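/- Let $\gamma_1,\gamma_2\in\mathbb R\setminus\{0\}$ with $\gamma_1+\gamma_2\neq 0$, let $b_1,b_2>0$, $d>2(b_1+b_2)$ and $\alpha\in(0,1)$. Write $\mathbb T$ for the unit circle, let $X$ be the space of $f\in C^{1+\alpha}(\mathbb T)$ of the form $f(w)=\sum_{n\ge1}a_n\overline w^{\,n}$ with $a_n\in\mathbb R$, with norm $\|f\|_X=\|f\|_\infty+\|f'\|_\infty+[f']_\alpha$, where $[\cdot]_\alpha$ is the Hölder seminorm. For $\varepsilon\in\mathbb R$ and $f_1,f_2\in X$ put $\phi_j(\varepsilon,w)=w+\varepsilon b_jf_j(w)$. When $\phi_j$ extends to a conformal map from $\{|w|>1\}$, continuous and injective on $\{|w|\ge1\}$ and normalized by $\phi_j(\varepsilon,w)=w+o(1)$ at infinity, onto the exterior of a domain $D_j^\varepsilon$ with $0\in D_j^\varepsilon\subset B(0,2)$, consider for $\varepsilon\ne0$ the patches $\tilde D_1^\varepsilon=\varepsilon b_1D_1^\varepsilon$ and $\tilde D_2^\varepsilon=d-\varepsilon b_2D_2^\varepsilon$ carrying the constant vorticities $\gamma_j/(\varepsilon^2b_j^2)$.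 They induce the velocity $v$ given by $$\overline{v(z)}=\sum_{j=1}^2\frac{i\gamma_j}{2\varepsilon^2b_j^2}\,\frac1{2\pi i}\int_{\partial\tilde D_j^\varepsilon}\frac{\overline\xi-\overline z}{\xi-z}\,d\xi .$$ The pair is called co-rotating with angular velocity $\Omega\in\mathbb R$ and centre of rotation $Z\in\mathbb R$ if $\mathrm{Re}\{(-i\Omega(\overline z-Z)-\overline{v(z)})\,\vec n(z)\}=0$ for all $z\in\partial\tilde D_1^\varepsilon\cup\partial\tilde D_2^\varepsilon$, where $\vec n$ is the exterior normal. For $\varepsilon_0>0$, a co-rotating branch on $[-\varepsilon_0,\varepsilon_0]$ is a $C^1$ curve $\varepsilon\mapsto(\Omega(\varepsilon),Z(\varepsilon),f_1(\varepsilon),f_2(\varepsilon))\in\mathbb R\times\mathbb R\times X\times X$ with $\|f_j(\varepsilon)\|_X<1$, with initial value $$(\Omega,Z,f_1,f_2)(0)=\Big(\frac{\gamma_1+\gamma_2}{2d^2},\ \frac{\gamma_2d}{\gamma_1+\gamma_2},\ 0,\ 0\Big),$$ such that the maps $\phi_j(\varepsilon,\cdot)$ are conformal parametrizations as above for all $|\varepsilon|\le\varepsilon_0$,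 and such that for all $0<|\varepsilon|\le\varepsilon_0$ the corresponding pair of patches is co-rotating with angular velocity $\Omega(\varepsilon)$ and centre $Z(\varepsilon)$. Then a co-rotating branch exists for some $\varepsilon_0\in(0,\tfrac12)$. Moreover, every co-rotating branch (for any $\varepsilon_0>0$) has the following expansions as $\varepsilon\to0$, where $\delta_j=\gamma_{3-j}/\gamma_j$. For $j=1,2$, uniformly in $w\in\mathbb T$, $$\begin{aligned}\phi_j(\varepsilon,w)=w&+\delta_j\Big(\frac{\varepsilon b_j}{d}\Big)^2\overline w+\frac{\delta_j}{2}\Big(\frac{\varepsilon b_j}{d}\Big)^3\overline w^2+\frac{\delta_j}{3}\Big(\frac{\varepsilon b_j}{d}\Big)^4\big(\overline w^3+6(1+\delta_j)\overline w\big)\\&+\frac{\delta_j}{4}\Big(\frac{\varepsilon b_j}{d}\Big)^5\big(\overline w^4+3(1+\delta_j)\overline w^2\big)+o(\varepsilon^5).\end{aligned}$$ The angular velocity satisfies $$\Omega(\varepsilon)=\frac{\gamma_1+\gamma_2}{2d^2}+\frac{\varepsilon^4}{2d^6}\big(\gamma_1b_2^4+\gamma_2b_1^4\big)+o(\varepsilon^4),$$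 and the centre of rotation satisfies $$Z(\varepsilon)=\frac{\gamma_2d}{\gamma_1+\gamma_2}+\frac{\varepsilon^4}{d^3(\gamma_1+\gamma_2)^2}\Big(\frac{\gamma_2^3}{\gamma_1}b_1^4-\frac{\gamma_1^3}{\gamma_2}b_2^4\Big)+o(\varepsilon^4).$$ -/

import Mathlib

open Filter Topology Set Asymptotics
open scoped NNReal ENNReal ComplexConjugate

namespace VortexPair

noncomputable section

/-! ### Functions on the unit circle -/

/-- `f : 𝕋 → ℂ` is differentiable along the circle. -/
def CircleDifferentiable (f : Circle → ℂ) : Prop :=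
  ∀ w : Circle, DifferentiableAt ℝ (fun t : ℝ => f (w * Circle.exp t)) 0

/-- The derivative `f'(w) = df/dw` along the circle: since `w e^{it}` has velocity `i w` at `t = 0`,
it is `(d/dt f(w e^{it}))|_{t=0} / (i w)`. -/
def circleDeriv (f : Circle → ℂ) (w : Circle) : ℂ :=
  deriv (fun t : ℝ => f (w * Circle.exp t)) 0 / (Complex.I * (w : ℂ))

/-- The `C^{1+α}(𝕋)` norm `‖f‖_∞ + ‖f'‖_∞ + [f']_α` (used for differentiable `f`). -/
def holderNorm (α : ℝ≥0) (f : Circle → ℂ) : ℝ≥0∞ :=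
  (⨆ w : Circle, ‖f w‖ₑ) + (⨆ w : Circle, ‖circleDeriv f w‖ₑ) + eHolderNorm α (circleDeriv f)

/-- The space of `f ∈ C^{1+α}(𝕋)` of the form `f(w) = ∑_{n ≥ 1} a_n w^{-n}` with `a_n` real. -/
structure MemX (α : ℝ≥0) (f : Circle → ℂ) : Prop where
  differentiable : CircleDifferentiable f
  norm_lt_top : holderNorm α f < ∞
  series : ∃ a : ℕ → ℝ, ∀ w : Circle, HasSum (fun n : ℕ => (a n : ℂ) * conj (w : ℂ) ^ (n + 1)) (f w)

/-- `f : s → X` is continuously differentiable for the `C^{1+α}` norm, with `s` a real interval. -/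
def IsC1Curve (α : ℝ≥0) (s : Set ℝ) (f : ℝ → Circle → ℂ) : Prop :=
  (∀ ε ∈ s, MemX α (f ε)) ∧
  ∃ f' : ℝ → Circle → ℂ, (∀ ε ∈ s, MemX α (f' ε)) ∧
    (∀ ε ∈ s, Tendsto
      (fun η : ℝ => holderNorm α (fun w => (f η w - f ε w) / ((η - ε : ℝ) : ℂ) - f' ε w))
      (𝓝[s \ {ε}] ε) (𝓝 0)) ∧
    (∀ ε ∈ s, Tendsto (fun η : ℝ => holderNorm α (fun w => f' η w - f' ε w)) (𝓝[s] ε) (𝓝 0))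

/-- The contour mean `(1/2πi) ∫ k(ξ) dξ` along the closed curve parametrized by `z : 𝕋 → ℂ`. -/
def contourMean (z : Circle → ℂ) (k : ℂ → ℂ) : ℂ :=
  (2 * (Real.pi : ℂ) * Complex.I)⁻¹ *
    ∫ t in (0 : ℝ)..(2 * Real.pi),
      k (z (Circle.exp t)) * circleDeriv z (Circle.exp t) * (Complex.I * (Circle.exp t : ℂ))

/-! ### Pairs of patches -/

/-- `φ` is the boundary value of a conformal map `Φ` of the exterior of the unit disc, normalized by
`Φ(w) = w + o(1)` at infinity, onto the exterior of a domain `D` (the complement of the range of `Φ`)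
which contains the origin and lies in the disc of radius `2` centred at the origin. -/
def IsConformalParam (φ : Circle → ℂ) : Prop :=
  ∃ Φ : ℂ → ℂ,
    ContinuousOn Φ {w | 1 ≤ ‖w‖} ∧
    DifferentiableOn ℂ Φ {w | 1 < ‖w‖} ∧
    InjOn Φ {w | 1 ≤ ‖w‖} ∧
    Tendsto (fun w => Φ w - w) (Bornology.cobounded ℂ) (𝓝 0) ∧
    (∀ w : Circle, Φ w = φ w) ∧
    (0 : ℂ) ∈ (Φ '' {w | 1 ≤ ‖w‖})ᶜ ∧
    (Φ '' {w | 1 ≤ ‖w‖})ᶜ ⊆ Metric.ball 0 2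

/-- The parametrization `φ_j(w) = w + ε b_j f_j(w)`. -/
def conformalMap (b : Fin 2 → ℝ) (ε : ℝ) (f : Fin 2 → Circle → ℂ) (j : Fin 2) (w : Circle) : ℂ :=
  (w : ℂ) + (ε : ℂ) * (b j : ℂ) * f j w

/-- The boundaries `ε b_1 φ_1` and `d - ε b_2 φ_2` of the two patches `ε b_1 D_1`, `d - ε b_2 D_2`. -/
def patchBoundary (b : Fin 2 → ℝ) (d ε : ℝ) (φ : Fin 2 → Circle → ℂ) : Fin 2 → Circle → ℂ :=
  ![fun w => (ε : ℂ) * (b 0 : ℂ) * φ 0 w, fun w => (d : ℂ) - (ε : ℂ) * (b 1 : ℂ) * φ 1 w]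

/-- The complex conjugate of the velocity at `p` induced by two patches with boundaries `z_1`, `z_2`
and constant vorticities `γ_j / (ε² b_j²)`: the Biot-Savart law written as a contour integral. -/
def conjVelocity (γ b : Fin 2 → ℝ) (ε : ℝ) (z : Fin 2 → Circle → ℂ) (p : ℂ) : ℂ :=
  ∑ j : Fin 2, Complex.I * (γ j : ℂ) / (2 * (ε : ℂ) ^ 2 * (b j : ℂ) ^ 2) *
    contourMean (z j) (fun ξ => (conj ξ - conj p) / (ξ - p))

/-- The pair of patches rotates uniformly about `Z` with angular velocity `Ω`: at every boundary point
the normal components of the velocity and of the rigid rotation `iΩ(z - Z)` agree. The vector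
`w z_j'(w)` is a positive multiple of the outer unit normal. -/
def RotatesUniformly (γ b : Fin 2 → ℝ) (ε Ω Z : ℝ) (z : Fin 2 → Circle → ℂ) : Prop :=
  ∀ (j : Fin 2) (w : Circle),
    ((-Complex.I * (Ω : ℂ) * (conj (z j w) - (Z : ℂ)) - conjVelocity γ b ε z (z j w)) *
      ((w : ℂ) * circleDeriv (z j) w)).re = 0

/-- A `C¹` branch `ε ↦ (Ω, Z, f_1, f_2)` on `[-ε₀, ε₀]` of co-rotating pairs of patches emanating from
the pair of point vortices `πγ_1 δ_0`, `πγ_2 δ_d`. -/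
structure IsCorotatingBranch (α : ℝ≥0) (γ b : Fin 2 → ℝ) (d ε₀ : ℝ)
    (Ω Z : ℝ → ℝ) (f : ℝ → Fin 2 → Circle → ℂ) : Prop where
  contDiff_Ω : ContDiffOn ℝ 1 Ω (Icc (-ε₀) ε₀)
  contDiff_Z : ContDiffOn ℝ 1 Z (Icc (-ε₀) ε₀)
  contDiff_f : ∀ j, IsC1Curve α (Icc (-ε₀) ε₀) (fun ε => f ε j)
  norm_f_lt : ∀ ε ∈ Icc (-ε₀) ε₀, ∀ j, holderNorm α (f ε j) < 1
  Ω_zero : Ω 0 = (γ 0 + γ 1) / (2 * d ^ 2)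
  Z_zero : Z 0 = γ 1 * d / (γ 0 + γ 1)
  f_zero : ∀ j w, f 0 j w = 0
  conformal : ∀ ε ∈ Icc (-ε₀) ε₀, ∀ j, IsConformalParam (conformalMap b ε (f ε) j)
  rotates : ∀ ε ∈ Icc (-ε₀) ε₀, ε ≠ 0 →
    RotatesUniformly γ b ε (Ω ε) (Z ε) (patchBoundary b d ε (conformalMap b ε (f ε)))

/-- The expansion up to order `ε⁵` of the conformal parametrization of a patch, as a function of
`δ` and `x = ε b / d`. -/
def conformalExpansion (δ x : ℝ) (w : Circle) : ℂ :=
  (w : ℂ) + (δ : ℂ) * (x : ℂ) ^ 2 * conj (w : ℂ)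
    + (δ : ℂ) / 2 * (x : ℂ) ^ 3 * conj (w : ℂ) ^ 2
    + (δ : ℂ) / 3 * (x : ℂ) ^ 4 * (conj (w : ℂ) ^ 3 + 6 * (1 + (δ : ℂ)) * conj (w : ℂ))
    + (δ : ℂ) / 4 * (x : ℂ) ^ 5 * (conj (w : ℂ) ^ 4 + 3 * (1 + (δ : ℂ)) * conj (w : ℂ) ^ 2)

end

end VortexPair

namespace VortexPair

open MeasureTheory

/-! ### Means over the unit circle -/

/-! The rotation condition is singular at `ε = 0`, because the vorticities blow up. The singular
part is the velocity that a circular patch induces on its own boundary; it contributes a real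
constant to a quantity whose imaginary part matters, and drops out. Moreover, all first order
contributions of the deformation to the self-induced velocity have mean zero, since a profile and
its difference quotients carry only negative frequencies. What remains (`rotatesUniformly_iff`) is
`Im F_j = 0` on the circle, where `F_j` is `reducedField`. The unknowns are `f_1`, `f_2` and the two
speeds `A_1 = Ω Z`, `A_2 = Ω (d - Z)`, from which `Ω = (A_1 + A_2) / d`. At `ε = 0` the field is
`-(γ_j / 2) f_j' + (γ_{3-j} / (2 d) - A_j) w`. The frequencies of `f_j'` are at most `-2` and that
of `w` is `1`, so the imaginary part of this expression determines both `f_j'` and `A_j`. Both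
halves of the theorem rest on this.

Expansions. The fifth order expansion of the statement, together with suitable speeds
(`approxProfile`, `approxSpeed`), satisfies the equations up to `O(ε⁵)`: modulo such terms the field
is a polynomial in `w` and its conjugate, symmetric in the two and with real coefficients, hence
real (`uniformO_reducedField_approx`). Parseval makes the linear part coercive: the mean of `(Im
(γ/2 h' + α w))²` is `γ²/8` times the mean of `|h'|²` plus `α²/2` (`IsProfile.circleMean_im_sq`).
The rest of the field is Lipschitz with a constant `O(ε)`, where the error is measured by the mean
square of `h'`, by the speeds and by the pointwise size of `h'` (`exists_reducedField_lipschitz`).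
For small `ε` this is absorbed, so every rotating pair with bounded profiles is within `O(ε⁵)` of
the approximate one (`exists_dist_approx_le`). This is a direct estimate that uses no uniqueness
from the implicit function theorem, so it applies to every branch. The map `φ_j` carries one more
factor `ε`, and the expansions of `Ω` and `Z` follow from those of the two speeds.

Existence. Profiles analytic across the circle are coordinatized by `ℓ¹`, and a spare coordinate of
each one encodes the speed of its patch. The integrands become bounded operators on weighted `ℓ¹`
Laurent coefficients in `(τ, w)`, generated by shifts. In this Banach algebra the denominators can
be inverted smoothly, and evaluation at a point is an eigenfunctional of all operators involved,
which returns the original integrand. In these coordinates the map `residual` is exactly the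
identity at `ε = 0` (`residual_zero`), so the implicit function theorem yields the branch. -/

/-- The normalized Lebesgue measure on `(-π, π]`. -/
noncomputable def angleMeasure : Measure ℝ :=
  ENNReal.ofReal (2 * Real.pi)⁻¹ • (volume.restrict (Ioc (-Real.pi) Real.pi))

instance isProbabilityMeasure_angleMeasure : IsProbabilityMeasure angleMeasure := by
  constructor
  have h : (0 : ℝ) < 2 * Real.pi := by positivity
  simp only [angleMeasure, Measure.smul_apply, Measure.restrict_apply MeasurableSet.univ,
    univ_inter, Real.volume_Ioc, smul_eq_mul]
  rw [← ENNReal.ofReal_mul (by positivity), show Real.pi - -Real.pi = 2 * Real.pi by ring,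
    inv_mul_cancel₀ h.ne', ENNReal.ofReal_one]

/-- The mean of a function over the unit circle. -/
noncomputable def circleMean {E : Type*} [NormedAddCommGroup E] [NormedSpace ℝ E]
    (F : Circle → E) : E :=
  ∫ t, F (Circle.exp t) ∂angleMeasure

section

variable {E : Type*} [NormedAddCommGroup E] [NormedSpace ℝ E]

theorem circleMean_eq_intervalIntegral_symm (F : Circle → E) :
    circleMean F = (2 * Real.pi)⁻¹ • ∫ t in (-Real.pi)..Real.pi, F (Circle.exp t) := by
  rw [circleMean, angleMeasure, integral_smul_measure, ENNReal.toReal_ofReal (by positivity),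
    intervalIntegral.integral_of_le (by linarith [Real.pi_pos])]

theorem intervalIntegral_circle_shift (F : Circle → E) (a : ℝ) :
    ∫ t in (-Real.pi)..Real.pi, F (Circle.exp t) = ∫ t in a..(a + 2 * Real.pi), F (Circle.exp t) := by
  have hp : Function.Periodic (fun t : ℝ => F (Circle.exp t)) (2 * Real.pi) := fun t => by
    simp only [Circle.periodic_exp t]
  have := hp.intervalIntegral_add_eq (-Real.pi) a
  rwa [show -Real.pi + 2 * Real.pi = Real.pi by ring] at this

theorem circleMean_eq_intervalIntegral (F : Circle → E) :
    circleMean F = (2 * Real.pi)⁻¹ • ∫ t in (0 : ℝ)..(2 * Real.pi), F (Circle.exp t) := by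
  rw [circleMean_eq_intervalIntegral_symm, intervalIntegral_circle_shift F 0, zero_add]

/-- Multiplication by `w` translates the angle by `arg w`, and a periodic function has the same
integral over every period. -/
theorem circleMean_rotate (F : Circle → E) (w : Circle) :
    circleMean (fun τ => F (w * τ)) = circleMean F := by
  rw [circleMean_eq_intervalIntegral, circleMean_eq_intervalIntegral_symm F,
    intervalIntegral_circle_shift F (w : ℂ).arg]
  have h := intervalIntegral.integral_comp_add_left (a := 0) (b := 2 * Real.pi)
    (fun t : ℝ => F (Circle.exp t)) (w : ℂ).arg
  simp only [add_zero] at h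
  rw [← h]
  simp only [Circle.exp_add, Circle.exp_arg]

end

/-- A function on the circle which is bounded and measurable in the angle. -/
structure Tame (F : Circle → ℂ) : Prop where
  meas : Measurable (fun t : ℝ => F (Circle.exp t))
  bdd : ∃ C : ℝ, ∀ τ, ‖F τ‖ ≤ C

namespace Tame

variable {F G : Circle → ℂ}

theorem integrable (hF : Tame F) : Integrable (fun t : ℝ => F (Circle.exp t)) angleMeasure := by
  obtain ⟨C, hC⟩ := hF.bdd
  exact Integrable.of_bound hF.meas.aestronglyMeasurable C (Eventually.of_forall fun t => hC _)

theorem of_continuous (h : Continuous F) : Tame F := by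
  refine ⟨(h.comp Circle.exp.continuous).measurable, ?_⟩
  obtain ⟨C, hC⟩ := isCompact_univ.exists_bound_of_continuousOn h.continuousOn
  exact ⟨C, fun τ => hC τ (mem_univ _)⟩

theorem const (c : ℂ) : Tame (fun _ => c) := of_continuous continuous_const

theorem add (hF : Tame F) (hG : Tame G) : Tame (fun τ => F τ + G τ) := by
  obtain ⟨C, hC⟩ := hF.bdd
  obtain ⟨D, hD⟩ := hG.bdd
  exact ⟨hF.meas.add hG.meas, C + D, fun τ => (norm_add_le _ _).trans (add_le_add (hC τ) (hD τ))⟩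

theorem sub (hF : Tame F) (hG : Tame G) : Tame (fun τ => F τ - G τ) := by
  obtain ⟨C, hC⟩ := hF.bdd
  obtain ⟨D, hD⟩ := hG.bdd
  exact ⟨hF.meas.sub hG.meas, C + D, fun τ => (norm_sub_le _ _).trans (add_le_add (hC τ) (hD τ))⟩

theorem mul (hF : Tame F) (hG : Tame G) : Tame (fun τ => F τ * G τ) := by
  obtain ⟨C, hC⟩ := hF.bdd
  obtain ⟨D, hD⟩ := hG.bdd
  refine ⟨hF.meas.mul hG.meas, C * D, fun τ => ?_⟩
  rw [norm_mul]
  exact mul_le_mul (hC τ) (hD τ) (norm_nonneg _) ((norm_nonneg _).trans (hC τ))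

theorem star (hF : Tame F) : Tame (fun τ => conj (F τ)) := by
  obtain ⟨C, hC⟩ := hF.bdd
  exact ⟨Complex.continuous_conj.measurable.comp hF.meas, C, fun τ => by
    rw [Complex.norm_conj]; exact hC τ⟩

theorem inv (hF : Tame F) {c : ℝ} (hc : 0 < c) (h : ∀ τ, c ≤ ‖F τ‖) : Tame (fun τ => (F τ)⁻¹) := by
  refine ⟨hF.meas.inv, c⁻¹, fun τ => ?_⟩
  rw [norm_inv]
  exact inv_anti₀ hc (h τ)

theorem div (hF : Tame F) (hG : Tame G) {c : ℝ} (hc : 0 < c) (h : ∀ τ, c ≤ ‖G τ‖) :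
    Tame (fun τ => F τ / G τ) := by
  simp only [div_eq_mul_inv]
  exact hF.mul (hG.inv hc h)

theorem norm (hF : Tame F) : Integrable (fun t : ℝ => ‖F (Circle.exp t)‖) angleMeasure :=
  hF.integrable.norm

end Tame

variable {F G : Circle → ℂ}

theorem circleMean_add (hF : Tame F) (hG : Tame G) :
    circleMean (fun τ => F τ + G τ) = circleMean F + circleMean G :=
  integral_add hF.integrable hG.integrable

theorem circleMean_sub (hF : Tame F) (hG : Tame G) :
    circleMean (fun τ => F τ - G τ) = circleMean F - circleMean G :=
  integral_sub hF.integrable hG.integrable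

theorem circleMean_const_mul (c : ℂ) (F : Circle → ℂ) :
    circleMean (fun τ => c * F τ) = c * circleMean F :=
  integral_const_mul c _

theorem circleMean_mul_const (c : ℂ) (F : Circle → ℂ) :
    circleMean (fun τ => F τ * c) = circleMean F * c :=
  integral_mul_const c _

theorem circleMean_const (c : ℂ) : circleMean (fun _ => c) = c := by
  simp [circleMean]

theorem circleMean_conj (F : Circle → ℂ) :
    circleMean (fun τ => conj (F τ)) = conj (circleMean F) :=
  integral_conj

theorem norm_circleMean_le {C : ℝ} (h : ∀ τ, ‖F τ‖ ≤ C) : ‖circleMean F‖ ≤ C := by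
  have := norm_integral_le_of_norm_le_const (μ := angleMeasure) (f := fun t => F (Circle.exp t))
    (Eventually.of_forall fun t => h (Circle.exp t))
  simpa [circleMean] using this

/-- One point of the circle corresponds to one angle in `(-π, π]`, a null set. This allows closed
forms of difference quotients to be used in means, although `diffQuot` has the value `0 / 0 = 0` on
the diagonal. -/
theorem circleMean_congr {w : Circle} (h : ∀ τ, τ ≠ w → F τ = G τ) : circleMean F = circleMean G := by
  apply integral_congr_ae
  rw [angleMeasure]
  refine Measure.ae_smul_measure ?_ _
  have h1 : ∀ᵐ t ∂(volume.restrict (Ioc (-Real.pi) Real.pi)), t ≠ (w : ℂ).arg :=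
    ae_restrict_of_ae (Measure.ae_ne volume _)
  filter_upwards [h1, ae_restrict_mem measurableSet_Ioc] with t ht ht'
  refine h _ fun e => ht ?_
  rw [← e, Circle.arg_exp ht'.1 ht'.2]

/-- For `n ≠ 0`, rotation by the angle `π / n` multiplies `τ ^ n` by `-1` and preserves the mean,
which therefore equals its own negative. -/
theorem circleMean_zpow (n : ℤ) : circleMean (fun τ => (τ : ℂ) ^ n) = if n = 0 then 1 else 0 := by
  split_ifs with h
  · simp [h, circleMean_const]
  · have h1 := circleMean_rotate (fun τ : Circle => (τ : ℂ) ^ n) (Circle.exp (Real.pi / n))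
    have hn : (n : ℝ) ≠ 0 := by exact_mod_cast h
    have h2 : ((Circle.exp (Real.pi / n) : Circle) : ℂ) ^ n = -1 := by
      rw [← Circle.coe_zpow, ← Circle.exp_intCast_mul, mul_div_cancel₀ _ hn]
      simp [Circle.coe_exp]
    simp only [Circle.coe_mul, mul_zpow, h2, circleMean_const_mul] at h1
    linear_combination (-1 / 2 : ℂ) * h1

/-- Parseval's identity on an interval of length `2π`, with Fourier coefficients written as means.
-/
theorem hasSum_sq_circleMean (hF : Tame F) :
    HasSum (fun k : ℤ => ‖circleMean (fun τ => (τ : ℂ) ^ (-k) * F τ)‖ ^ 2)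
      (circleMean (fun τ => ‖F τ‖ ^ 2)) := by
  have hab : (0 : ℝ) < 2 * Real.pi := by positivity
  have hL : MemLp (fun t : ℝ => F (Circle.exp t)) 2 (volume.restrict (Ioc 0 (2 * Real.pi))) := by
    obtain ⟨C, hC⟩ := hF.bdd
    exact MemLp.of_bound hF.meas.aestronglyMeasurable C (Eventually.of_forall fun t => hC _)
  have h := hasSum_sq_fourierCoeffOn hab hL
  rw [circleMean_eq_intervalIntegral (E := ℝ)]
  rw [sub_zero] at h
  convert h using 3 with k
  rw [fourierCoeffOn_eq_integral, circleMean_eq_intervalIntegral (E := ℂ)]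
  rw [one_div]
  have hI : ∫ t in (0 : ℝ)..(2 * Real.pi), ((Circle.exp t : Circle) : ℂ) ^ (-k) * F (Circle.exp t) =
      ∫ t in (0 : ℝ)..(2 * Real.pi), (fourier (-k)) (t : AddCircle (2 * Real.pi - 0)) •
        F (Circle.exp t) := by
    apply intervalIntegral.integral_congr
    intro t _
    simp only [smul_eq_mul]
    congr 1
    rw [fourier_coe_apply, Circle.coe_exp, ← Complex.exp_int_mul]
    congr 1
    have : (Real.pi : ℂ) ≠ 0 := by exact_mod_cast Real.pi_ne_zero
    push_cast
    field_simp
    ring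
  rw [hI, sub_zero]

/-! ### Differentiation along the circle -/

theorem CircleDifferentiable.hasDerivAt {f : Circle → ℂ} (hf : CircleDifferentiable f) (w : Circle)
    (t : ℝ) : HasDerivAt (fun s : ℝ => f (w * Circle.exp s))
      (circleDeriv f (w * Circle.exp t) * (Complex.I * (w * Circle.exp t : Circle))) t := by
  have h := (hf (w * Circle.exp t)).hasDerivAt
  have h2 : circleDeriv f (w * Circle.exp t) * (Complex.I * (w * Circle.exp t : Circle)) =
      deriv (fun s : ℝ => f (w * Circle.exp t * Circle.exp s)) 0 := by
    rw [circleDeriv, div_mul_cancel₀]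
    exact mul_ne_zero Complex.I_ne_zero (Circle.coe_ne_zero _)
  rw [h2]
  have h3 : HasDerivAt (fun s : ℝ => f (w * Circle.exp t * Circle.exp (s - t)))
      (deriv (fun s : ℝ => f (w * Circle.exp t * Circle.exp s)) 0) t := by
    have h0 : HasDerivAt (fun s : ℝ => f (w * Circle.exp t * Circle.exp s))
      (deriv (fun s : ℝ => f (w * Circle.exp t * Circle.exp s)) 0) (t - t) := by rwa [sub_self]
    exact HasDerivAt.comp_sub_const t t h0
  refine h3.congr_of_eventuallyEq (Eventually.of_forall fun s => ?_)
  simp only [mul_assoc, ← Circle.exp_add]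
  congr 3
  ring

theorem hasDerivAt_circleExp (w : Circle) (t : ℝ) :
    HasDerivAt (fun s : ℝ => ((w * Circle.exp s : Circle) : ℂ))
      (Complex.I * (w * Circle.exp t : Circle)) t := by
  simp only [Circle.coe_mul, Circle.coe_exp]
  have h : HasDerivAt (fun s : ℝ => (s : ℂ) * Complex.I) Complex.I t := by
    simpa using (Complex.ofRealCLM.hasDerivAt (x := t)).mul_const Complex.I
  exact (h.cexp.const_mul (w : ℂ)).congr_deriv (by ring)

theorem CircleDifferentiable.of_hasDerivAt {f f' : Circle → ℂ}
    (h : ∀ w, HasDerivAt (fun s : ℝ => f (w * Circle.exp s)) (f' w * (Complex.I * w)) 0) :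
    CircleDifferentiable f ∧ circleDeriv f = f' := by
  refine ⟨fun w => (h w).differentiableAt, funext fun w => ?_⟩
  rw [circleDeriv, (h w).deriv, mul_div_cancel_right₀]
  exact mul_ne_zero Complex.I_ne_zero (Circle.coe_ne_zero _)

theorem CircleDifferentiable.hasDerivAt_zero {f : Circle → ℂ} (hf : CircleDifferentiable f)
    (w : Circle) : HasDerivAt (fun s : ℝ => f (w * Circle.exp s))
      (circleDeriv f w * (Complex.I * w)) 0 := by
  simpa using hf.hasDerivAt w 0

theorem CircleDifferentiable.continuous {f : Circle → ℂ} (hf : CircleDifferentiable f) :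
    Continuous f := by
  have h : Continuous (fun s : ℝ => f (Circle.exp s)) := by
    refine continuous_iff_continuousAt.2 fun t => ?_
    simpa using (hf.hasDerivAt 1 t).continuousAt
  refine continuous_iff_continuousAt.2 fun w => ?_
  obtain ⟨t, rfl⟩ := Circle.exp_surjective w
  -- `Circle.exp` is a local homeomorphism, so continuity can be tested in the angle.
  rw [ContinuousAt, ← isLocalHomeomorph_circleExp.map_nhds_eq t, tendsto_map'_iff]
  exact h.continuousAt

theorem circleDifferentiable_affine {f : Circle → ℂ} (hf : CircleDifferentiable f) (c p q : ℂ) :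
    CircleDifferentiable (fun w => c + p * w + q * f w) ∧
      circleDeriv (fun w => c + p * w + q * f w) = fun w => p + q * circleDeriv f w := by
  apply CircleDifferentiable.of_hasDerivAt
  intro w
  have h1 := hasDerivAt_circleExp w 0
  have h2 := hf.hasDerivAt_zero w
  simp only [Circle.exp_zero, mul_one] at h1
  exact (((h1.const_mul p).const_add c).add (h2.const_mul q)).congr_deriv (by ring)

theorem CircleDifferentiable.sub {f g : Circle → ℂ} (hf : CircleDifferentiable f)
    (hg : CircleDifferentiable g) : CircleDifferentiable (fun w => f w - g w) ∧
      circleDeriv (fun w => f w - g w) = fun w => circleDeriv f w - circleDeriv g w := by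
  apply CircleDifferentiable.of_hasDerivAt
  intro w
  exact ((hf.hasDerivAt_zero w).sub (hg.hasDerivAt_zero w)).congr_deriv (by ring)

/-- The chord is `2 |sin (arg / 2)|`, and Jordan's inequality bounds this sine from below. -/
theorem abs_arg_le_norm_sub_one (z : Circle) : |(z : ℂ).arg| ≤ Real.pi / 2 * ‖(z : ℂ) - 1‖ := by
  have h0 : ‖(z : ℂ) - 1‖ = ‖2 * Real.sin ((z : ℂ).arg / 2)‖ := by
    rw [← Complex.norm_exp_I_mul_ofReal_sub_one, mul_comm, ← Circle.coe_exp, Circle.exp_arg]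
  have h1 := Complex.abs_arg_le_pi (z : ℂ)
  have h2 : 2 / Real.pi * (|(z : ℂ).arg| / 2) ≤ Real.sin (|(z : ℂ).arg| / 2) :=
    Real.mul_le_sin (by positivity) (by linarith)
  have h3 : |Real.sin ((z : ℂ).arg / 2)| = |Real.sin (|(z : ℂ).arg| / 2)| := by
    rcases abs_cases (z : ℂ).arg with ⟨h, _⟩ | ⟨h, _⟩ <;> rw [h]
    rw [neg_div, Real.sin_neg, abs_neg]
  rw [h0, Real.norm_eq_abs, abs_mul, h3, abs_two]
  have h4 := h2.trans (le_abs_self _)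
  have hp := Real.pi_pos
  rw [div_mul_div_comm, div_le_iff₀ (by positivity)] at h4
  nlinarith

/-- The mean value inequality along the arc, whose length is at most `π / 2` times the chord; `2` is
a round bound for `π / 2`. -/
theorem norm_sub_le_of_circleDeriv {f : Circle → ℂ} (hf : CircleDifferentiable f) {C : ℝ}
    (hC : ∀ w, ‖circleDeriv f w‖ ≤ C) (τ w : Circle) : ‖f τ - f w‖ ≤ 2 * C * ‖(τ : ℂ) - w‖ := by
  have h0 : ∀ s : ℝ, ‖f (w * Circle.exp s) - f (w * Circle.exp 0)‖ ≤ C * ‖s - 0‖ := fun s =>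
    convex_univ.norm_image_sub_le_of_norm_hasDerivWithin_le (𝕜 := ℝ)
      (fun t _ => (hf.hasDerivAt w t).hasDerivWithinAt)
      (fun t _ => by
        rw [norm_mul, norm_mul, Complex.norm_I, Circle.norm_coe, one_mul, mul_one]
        exact hC _) (mem_univ _) (mem_univ _)
  have h1 := h0 ((w⁻¹ * τ : Circle) : ℂ).arg
  rw [Circle.exp_arg, Circle.exp_zero, mul_one, mul_inv_cancel_left, sub_zero, Real.norm_eq_abs] at h1
  have h2 := abs_arg_le_norm_sub_one (w⁻¹ * τ)
  have h3 : ‖((w⁻¹ * τ : Circle) : ℂ) - 1‖ = ‖(τ : ℂ) - w‖ := by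
    have : (τ : ℂ) - w = w * (((w⁻¹ * τ : Circle) : ℂ) - 1) := by
      rw [Circle.coe_mul, Circle.coe_inv, mul_sub, mul_inv_cancel_left₀ (Circle.coe_ne_zero w), mul_one]
    rw [this, norm_mul, Circle.norm_coe, one_mul]
  rw [h3] at h2
  have hC0 : 0 ≤ C := (norm_nonneg _).trans (hC 1)
  have h4 : Real.pi / 2 ≤ 2 := by linarith [Real.pi_le_four]
  calc ‖f τ - f w‖ ≤ C * |((w⁻¹ * τ : Circle) : ℂ).arg| := h1
    _ ≤ C * (2 * ‖(τ : ℂ) - w‖) := by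
        gcongr
        exact h2.trans (by gcongr)
    _ = _ := by ring

/-! ### Fourier series with negative frequencies and real coefficients. -/

theorem hasSum_congr_of_forall {ι E : Type*} [AddCommMonoid E] [TopologicalSpace E] {f g : ι → E}
    {x : E} (h : ∀ i, f i = g i) : HasSum f x ↔ HasSum g x := by
  rw [funext h]

theorem conj_circle (w : Circle) : conj (w : ℂ) = (w : ℂ)⁻¹ := by
  rw [← Circle.coe_inv_eq_conj, Circle.coe_inv]

theorem conj_circle_pow (w : Circle) (n : ℕ) : conj (w : ℂ) ^ n = (w : ℂ) ^ (-(n : ℤ)) := by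
  rw [conj_circle, zpow_neg, zpow_natCast, inv_pow]

theorem continuous_circle_coe : Continuous (fun τ : Circle => (τ : ℂ)) := continuous_subtype_val

theorem continuous_circle_zpow (k : ℤ) : Continuous (fun τ : Circle => (τ : ℂ) ^ k) := by
  simp only [← Circle.coe_zpow]
  exact continuous_circle_coe.comp (_root_.continuous_zpow k)

theorem norm_circle_zpow (w : Circle) (k : ℤ) : ‖(w : ℂ) ^ k‖ = 1 := by
  rw [← Circle.coe_zpow, Circle.norm_coe]

theorem hasSum_circleMean {c : ℕ → ℂ} (hc : Summable (fun n => ‖c n‖)) {g : ℕ → Circle → ℂ}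
    (hg : ∀ n, Tame (g n)) {K : ℝ} (hK : ∀ n τ, ‖g n τ‖ ≤ K) {F : Circle → ℂ}
    (hF : ∀ τ, HasSum (fun n => c n * g n τ) (F τ)) :
    HasSum (fun n => c n * circleMean (g n)) (circleMean F) := by
  have h := hasSum_integral_of_summable_integral_norm (μ := angleMeasure)
    (F := fun n t => c n * g n (Circle.exp t)) (fun n => (hg n).integrable.const_mul _) ?_
  · simp only [circleMean]
    have e : ∫ t, F (Circle.exp t) ∂angleMeasure =
        ∫ t, ∑' n, c n * g n (Circle.exp t) ∂angleMeasure :=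
      integral_congr_ae (Eventually.of_forall fun t => (hF _).tsum_eq.symm)
    rw [e]
    exact (hasSum_congr_of_forall fun n => (integral_const_mul _ _).symm).2 h
  · refine Summable.of_nonneg_of_le (fun n => integral_nonneg fun t => norm_nonneg _) (fun n => ?_)
      (hc.mul_right K)
    have := integral_mono_of_nonneg (μ := angleMeasure) (f := fun t => ‖c n * g n (Circle.exp t)‖)
      (g := fun _ => ‖c n‖ * K) (Eventually.of_forall fun t => norm_nonneg _) (integrable_const _)
      (Eventually.of_forall fun t => by
        simp only [norm_mul]
        exact mul_le_mul_of_nonneg_left (hK n _) (norm_nonneg _))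
    simpa using this

/-- `f` is a continuously differentiable function on the circle with the Fourier expansion
`∑ a_n w^{-(n+1)}`. -/
structure IsProfile (f : Circle → ℂ) (a : ℕ → ℝ) : Prop where
  diff : CircleDifferentiable f
  cont : Continuous (circleDeriv f)
  series : ∀ w : Circle, HasSum (fun n : ℕ => (a n : ℂ) * conj (w : ℂ) ^ (n + 1)) (f w)

/-- The difference quotient of a function on the circle. -/
noncomputable def diffQuot (f : Circle → ℂ) (τ w : Circle) : ℂ := (f τ - f w) / ((τ : ℂ) - w)

namespace IsProfile

variable {f g : Circle → ℂ} {a b : ℕ → ℝ}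

theorem sub (hf : IsProfile f a) (hg : IsProfile g b) :
    IsProfile (fun w => f w - g w) (fun n => a n - b n) := by
  obtain ⟨h1, h2⟩ := hf.diff.sub hg.diff
  refine ⟨h1, ?_, fun w => ?_⟩
  · rw [h2]
    exact hf.cont.sub hg.cont
  · refine (hasSum_congr_of_forall fun n => ?_).2 ((hf.series w).sub (hg.series w))
    push_cast
    ring

theorem circleDeriv_sub (hf : IsProfile f a) (hg : IsProfile g b) :
    circleDeriv (fun w => f w - g w) = fun w => circleDeriv f w - circleDeriv g w :=
  (hf.diff.sub hg.diff).2

theorem summable (hf : IsProfile f a) : Summable (fun n => ‖(a n : ℂ)‖) := by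
  have h := (hf.series 1).summable.norm
  simpa using h

theorem exists_bound (hf : IsProfile f a) : ∃ C, ∀ w, ‖circleDeriv f w‖ ≤ C :=
  (Tame.of_continuous hf.cont).bdd

theorem circleMean_zpow_mul (hf : IsProfile f a) (k : ℤ) :
    HasSum (fun n : ℕ => (a n : ℂ) * if k - (n + 1) = 0 then 1 else 0)
      (circleMean (fun τ => (τ : ℂ) ^ k * f τ)) := by
  have := hasSum_circleMean hf.summable (g := fun n τ => (τ : ℂ) ^ (k - (n + 1)))
    (F := fun τ => (τ : ℂ) ^ k * f τ)
    (fun n => Tame.of_continuous (continuous_circle_zpow _)) (K := 1)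
    (fun n τ => (norm_circle_zpow _ _).le) (fun τ => ?_)
  · simpa only [circleMean_zpow] using this
  · refine (hasSum_congr_of_forall fun n => ?_).2 ((hf.series τ).mul_left ((τ : ℂ) ^ k))
    rw [conj_circle_pow, sub_eq_add_neg, zpow_add₀ (Circle.coe_ne_zero τ)]
    push_cast
    ring

theorem circleMean_zpow_mul_nonpos (hf : IsProfile f a) {k : ℤ} (hk : k ≤ 0) :
    circleMean (fun τ => (τ : ℂ) ^ k * f τ) = 0 := by
  refine (hf.circleMean_zpow_mul _).unique ?_
  refine (hasSum_congr_of_forall fun m => ?_).2 hasSum_zero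
  rw [if_neg (by omega), mul_zero]

end IsProfile

/-- Integration by parts with the periodic function `τ ^ (k - 1) * f`. The exponent drops by one
because `circleDeriv` divides the angular derivative by `I * τ`. -/
theorem circleMean_zpow_mul_circleDeriv {f : Circle → ℂ} (hf : CircleDifferentiable f)
    (hc : Continuous (circleDeriv f)) (k : ℤ) :
    circleMean (fun τ => (τ : ℂ) ^ k * circleDeriv f τ) =
      (1 - k) * circleMean (fun τ => (τ : ℂ) ^ (k - 1) * f τ) := by
  rw [circleMean_eq_intervalIntegral, circleMean_eq_intervalIntegral, mul_smul_comm]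
  congr 1
  have hd : ∀ t : ℝ, HasDerivAt (fun s : ℝ => ((Circle.exp s : Circle) : ℂ) ^ (k - 1) * f (Circle.exp s))
      (Complex.I * ((Circle.exp t : ℂ) ^ k * circleDeriv f (Circle.exp t) -
        (1 - k) * ((Circle.exp t : ℂ) ^ (k - 1) * f (Circle.exp t)))) t := by
    intro t
    have h1 := hasDerivAt_circleExp 1 t
    have h2 := hf.hasDerivAt 1 t
    simp only [one_mul] at h1 h2
    have h3 : HasDerivAt (fun s : ℝ => ((Circle.exp s : Circle) : ℂ) ^ (k - 1))
        (((k - 1 : ℤ) : ℂ) * (Circle.exp t : ℂ) ^ (k - 1 - 1) * (Complex.I * (Circle.exp t : ℂ))) t :=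
      HasDerivAt.comp t (h₂ := fun z : ℂ => z ^ (k - 1))
        (hasDerivAt_zpow (k - 1) (Circle.exp t : ℂ) (Or.inl (Circle.coe_ne_zero _))) h1
    refine (h3.mul h2).congr_deriv ?_
    have e1 : (Circle.exp t : ℂ) ^ k = (Circle.exp t : ℂ) ^ (k - 1) * Circle.exp t := by
      rw [← zpow_add_one₀ (Circle.coe_ne_zero _), sub_add_cancel]
    have e2 : (Circle.exp t : ℂ) ^ (k - 1) = (Circle.exp t : ℂ) ^ (k - 1 - 1) * Circle.exp t := by
      rw [← zpow_add_one₀ (Circle.coe_ne_zero _), sub_add_cancel]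
    rw [e1, e2]
    push_cast
    ring
  have hct : Continuous (fun t : ℝ => (Circle.exp t : ℂ) ^ k * circleDeriv f (Circle.exp t)) :=
    ((continuous_circle_zpow k).mul hc).comp Circle.exp.continuous
  have hct2 : Continuous (fun t : ℝ => (Circle.exp t : ℂ) ^ (k - 1) * f (Circle.exp t)) :=
    ((continuous_circle_zpow (k - 1)).mul hf.continuous).comp Circle.exp.continuous
  have h := intervalIntegral.integral_eq_sub_of_hasDerivAt (a := 0) (b := 2 * Real.pi)
    (fun t _ => hd t) (by
      apply Continuous.intervalIntegrable
      exact continuous_const.mul (hct.sub (continuous_const.mul hct2)))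
  rw [Circle.exp_two_pi, Circle.exp_zero, sub_self, intervalIntegral.integral_const_mul,
    intervalIntegral.integral_sub (hct.intervalIntegrable _ _)
      ((hct2.const_mul (1 - (k : ℂ))).intervalIntegrable _ _),
    intervalIntegral.integral_const_mul] at h
  exact sub_eq_zero.1 ((mul_eq_zero.1 h).resolve_left Complex.I_ne_zero)

namespace IsProfile

variable {f g : Circle → ℂ} {a b : ℕ → ℝ}

/-- Differentiating `w ^ (-(n + 1))` gives the frequency `-(n + 2)`, so `f'` has no frequency above
`-2`. That the frequency `-1` is also absent later decouples `f'` from multiples of `w`. -/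
theorem circleMean_zpow_mul_circleDeriv_eq_zero (hf : IsProfile f a) {k : ℤ} (hk : k ≤ 1) :
    circleMean (fun τ => (τ : ℂ) ^ k * circleDeriv f τ) = 0 := by
  rw [circleMean_zpow_mul_circleDeriv hf.diff hf.cont, hf.circleMean_zpow_mul_nonpos (by omega),
    mul_zero]

theorem norm_diffQuot_le (hf : CircleDifferentiable f) {C : ℝ} (hC : ∀ w, ‖circleDeriv f w‖ ≤ C)
    (τ w : Circle) : ‖diffQuot f τ w‖ ≤ 2 * C := by
  have hC0 : 0 ≤ C := (norm_nonneg _).trans (hC 1)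
  rw [diffQuot, norm_div]
  exact div_le_of_le_mul₀ (norm_nonneg _) (by positivity) (norm_sub_le_of_circleDeriv hf hC τ w)

theorem tame_diffQuot (hf : IsProfile f a) (w : Circle) : Tame (fun τ => diffQuot f τ w) := by
  obtain ⟨C, hC⟩ := hf.exists_bound
  refine ⟨?_, 2 * C, fun τ => norm_diffQuot_le hf.diff hC τ w⟩
  have h1 : Measurable (fun t : ℝ => f (Circle.exp t)) :=
    (hf.diff.continuous.comp Circle.exp.continuous).measurable
  have h2 : Measurable (fun t : ℝ => (Circle.exp t : ℂ)) :=
    (continuous_circle_coe.comp Circle.exp.continuous).measurable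
  exact (h1.sub_const _).div (h2.sub_const _)

end IsProfile

/-- With the pole inside the disc, `1 / (τ - ρ)` is a geometric series in negative powers of `τ`,
and multiplication by `τ ^ k` with `k ≤ 0` keeps the frequencies negative. -/
theorem circleMean_zpow_div_sub {ρ : ℂ} (hρ : ‖ρ‖ < 1) {k : ℤ} (hk : k ≤ 0) :
    circleMean (fun τ => (τ : ℂ) ^ k * ((τ : ℂ) - ρ)⁻¹) = 0 := by
  have hs : Summable (fun n : ℕ => ‖ρ ^ n‖) := by
    simp only [norm_pow]
    exact summable_geometric_of_lt_one (norm_nonneg _) hρ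
  refine (hasSum_circleMean hs (g := fun n τ => (τ : ℂ) ^ (k - (n + 1)))
    (fun n => Tame.of_continuous (continuous_circle_zpow _)) (K := 1)
    (fun n τ => (norm_circle_zpow _ _).le) (fun τ => ?_)).unique ?_
  · have hτ := Circle.coe_ne_zero τ
    have h1 : ‖ρ * (τ : ℂ)⁻¹‖ < 1 := by
      rw [norm_mul, norm_inv, Circle.norm_coe, inv_one, mul_one]; exact hρ
    have h2 := (hasSum_geometric_of_norm_lt_one h1).mul_left ((τ : ℂ) ^ k * (τ : ℂ)⁻¹)
    have h3 : (τ : ℂ) ^ k * (τ : ℂ)⁻¹ * (1 - ρ * (τ : ℂ)⁻¹)⁻¹ = (τ : ℂ) ^ k * ((τ : ℂ) - ρ)⁻¹ := by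
      rw [mul_assoc, ← mul_inv, mul_sub, mul_one, mul_left_comm, mul_inv_cancel₀ hτ, mul_one]
    rw [h3] at h2
    refine (hasSum_congr_of_forall fun n => ?_).2 h2
    rw [zpow_sub₀ hτ, zpow_add_one₀ hτ, mul_pow, inv_pow, zpow_natCast]
    field_simp
  · refine (hasSum_congr_of_forall fun m => ?_).2 hasSum_zero
    rw [circleMean_zpow, if_neg (by omega), mul_zero]

/-- Moving the pole from `w` to `r * w` changes the distance by `1 - r`, which is itself at most `‖τ
- r * w‖`. This supplies the domination for the limit `r → 1`. -/
theorem norm_sub_le_two_mul_norm_sub_smul (τ w : Circle) {r : ℝ} (hr0 : 0 ≤ r) (hr : r < 1) :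
    ‖(τ : ℂ) - w‖ ≤ 2 * ‖(τ : ℂ) - r * w‖ := by
  have h1 : ‖(τ : ℂ) - w‖ ≤ ‖(τ : ℂ) - r * w‖ + (1 - r) := by
    have : (τ : ℂ) - w = ((τ : ℂ) - r * w) - ((1 - r : ℝ) : ℂ) * w := by push_cast; ring
    rw [this]
    refine (norm_sub_le _ _).trans ?_
    rw [norm_mul, Circle.norm_coe, mul_one, Complex.norm_real, Real.norm_of_nonneg (by linarith)]
  have h2 := norm_sub_norm_le (τ : ℂ) (r * w)
  rw [norm_mul, Circle.norm_coe, Circle.norm_coe, mul_one, Complex.norm_real,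
      Real.norm_of_nonneg hr0] at h2
  linarith

namespace IsProfile

variable {f g : Circle → ℂ} {a b : ℕ → ℝ}

/-- The pole `w` lies on the circle, so it is first moved inside to `r n * w`, where the integrand
has only negative frequencies and the mean vanishes. The Lipschitz bound for `f` then permits
dominated convergence. -/
theorem circleMean_diffQuot (hf : IsProfile f a) (w : Circle) :
    circleMean (fun τ => diffQuot f τ w) = 0 := by
  obtain ⟨C, hC⟩ := hf.exists_bound
  set r : ℕ → ℝ := fun n => 1 - 1 / ((n : ℝ) + 1) with hr
  have hr0 : ∀ n, 0 ≤ r n := fun n => by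
    simp only [hr]
    rw [sub_nonneg, div_le_one (by positivity)]
    linarith [(Nat.cast_nonneg n : (0 : ℝ) ≤ n)]
  have hr1 : ∀ n, r n < 1 := fun n => by
    simp only [hr]
    have : (0 : ℝ) < 1 / ((n : ℝ) + 1) := by positivity
    linarith
  have hrt : Tendsto r atTop (𝓝 1) := by
    simpa [hr] using (tendsto_one_div_add_atTop_nhds_zero_nat (𝕜 := ℝ)).const_sub 1
  have hz : ∀ n, circleMean (fun τ => (f τ - f w) * ((τ : ℂ) - r n * w)⁻¹) = 0 := by
    intro n
    have hρ : ‖(r n : ℂ) * w‖ < 1 := by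
      rw [norm_mul, Circle.norm_coe, mul_one, Complex.norm_real, Real.norm_of_nonneg (hr0 n)]
      exact hr1 n
    have hne : ∀ τ : Circle, 1 - r n ≤ ‖(τ : ℂ) - r n * w‖ := fun τ => by
      have := norm_sub_norm_le (τ : ℂ) (r n * w)
      rwa [norm_mul, Circle.norm_coe, Circle.norm_coe, mul_one, Complex.norm_real,
        Real.norm_of_nonneg (hr0 n)] at this
    have hT : Tame (fun τ : Circle => ((τ : ℂ) - r n * w)⁻¹) :=
      (Tame.of_continuous (continuous_circle_coe.sub continuous_const)).inv
        (sub_pos.2 (hr1 n)) hne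
    have h1 : circleMean (fun τ => f τ * ((τ : ℂ) - r n * w)⁻¹) = 0 := by
      refine (hasSum_circleMean hf.summable
        (g := fun m τ => (τ : ℂ) ^ (-((m : ℤ) + 1)) * ((τ : ℂ) - r n * w)⁻¹)
        (fun m => (Tame.of_continuous (continuous_circle_zpow _)).mul hT) (K := (1 - r n)⁻¹)
        (fun m τ => ?_) (fun τ => ?_)).unique ?_
      · rw [norm_mul, norm_circle_zpow, one_mul, norm_inv]
        exact inv_anti₀ (sub_pos.2 (hr1 n)) (hne τ)
      · refine (hasSum_congr_of_forall fun m => ?_).2 ((hf.series τ).mul_right (((τ : ℂ) - r n * w)⁻¹))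
        rw [conj_circle_pow]
        push_cast
        ring
      · refine (hasSum_congr_of_forall fun m => ?_).2 hasSum_zero
        rw [circleMean_zpow_div_sub hρ (by omega), mul_zero]
    have h2 : circleMean (fun τ : Circle => ((τ : ℂ) - r n * w)⁻¹) = 0 := by
      simpa using circleMean_zpow_div_sub hρ (le_refl 0)
    have h3 := circleMean_sub ((Tame.of_continuous hf.diff.continuous).mul hT) ((Tame.const (f w)).mul hT)
    rw [circleMean_const_mul, h1, h2, mul_zero, sub_zero] at h3
    rw [← h3]
    congr 1
    ext τ
    ring
  have hlim : Tendsto (fun n => circleMean (fun τ => (f τ - f w) * ((τ : ℂ) - r n * w)⁻¹)) atTop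
      (𝓝 (circleMean (fun τ => diffQuot f τ w))) := by
    refine tendsto_integral_of_dominated_convergence (fun _ => 4 * C) (fun n => ?_)
      (integrable_const _) (fun n => Eventually.of_forall fun t => ?_)
      (Eventually.of_forall fun t => ?_)
    · have h1 : Measurable (fun t : ℝ => f (Circle.exp t)) :=
        (hf.diff.continuous.comp Circle.exp.continuous).measurable
      have h2 : Measurable (fun t : ℝ => (Circle.exp t : ℂ)) :=
        (continuous_circle_coe.comp Circle.exp.continuous).measurable
      exact ((h1.sub_const _).mul (h2.sub_const _).inv).aestronglyMeasurable
    · have h1 := norm_sub_le_of_circleDeriv hf.diff hC (Circle.exp t) w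
      have h2 := norm_sub_le_two_mul_norm_sub_smul (Circle.exp t) w (hr0 n) (hr1 n)
      have hC0 : 0 ≤ C := (norm_nonneg _).trans (hC 1)
      rw [norm_mul, norm_inv, ← div_eq_mul_inv]
      refine div_le_of_le_mul₀ (norm_nonneg _) (by positivity) (h1.trans ?_)
      nlinarith
    · by_cases h : (Circle.exp t : ℂ) = w
      · have : Circle.exp t = w := Circle.ext h
        simp [diffQuot, this]
      · simp only [diffQuot, div_eq_mul_inv]
        refine Tendsto.const_mul _ (Tendsto.inv₀ ?_ (sub_ne_zero.2 h))
        have := ((Complex.continuous_ofReal.tendsto _).comp hrt).mul_const (w : ℂ)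
        simpa using this.const_sub (Circle.exp t : ℂ)
  simp only [hz] at hlim
  exact (tendsto_nhds_unique tendsto_const_nhds hlim).symm

theorem circleMean_circleDeriv (hf : IsProfile f a) : circleMean (circleDeriv f) = 0 := by
  simpa using hf.circleMean_zpow_mul_circleDeriv_eq_zero (k := 0) (by norm_num)

end IsProfile

/-! ### The reduced equation -/

/-- The quadratic part of the kernel of the velocity induced by a patch on its own boundary. -/
noncomputable def selfKernel (η : ℝ) (f : Circle → ℂ) (w τ : Circle) : ℂ :=
  (conj (diffQuot f τ w) - diffQuot f τ w) * (circleDeriv f τ - diffQuot f τ w) /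
    (1 + η * diffQuot f τ w)

/-- The kernel of the velocity induced by a patch at an outer point. -/
noncomputable def crossKernel (η : ℝ) (g : Circle → ℂ) (y : ℂ) (τ : Circle) : ℂ :=
  (τ : ℂ) * conj ((τ : ℂ) + η * g τ) * (1 + η * circleDeriv g τ) / (y - η * ((τ : ℂ) + η * g τ))

/-- The desingularized boundary field; a pair of patches rotates uniformly if and only if the imaginary
part of this field vanishes on both boundaries. -/
noncomputable def reducedField (γ γ' η η' d Ω A : ℝ) (f g : Circle → ℂ) (w : Circle) : ℂ :=
  -(γ / 2) * circleDeriv f w +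
    (Ω * η * conj ((w : ℂ) + η * f w) - A - γ / 2 * (η * conj (w : ℂ) * circleMean (selfKernel η f w)) +
      γ' / 2 * circleMean (crossKernel η' g (d - η * ((w : ℂ) + η * f w)))) *
      ((w : ℂ) * (1 + η * circleDeriv f w))

theorem contourMean_eq (z : Circle → ℂ) (k : ℂ → ℂ) :
    contourMean z k = circleMean (fun τ => (τ : ℂ) * (k (z τ) * circleDeriv z τ)) := by
  rw [contourMean, circleMean_eq_intervalIntegral, Complex.real_smul,
    ← intervalIntegral.integral_const_mul, ← intervalIntegral.integral_const_mul]
  congr 1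
  ext t
  have : (Real.pi : ℂ) ≠ 0 := by exact_mod_cast Real.pi_ne_zero
  push_cast
  field_simp

theorem norm_eta_diffQuot_le {f : Circle → ℂ} (hf : CircleDifferentiable f) {η : ℝ}
    (hη : ∀ w, ‖(η : ℂ) * circleDeriv f w‖ ≤ 1 / 4) (τ w : Circle) :
    ‖(η : ℂ) * diffQuot f τ w‖ ≤ 1 / 2 := by
  obtain ⟨h1, h2⟩ := circleDifferentiable_affine hf 0 0 η
  have h3 := IsProfile.norm_diffQuot_le h1 (C := 1 / 4) (by rw [h2]; simpa only [zero_add] using hη) τ w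
  have h4 : diffQuot (fun w : Circle => 0 + 0 * (w : ℂ) + (η : ℂ) * f w) τ w = η * diffQuot f τ w := by
    simp only [diffQuot]
    ring
  rw [h4] at h3
  linarith

theorem tame_selfKernel {f : Circle → ℂ} {a : ℕ → ℝ} (hf : IsProfile f a) {η : ℝ}
    (hη : ∀ w, ‖(η : ℂ) * circleDeriv f w‖ ≤ 1 / 4) (w : Circle) : Tame (selfKernel η f w) := by
  have hq := hf.tame_diffQuot w
  refine (((hq.star.sub hq).mul ((Tame.of_continuous hf.cont).sub hq)).div
    ((Tame.const 1).add ((Tame.const (η : ℂ)).mul hq)) (c := 1 / 2) (by norm_num) fun τ => ?_)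
  have := norm_eta_diffQuot_le hf.diff hη τ w
  have h2 := norm_sub_norm_le (1 : ℂ) (-((η : ℂ) * diffQuot f τ w))
  rw [norm_neg, norm_one, sub_neg_eq_add] at h2
  linarith

/-- The argument principle with winding number zero: the values stay in the right half plane, so `-I
* log u` is a periodic primitive. -/
theorem circleMean_mul_deriv_div {u : Circle → ℂ} (hu : CircleDifferentiable u)
    (hc : Continuous (circleDeriv u)) (hpos : ∀ τ, 0 < (u τ).re) :
    circleMean (fun τ => (τ : ℂ) * circleDeriv u τ / u τ) = 0 := by
  rw [circleMean_eq_intervalIntegral]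
  have hd : ∀ t : ℝ, HasDerivAt (fun s : ℝ => -Complex.I * Complex.log (u (Circle.exp s)))
      ((Circle.exp t : ℂ) * circleDeriv u (Circle.exp t) / u (Circle.exp t)) t := by
    intro t
    have h1 := hu.hasDerivAt 1 t
    simp only [one_mul] at h1
    refine ((h1.clog_real (Or.inl (hpos _))).const_mul (-Complex.I)).congr_deriv ?_
    linear_combination (-(Circle.exp t : ℂ) * circleDeriv u (Circle.exp t) / u (Circle.exp t)) *
      Complex.I_mul_I
  have hct : Continuous (fun t : ℝ => (Circle.exp t : ℂ) * circleDeriv u (Circle.exp t) /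
      u (Circle.exp t)) :=
    ((continuous_circle_coe.mul hc).div hu.continuous
      fun τ h => by simpa [h] using hpos τ).comp Circle.exp.continuous
  rw [intervalIntegral.integral_eq_sub_of_hasDerivAt (fun t _ => hd t) (hct.intervalIntegrable _ _),
    Circle.exp_two_pi, Circle.exp_zero, sub_self, smul_zero]

theorem exists_pos_le_norm {u : Circle → ℂ} (hu : Continuous u) (h : ∀ τ, u τ ≠ 0) :
    ∃ c : ℝ, 0 < c ∧ ∀ τ, c ≤ ‖u τ‖ := by
  obtain ⟨τ, -, hτ⟩ := isCompact_univ.exists_isMinOn univ_nonempty hu.norm.continuousOn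
  exact ⟨‖u τ‖, norm_pos_iff.2 (h τ), fun σ => hτ (mem_univ σ)⟩

/-- With `q` the difference quotient, the integrand off the diagonal is `-σ w⁻¹ (1 + η (conj q - q +
f') + η² selfKernel)`. Each of `conj q`, `q` and `f'` has mean zero, so the deformation acts only
through the quadratic `selfKernel`. This is the cancellation that removes the singularity at `ε =
0`. -/
theorem contourMean_self {f : Circle → ℂ} {a : ℕ → ℝ} (hf : IsProfile f a) {η : ℝ}
    (hη : ∀ w, ‖(η : ℂ) * circleDeriv f w‖ ≤ 1 / 4) (c σ : ℝ) (hσ : σ ≠ 0) (w : Circle) :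
    contourMean (fun τ => (c : ℂ) + σ * ((τ : ℂ) + η * f τ))
      (fun ξ => (conj ξ - conj ((c : ℂ) + σ * ((w : ℂ) + η * f w))) / (ξ - ((c : ℂ) + σ * ((w : ℂ) + η * f w)))) =
      -σ * conj (w : ℂ) * (1 + η ^ 2 * circleMean (selfKernel η f w)) := by
  obtain ⟨-, h2⟩ := circleDifferentiable_affine hf.diff c σ (σ * η)
  have h3 : (fun w : Circle => (c : ℂ) + σ * w + σ * η * f w) =
      fun τ : Circle => (c : ℂ) + σ * ((τ : ℂ) + η * f τ) := by ext τ; ring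
  rw [h3] at h2
  have hq := hf.tame_diffQuot w
  have hd := Tame.of_continuous hf.cont
  rw [contourMean_eq, h2]
  have e : circleMean (fun τ : Circle => -σ * conj (w : ℂ) * (1 + (η * ((conj (diffQuot f τ w) -
      diffQuot f τ w) + circleDeriv f τ) + η ^ 2 * selfKernel η f w τ))) =
      -σ * conj (w : ℂ) * (1 + η ^ 2 * circleMean (selfKernel η f w)) := by
    rw [circleMean_const_mul, circleMean_add (Tame.const 1) (Tame.add
      ((Tame.const _).mul ((hq.star.sub hq).add hd)) ((Tame.const _).mul (tame_selfKernel hf hη w))),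
      circleMean_add ((Tame.const _).mul ((hq.star.sub hq).add hd))
        ((Tame.const _).mul (tame_selfKernel hf hη w)),
      circleMean_const_mul, circleMean_const_mul, circleMean_add (hq.star.sub hq) hd,
      circleMean_sub hq.star hq, circleMean_conj, hf.circleMean_diffQuot, hf.circleMean_circleDeriv,
      circleMean_const]
    simp
  rw [← e]
  refine circleMean_congr (w := w) fun τ hτ => ?_
  have hne : (τ : ℂ) - w ≠ 0 := sub_ne_zero.2 fun h => hτ (Circle.ext h)
  have h1 : f τ - f w = diffQuot f τ w * ((τ : ℂ) - w) := by rw [diffQuot, div_mul_cancel₀ _ hne]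
  have hq0 : 1 + (η : ℂ) * diffQuot f τ w ≠ 0 := by
    have := norm_eta_diffQuot_le hf.diff hη τ w
    intro h0
    have h4 : (η : ℂ) * diffQuot f τ w = -1 := by linear_combination h0
    rw [h4, norm_neg, norm_one] at this
    norm_num at this
  have hσ' : (σ : ℂ) ≠ 0 := by exact_mod_cast hσ
  have e1 : (c : ℂ) + σ * ((τ : ℂ) + η * f τ) - ((c : ℂ) + σ * ((w : ℂ) + η * f w)) =
      σ * (((τ : ℂ) - w) * (1 + η * diffQuot f τ w)) := by
    linear_combination (σ * η : ℂ) * h1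
  have e2 : conj ((c : ℂ) + σ * ((τ : ℂ) + η * f τ)) - conj ((c : ℂ) + σ * ((w : ℂ) + η * f w)) =
      σ * ((conj (τ : ℂ) - conj (w : ℂ)) * (1 + η * conj (diffQuot f τ w))) := by
    rw [← map_sub, e1]
    simp
  have hτ0 := Circle.coe_ne_zero τ
  have hw0 := Circle.coe_ne_zero w
  have e3 : conj (τ : ℂ) - conj (w : ℂ) = -((τ : ℂ) - w) * ((τ : ℂ)⁻¹ * (w : ℂ)⁻¹) := by
    rw [conj_circle, conj_circle]
    field_simp
    ring
  rw [e1, e2, e3, selfKernel, conj_circle]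
  set q := diffQuot f τ w
  field_simp
  ring

/-- The first summand is a constant times the logarithmic derivative of a curve in the right half
plane, and its mean is zero. It is the part of the Biot-Savart integrand that contains the conjugate
of the outer point. -/
theorem circleMean_add_mul_crossKernel {g : Circle → ℂ} {a : ℕ → ℝ} (hg : IsProfile g a) {η : ℝ}
    {x : ℂ} (hpos : ∀ τ : Circle, 0 < (x - η * ((τ : ℂ) + η * g τ)).re) (k l : ℂ) :
    circleMean (fun τ : Circle => k * ((τ : ℂ) * (-(η : ℂ) + -(η : ℂ) * η * circleDeriv g τ) /
      (x - η * ((τ : ℂ) + η * g τ))) + l * crossKernel η g x τ) = l * circleMean (crossKernel η g x) := by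
  obtain ⟨h4, h5⟩ := circleDifferentiable_affine hg.diff x (-η) (-η * η)
  have h6 : (fun w : Circle => x + -(η : ℂ) * w + -(η : ℂ) * η * g w) =
      fun τ : Circle => x - η * ((τ : ℂ) + η * g τ) := by ext τ; ring
  rw [h6] at h4 h5
  have h7 := circleMean_mul_deriv_div h4 (by
    rw [h5]; exact continuous_const.add (continuous_const.mul hg.cont)) hpos
  rw [h5] at h7
  obtain ⟨c0, hc0, hc1⟩ := exists_pos_le_norm h4.continuous fun τ h => by
    have := hpos τ
    rw [h] at this
    exact lt_irrefl _ this
  have hT0 : Tame (fun τ : Circle => x - η * ((τ : ℂ) + η * g τ)) := Tame.of_continuous h4.continuous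
  have hTd : Tame (circleDeriv g) := Tame.of_continuous hg.cont
  have hTτ : Tame (fun τ : Circle => (τ : ℂ)) := Tame.of_continuous continuous_circle_coe
  have hTg : Tame g := Tame.of_continuous hg.diff.continuous
  have hT1 : Tame (fun τ : Circle => (τ : ℂ) * (-(η : ℂ) + -(η : ℂ) * η * circleDeriv g τ) /
      (x - η * ((τ : ℂ) + η * g τ))) :=
    (hTτ.mul ((Tame.const _).add ((Tame.const _).mul hTd))).div hT0 hc0 hc1
  have hT2 : Tame (crossKernel η g x) :=
    ((hTτ.mul (hTτ.add ((Tame.const _).mul hTg)).star).mul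
      ((Tame.const 1).add ((Tame.const _).mul hTd))).div hT0 hc0 hc1
  rw [circleMean_add ((Tame.const _).mul hT1) ((Tame.const _).mul hT2), circleMean_const_mul,
    circleMean_const_mul, h7, mul_zero, zero_add]

/-- Here `ξ - p` is `s` times a function with positive real part, so the conjugate of `p`
contributes nothing and only `crossKernel` survives. The sign `s` is `1` for a point on the first
patch and `-1` for a point on the second. -/
theorem contourMean_cross {g : Circle → ℂ} {a : ℕ → ℝ} (hg : IsProfile g a) {η s c : ℝ} {p x : ℂ}
    (hs : s ^ 2 = 1) (hp : p = c - s * x)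
    (hpos : ∀ τ : Circle, 0 < (x - η * ((τ : ℂ) + η * g τ)).re) :
    contourMean (fun τ => (c : ℂ) + (-(s * η) : ℝ) * ((τ : ℂ) + η * g τ))
      (fun ξ => (conj ξ - conj p) / (ξ - p)) = s * η ^ 2 * circleMean (crossKernel η g x) := by
  obtain ⟨-, h2⟩ := circleDifferentiable_affine hg.diff c (-(s * η) : ℝ) ((-(s * η) : ℝ) * η)
  have h3 : (fun w : Circle => (c : ℂ) + (-(s * η) : ℝ) * w + (-(s * η) : ℝ) * η * g w) =
      fun τ : Circle => (c : ℂ) + (-(s * η) : ℝ) * ((τ : ℂ) + η * g τ) := by ext τ; ring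
  rw [h3] at h2
  rw [contourMean_eq, h2, ← circleMean_add_mul_crossKernel hg hpos (s * conj x)]
  refine congrArg circleMean (funext fun τ => ?_)
  have hne : x - η * ((τ : ℂ) + η * g τ) ≠ 0 := fun h => by
    have := hpos τ
    rw [h] at this
    exact lt_irrefl _ this
  have hs0 : (s : ℂ) ≠ 0 := by
    intro h
    have : s = 0 := by exact_mod_cast h
    simp [this] at hs
  have e1 : (c : ℂ) + (-(s * η) : ℝ) * ((τ : ℂ) + η * g τ) - p =
      s * (x - η * ((τ : ℂ) + η * g τ)) := by
    rw [hp]; push_cast; ring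
  have e2 : conj ((c : ℂ) + (-(s * η) : ℝ) * ((τ : ℂ) + η * g τ)) - conj p =
      s * (conj x - η * conj ((τ : ℂ) + η * g τ)) := by
    rw [← map_sub, e1]
    simp only [map_mul, map_sub, Complex.conj_ofReal]
  rw [e1, e2, crossKernel]
  push_cast
  generalize conj ((τ : ℂ) + η * g τ) = φ
  generalize circleDeriv g τ = D
  generalize x - η * ((τ : ℂ) + η * g τ) = y at hne ⊢
  rw [mul_div_mul_left _ _ hs0]
  field_simp
  ring

/-- The rotation condition on the boundary of one patch in terms of the reduced field. -/
theorem re_rotation_eq {f g : Circle → ℂ} {a a' : ℕ → ℝ} (hf : IsProfile f a) (hg : IsProfile g a')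
    {γ γ' η η' d Ω Z s c c' : ℝ} (hη0 : η ≠ 0) (hη0' : η' ≠ 0) (hs : s ^ 2 = 1) (hc : c' - c = s * d)
    (hη : ∀ w, ‖(η : ℂ) * circleDeriv f w‖ ≤ 1 / 4)
    (hpos : ∀ w τ : Circle, 0 < ((d : ℂ) - η * ((w : ℂ) + η * f w) - η' * ((τ : ℂ) + η' * g τ)).re) (w : Circle) :
    ((-Complex.I * Ω * (conj ((c : ℂ) + (s * η : ℝ) * ((w : ℂ) + η * f w)) - Z) -
      (Complex.I * γ / (2 * η ^ 2) *
        contourMean (fun τ => (c : ℂ) + (s * η : ℝ) * ((τ : ℂ) + η * f τ))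
          (fun ξ => (conj ξ - conj ((c : ℂ) + (s * η : ℝ) * ((w : ℂ) + η * f w))) /
            (ξ - ((c : ℂ) + (s * η : ℝ) * ((w : ℂ) + η * f w)))) +
      Complex.I * γ' / (2 * η' ^ 2) *
        contourMean (fun τ => (c' : ℂ) + (-(s * η') : ℝ) * ((τ : ℂ) + η' * g τ))
          (fun ξ => (conj ξ - conj ((c : ℂ) + (s * η : ℝ) * ((w : ℂ) + η * f w))) /
            (ξ - ((c : ℂ) + (s * η : ℝ) * ((w : ℂ) + η * f w)))))) *
      ((w : ℂ) * circleDeriv (fun τ => (c : ℂ) + (s * η : ℝ) * ((τ : ℂ) + η * f τ)) w)).re =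
      η * (reducedField γ γ' η η' d Ω (Ω * (s * (Z - c))) f g w).im := by
  have hs0 : s ≠ 0 := by rintro rfl; simp at hs
  have hsc : (s : ℂ) ^ 2 = 1 := by exact_mod_cast hs
  have hηc : (η : ℂ) ≠ 0 := by exact_mod_cast hη0
  have hηc' : (η' : ℂ) ≠ 0 := by exact_mod_cast hη0'
  have hcc : (c' : ℂ) - c = s * d := by exact_mod_cast hc
  obtain ⟨-, h2⟩ := circleDifferentiable_affine hf.diff c (s * η : ℝ) ((s * η : ℝ) * η)
  have h3 : (fun w : Circle => (c : ℂ) + (s * η : ℝ) * w + (s * η : ℝ) * η * f w) =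
      fun τ : Circle => (c : ℂ) + (s * η : ℝ) * ((τ : ℂ) + η * f τ) := by ext τ; ring
  rw [h3] at h2
  rw [contourMean_self hf hη c (s * η) (mul_ne_zero hs0 hη0) w,
    contourMean_cross hg hs (x := (d : ℂ) - η * ((w : ℂ) + η * f w)) (by
      push_cast
      linear_combination -hcc) (hpos w), h2]
  have hw : conj (w : ℂ) * w = 1 := by rw [conj_circle, inv_mul_cancel₀ (Circle.coe_ne_zero w)]
  -- The whole expression is `-I` times `η * reducedField - γ / 2`. The real constant `γ / 2` is the
  -- trace of the circular vortex, and it does not affect the real part.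
  have key : ∀ X : ℂ, X = -Complex.I * (η * reducedField γ γ' η η' d Ω (Ω * (s * (Z - c))) f g w - γ / 2) →
      X.re = η * (reducedField γ γ' η η' d Ω (Ω * (s * (Z - c))) f g w).im := by
    rintro X rfl
    simp
  apply key
  rw [reducedField]
  set m := circleMean (selfKernel η f w)
  set J := circleMean (crossKernel η' g (d - η * ((w : ℂ) + η * f w)))
  set D := circleDeriv f w
  simp only [map_add, map_mul, Complex.conj_ofReal]
  push_cast
  set φ := conj (w : ℂ)
  set ψ := conj (f w)
  field_simp
  linear_combination (w * (1 + η * D) * (-2 * Ω * η ^ 2 * (φ + η * ψ) - η * γ' * J +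
    η ^ 2 * φ * γ * m + φ * γ)) * hsc + γ * (1 + η * D) * hw

/-- The reflection `z ↦ d - z` exchanges the roles of the patches, so both conditions are instances
of `re_rotation_eq`, with `s = 1` and `s = -1`. The pair `(Ω, Z)` thereby enters through the speeds
`Ω * Z` and `Ω * (d - Z)`. -/
theorem rotatesUniformly_iff {γ b : Fin 2 → ℝ} {d ε Ω Z : ℝ} {f : Fin 2 → Circle → ℂ}
    {a : Fin 2 → ℕ → ℝ} (hf : ∀ j, IsProfile (f j) (a j)) (hη0 : ∀ j, ε * b j ≠ 0)
    (hη : ∀ j w, ‖((ε * b j : ℝ) : ℂ) * circleDeriv (f j) w‖ ≤ 1 / 4)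
    (hpos : ∀ j (w τ : Circle), 0 < ((d : ℂ) - (ε * b j : ℝ) * ((w : ℂ) + (ε * b j : ℝ) * f j w) -
      (ε * b (1 - j) : ℝ) * ((τ : ℂ) + (ε * b (1 - j) : ℝ) * f (1 - j) τ)).re) :
    RotatesUniformly γ b ε Ω Z (patchBoundary b d ε (conformalMap b ε f)) ↔
      ∀ j w, (reducedField (γ j) (γ (1 - j)) (ε * b j) (ε * b (1 - j)) d Ω
        (![Ω * Z, Ω * (d - Z)] j) (f j) (f (1 - j)) w).im = 0 := by
  set z := patchBoundary b d ε (conformalMap b ε f) with hz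
  have e0 : z 0 = fun τ : Circle => ((0 : ℝ) : ℂ) + ((1 * (ε * b 0) : ℝ) : ℂ) *
      ((τ : ℂ) + (ε * b 0 : ℝ) * f 0 τ) := by
    ext τ
    simp only [hz, patchBoundary, conformalMap, Matrix.cons_val_zero]
    push_cast
    ring
  have e1 : z 1 = fun τ : Circle => (d : ℂ) + ((-(1 * (ε * b 1)) : ℝ) : ℂ) *
      ((τ : ℂ) + (ε * b 1 : ℝ) * f 1 τ) := by
    ext τ
    simp only [hz, patchBoundary, conformalMap, Matrix.cons_val_one, Matrix.cons_val_zero]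
    push_cast
    ring
  have e0' : z 0 = fun τ : Circle => ((0 : ℝ) : ℂ) + ((-(-1 * (ε * b 0)) : ℝ) : ℂ) *
      ((τ : ℂ) + (ε * b 0 : ℝ) * f 0 τ) := by
    rw [e0]; ext τ; push_cast; ring
  have e1' : z 1 = fun τ : Circle => (d : ℂ) + ((-1 * (ε * b 1) : ℝ) : ℂ) *
      ((τ : ℂ) + (ε * b 1 : ℝ) * f 1 τ) := by
    rw [e1]; ext τ; push_cast; ring
  have k0 : ∀ w, ((-Complex.I * (Ω : ℂ) * (conj (z 0 w) - (Z : ℂ)) - conjVelocity γ b ε z (z 0 w)) *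
      ((w : ℂ) * circleDeriv (z 0) w)).re = (ε * b 0) * (reducedField (γ 0) (γ 1) (ε * b 0)
        (ε * b 1) d Ω (Ω * Z) (f 0) (f 1) w).im := by
    intro w
    have := re_rotation_eq (hf 0) (hf 1) (γ := γ 0) (γ' := γ 1) (Ω := Ω) (Z := Z) (s := 1) (c := 0)
      (c' := d) (d := d) (hη0 0) (hη0 1) (by norm_num) (by ring) (hη 0) (hpos 0) w
    rw [sub_zero, one_mul Z] at this
    rw [← this, conjVelocity, Fin.sum_univ_two, e1, e0]
    push_cast
    simp only [mul_pow, mul_assoc]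
  have k1 : ∀ w, ((-Complex.I * (Ω : ℂ) * (conj (z 1 w) - (Z : ℂ)) - conjVelocity γ b ε z (z 1 w)) *
      ((w : ℂ) * circleDeriv (z 1) w)).re = (ε * b 1) * (reducedField (γ 1) (γ 0) (ε * b 1)
        (ε * b 0) d Ω (Ω * (d - Z)) (f 1) (f 0) w).im := by
    intro w
    have := re_rotation_eq (hf 1) (hf 0) (γ := γ 1) (γ' := γ 0) (Ω := Ω) (Z := Z) (s := -1) (c := d)
      (c' := 0) (d := d) (hη0 1) (hη0 0) (by norm_num) (by ring) (hη 1) (hpos 1) w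
    rw [show -1 * (Z - d) = d - Z by ring] at this
    rw [← this, conjVelocity, Fin.sum_univ_two, e1', e0', add_comm (_ * contourMean _ _)]
    push_cast
    simp only [mul_pow, mul_assoc]
  rw [RotatesUniformly, Fin.forall_fin_two, Fin.forall_fin_two]
  simp only [k0, k1, mul_eq_zero, hη0, false_or]
  exact Iff.rfl

/-! ### Estimates by the mean square of the derivative -/

/-- The mean square norm of the derivative of a function on the circle. -/
noncomputable def derivNorm (h : Circle → ℂ) : ℝ := √(circleMean (fun τ => ‖circleDeriv h τ‖ ^ 2))

theorem derivNorm_nonneg (h : Circle → ℂ) : 0 ≤ derivNorm h := Real.sqrt_nonneg _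

theorem derivNorm_sq (h : Circle → ℂ) :
    derivNorm h ^ 2 = circleMean (fun τ => ‖circleDeriv h τ‖ ^ 2) :=
  Real.sq_sqrt (integral_nonneg fun _ => by positivity)

/-- Cauchy-Schwarz, read off from the nonnegative integral of `(s * g - G) ^ 2` with `G` the
integral of `g`. -/
theorem sq_intervalIntegral_le {g : ℝ → ℝ} (hg : Continuous g) {s : ℝ} (hs : 0 ≤ s) :
    (∫ u in (0 : ℝ)..s, g u) ^ 2 ≤ s * ∫ u in (0 : ℝ)..s, g u ^ 2 := by
  rcases hs.eq_or_lt with rfl | hs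
  · simp
  set G := ∫ u in (0 : ℝ)..s, g u with hG
  have h0 : 0 ≤ ∫ u in (0 : ℝ)..s, (s * g u - G) ^ 2 :=
    intervalIntegral.integral_nonneg hs.le fun u _ => sq_nonneg _
  have h1 : ∫ u in (0 : ℝ)..s, (s * g u - G) ^ 2 =
      ∫ u in (0 : ℝ)..s, (s ^ 2 * g u ^ 2 - (2 * s * G) * g u + G ^ 2) :=
    intervalIntegral.integral_congr fun u _ => by ring
  have i1 : Continuous (fun u => s ^ 2 * g u ^ 2) := by fun_prop
  have i2 : Continuous (fun u => (2 * s * G) * g u) := by fun_prop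
  have i3 : Continuous (fun u => s ^ 2 * g u ^ 2 - (2 * s * G) * g u) := by fun_prop
  rw [h1, intervalIntegral.integral_add (i3.intervalIntegrable _ _)
    (continuous_const.intervalIntegrable _ _), intervalIntegral.integral_sub
    (i1.intervalIntegrable _ _) (i2.intervalIntegrable _ _), intervalIntegral.integral_const_mul,
    intervalIntegral.integral_const_mul, intervalIntegral.integral_const, ← hG, smul_eq_mul,
    sub_zero] at h0
  have h2 : 0 ≤ s * (s * (∫ u in (0 : ℝ)..s, g u ^ 2) - G ^ 2) := by linarith
  have h3 := nonneg_of_mul_nonneg_right h2 hs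
  linarith

theorem circleMean_norm_circleDeriv_le {h : Circle → ℂ} (hc : Continuous (circleDeriv h)) :
    circleMean (fun τ => ‖circleDeriv h τ‖) ≤ derivNorm h := by
  refine Real.le_sqrt_of_sq_le ?_
  have hπ : 0 < 2 * Real.pi := by positivity
  have h1 := sq_intervalIntegral_le (g := fun t => ‖circleDeriv h (Circle.exp t)‖)
    (hc.comp Circle.exp.continuous).norm hπ.le
  rw [circleMean_eq_intervalIntegral, circleMean_eq_intervalIntegral, smul_eq_mul, smul_eq_mul, mul_pow]
  calc ((2 * Real.pi)⁻¹) ^ 2 * (∫ t in (0 : ℝ)..2 * Real.pi, ‖circleDeriv h (Circle.exp t)‖) ^ 2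
      ≤ ((2 * Real.pi)⁻¹) ^ 2 *
        (2 * Real.pi * ∫ t in (0 : ℝ)..2 * Real.pi, ‖circleDeriv h (Circle.exp t)‖ ^ 2) := by gcongr
    _ = _ := by field_simp

/-- The one dimensional Sobolev embedding into Hölder functions of exponent `1 / 2`: the fundamental
theorem of calculus on an arc, then Cauchy-Schwarz. -/
theorem norm_sub_le_derivNorm_aux {h : Circle → ℂ} (hd : CircleDifferentiable h)
    (hc : Continuous (circleDeriv h)) (w : Circle) {s : ℝ} (hs0 : 0 ≤ s) (hs : s ≤ 2 * Real.pi) :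
    ‖h (w * Circle.exp s) - h w‖ ≤ √s * (√(2 * Real.pi) * derivNorm h) := by
  have hcc : Continuous (fun u : ℝ => circleDeriv h (w * Circle.exp u)) :=
    hc.comp (continuous_const.mul Circle.exp.continuous)
  have hI := intervalIntegral.integral_eq_sub_of_hasDerivAt (a := 0) (b := s)
    (fun t _ => hd.hasDerivAt w t) (by
      apply Continuous.intervalIntegrable
      exact hcc.mul (continuous_const.mul
        (continuous_circle_coe.comp (continuous_const.mul Circle.exp.continuous))))
  rw [Circle.exp_zero, mul_one] at hI
  rw [← hI]
  have h1 := intervalIntegral.norm_integral_le_integral_norm (f := fun u : ℝ =>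
    circleDeriv h (w * Circle.exp u) * (Complex.I * ((w * Circle.exp u : Circle) : ℂ)))
    (μ := volume) hs0
  have h2 : ∀ u : ℝ, ‖circleDeriv h (w * Circle.exp u) * (Complex.I * ((w * Circle.exp u : Circle) : ℂ))‖
      = ‖circleDeriv h (w * Circle.exp u)‖ := fun u => by
    rw [norm_mul, norm_mul, Complex.norm_I, Circle.norm_coe, one_mul, mul_one]
  simp only [h2] at h1
  refine h1.trans ?_
  have h3 := sq_intervalIntegral_le hcc.norm hs0
  have h4 : ∫ u in (0 : ℝ)..s, ‖circleDeriv h (w * Circle.exp u)‖ ^ 2 ≤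
      2 * Real.pi * derivNorm h ^ 2 := by
    rw [derivNorm_sq, ← circleMean_rotate (fun τ => ‖circleDeriv h τ‖ ^ 2) w,
      circleMean_eq_intervalIntegral, smul_eq_mul, mul_inv_cancel_left₀ (by positivity)]
    exact intervalIntegral.integral_mono_interval le_rfl hs0 hs
      (Eventually.of_forall fun u => by positivity) ((hcc.norm.pow 2).intervalIntegrable _ _)
  refine le_of_sq_le_sq ?_ (by positivity [derivNorm_nonneg h])
  rw [mul_pow, mul_pow, Real.sq_sqrt hs0, Real.sq_sqrt (by positivity)]
  exact h3.trans (by gcongr)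

theorem norm_sub_le_derivNorm {h : Circle → ℂ} (hd : CircleDifferentiable h)
    (hc : Continuous (circleDeriv h)) (w : Circle) {s : ℝ} (hs : |s| ≤ 2 * Real.pi) :
    ‖h (w * Circle.exp s) - h w‖ ≤ √|s| * (√(2 * Real.pi) * derivNorm h) := by
  rcases le_total 0 s with h0 | h0
  · rw [abs_of_nonneg h0] at hs ⊢
    exact norm_sub_le_derivNorm_aux hd hc w h0 hs
  · rw [abs_of_nonpos h0] at hs ⊢
    have := norm_sub_le_derivNorm_aux hd hc (w * Circle.exp s) (neg_nonneg.2 h0) hs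
    rwa [Circle.exp_neg, mul_inv_cancel_right, norm_sub_rev] at this

/-- A profile has mean zero, so `h w` is the mean over `τ` of `h w - h τ`, and each of these is
bounded by the embedding along an arc of length at most `π`. -/
theorem IsProfile.norm_le_derivNorm {h : Circle → ℂ} {a : ℕ → ℝ} (hh : IsProfile h a) (w : Circle) :
    ‖h w‖ ≤ 2 * Real.pi * derivNorm h := by
  have h0 : circleMean h = 0 := by simpa using hh.circleMean_zpow_mul_nonpos (k := 0) le_rfl
  have hT : Tame h := Tame.of_continuous hh.diff.continuous
  have h1 : circleMean (fun τ => h w - h τ) = h w := by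
    rw [circleMean_sub (Tame.const _) hT, h0, circleMean_const, sub_zero]
  rw [← h1]
  refine norm_circleMean_le fun τ => ?_
  have hb := Complex.abs_arg_le_pi ((w⁻¹ * τ : Circle) : ℂ)
  have h2 := norm_sub_le_derivNorm hh.diff hh.cont w (s := ((w⁻¹ * τ : Circle) : ℂ).arg)
    (hb.trans (by linarith [Real.pi_pos]))
  rw [Circle.exp_arg, mul_inv_cancel_left, norm_sub_rev] at h2
  refine h2.trans ?_
  rw [← mul_assoc, ← Real.sqrt_mul (abs_nonneg _)]
  refine mul_le_mul_of_nonneg_right ?_ (derivNorm_nonneg h)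
  refine Real.sqrt_le_iff.2 ⟨by positivity, ?_⟩
  nlinarith [Real.pi_pos]

theorem intervalIntegrable_abs_rpow (a b : ℝ) :
    IntervalIntegrable (fun s : ℝ => |s| ^ (-(1 / 2) : ℝ)) volume a b := by
  have key : ∀ c : ℝ, IntervalIntegrable (fun s : ℝ => |s| ^ (-(1 / 2) : ℝ)) volume 0 c := by
    have pos : ∀ c : ℝ, 0 ≤ c →
        IntervalIntegrable (fun s : ℝ => |s| ^ (-(1 / 2) : ℝ)) volume 0 c := fun c hc => by
      refine (intervalIntegral.intervalIntegrable_rpow' (r := -(1 / 2)) (by norm_num)).congr ?_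
      intro s hs
      rw [uIoc_of_le hc] at hs
      simp only
      rw [abs_of_pos hs.1]
    intro c
    rcases le_total 0 c with hc | hc
    · exact pos c hc
    · have := (IntervalIntegrable.iff_comp_neg).1 (pos (-c) (by linarith))
      simpa using this
  exact (key a).symm.trans (key b)

/-- By the embedding, the difference quotient at angular distance `s` is at most a constant times
`|s| ^ (-1 / 2) * derivNorm h`, an integrable singularity. Thus the mean square of the derivative
controls the self-interaction without any Hölder norm. -/
theorem exists_circleMean_norm_diffQuot_le : ∃ C : ℝ, 0 ≤ C ∧
    ∀ (h : Circle → ℂ) (a : ℕ → ℝ), IsProfile h a → ∀ w : Circle,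
      circleMean (fun τ => ‖diffQuot h τ w‖) ≤ C * derivNorm h := by
  set I := ∫ s in (-Real.pi)..Real.pi, |s| ^ (-(1 / 2) : ℝ) with hI
  have hπ := Real.pi_pos
  have hI0 : 0 ≤ I := intervalIntegral.integral_nonneg (by linarith) fun s _ => by positivity
  refine ⟨(2 * Real.pi)⁻¹ * (Real.pi / 2 * √(2 * Real.pi) * I), by positivity, fun h a hh w => ?_⟩
  have hN := derivNorm_nonneg h
  rw [← circleMean_rotate _ w, circleMean_eq_intervalIntegral_symm, smul_eq_mul, mul_assoc]
  gcongr
  have hT : IntervalIntegrable (fun t : ℝ => ‖diffQuot h (w * Circle.exp t) w‖) volume (-Real.pi)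
      Real.pi := by
    obtain ⟨C, hC⟩ := hh.exists_bound
    have h1 : Measurable (fun t : ℝ => h (w * Circle.exp t)) :=
      (hh.diff.continuous.comp (continuous_const.mul Circle.exp.continuous)).measurable
    have h2 : Measurable (fun t : ℝ => ((w * Circle.exp t : Circle) : ℂ)) :=
      (continuous_circle_coe.comp (continuous_const.mul Circle.exp.continuous)).measurable
    have h3 : Measurable (fun t : ℝ => ‖diffQuot h (w * Circle.exp t) w‖) :=
      ((h1.sub_const _).div (h2.sub_const _)).norm
    rw [intervalIntegrable_iff]
    exact Measure.integrableOn_of_bounded (M := 2 * C) (by simp) h3.aestronglyMeasurable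
      (Eventually.of_forall fun t => by
        rw [norm_norm]; exact IsProfile.norm_diffQuot_le hh.diff hC _ _)
  have hB : IntervalIntegrable (fun s : ℝ => (Real.pi / 2 * √(2 * Real.pi) * derivNorm h) *
      |s| ^ (-(1 / 2) : ℝ)) volume (-Real.pi) Real.pi := (intervalIntegrable_abs_rpow _ _).const_mul _
  calc ∫ t in (-Real.pi)..Real.pi, ‖diffQuot h (w * Circle.exp t) w‖
      ≤ ∫ t in (-Real.pi)..Real.pi, (Real.pi / 2 * √(2 * Real.pi) * derivNorm h) *
        |t| ^ (-(1 / 2) : ℝ) := by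
        refine intervalIntegral.integral_mono_on_of_le_Ioo (by linarith) hT hB fun s hs => ?_
        -- On the diagonal the difference quotient is `0 / 0 = 0`.
        rcases eq_or_ne s 0 with rfl | hs0
        · simp only [Circle.exp_zero, mul_one, diffQuot, sub_self, div_zero, norm_zero]
          positivity
        have h1 := norm_sub_le_derivNorm hh.diff hh.cont w (s := s)
          (by rw [abs_le]; constructor <;> linarith [hs.1, hs.2])
        have h2 := abs_arg_le_norm_sub_one (Circle.exp s)
        rw [Circle.arg_exp hs.1 hs.2.le] at h2
        have h3 : ‖((w * Circle.exp s : Circle) : ℂ) - w‖ = ‖(Circle.exp s : ℂ) - 1‖ := by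
          rw [Circle.coe_mul, show (w : ℂ) * Circle.exp s - w = w * (Circle.exp s - 1) by ring,
            norm_mul, Circle.norm_coe, one_mul]
        have hs1 : 0 < |s| := abs_pos.2 hs0
        have h4 : 0 < ‖(Circle.exp s : ℂ) - 1‖ := by
          by_contra hneg
          have : ‖(Circle.exp s : ℂ) - 1‖ = 0 := le_antisymm (not_lt.1 hneg) (norm_nonneg _)
          rw [this, mul_zero] at h2
          linarith
        rw [diffQuot, norm_div, h3, div_le_iff₀ h4]
        have h5 : √|s| = |s| ^ (-(1 / 2) : ℝ) * |s| := by
          rw [Real.sqrt_eq_rpow]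
          conv_rhs => rw [← Real.rpow_add_one hs1.ne']
          norm_num
        rw [h5] at h1
        refine h1.trans ?_
        have hr : 0 ≤ |s| ^ (-(1 / 2) : ℝ) := by positivity
        calc |s| ^ (-(1 / 2) : ℝ) * |s| * (√(2 * Real.pi) * derivNorm h)
            ≤ |s| ^ (-(1 / 2) : ℝ) * (Real.pi / 2 * ‖(Circle.exp s : ℂ) - 1‖) *
              (√(2 * Real.pi) * derivNorm h) := by gcongr
          _ = _ := by ring
    _ = Real.pi / 2 * √(2 * Real.pi) * I * derivNorm h := by
        rw [intervalIntegral.integral_const_mul]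
        ring

/-! ### Lipschitz estimates -/

theorem norm_div_sub_div_le {n n' D D' : ℂ} {c K : ℝ} (hc : 0 < c) (hD : c ≤ ‖D‖) (hD' : c ≤ ‖D'‖)
    (hn : ‖n'‖ ≤ K) : ‖n / D - n' / D'‖ ≤ ‖n - n'‖ / c + K * ‖D - D'‖ / c ^ 2 := by
  have h1 : D ≠ 0 := norm_pos_iff.1 (hc.trans_le hD)
  have h2 : D' ≠ 0 := norm_pos_iff.1 (hc.trans_le hD')
  have e : n / D - n' / D' = (n - n') / D - n' * (D - D') / (D * D') := by field_simp; ring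
  rw [e]
  refine (norm_sub_le _ _).trans ?_
  rw [norm_div, norm_div, norm_mul, norm_mul]
  have hK : 0 ≤ K := (norm_nonneg _).trans hn
  gcongr
  rw [sq]
  gcongr

theorem norm_one_add_ge {z : ℂ} (hz : ‖z‖ ≤ 1 / 2) : 1 / 2 ≤ ‖1 + z‖ := by
  have h2 := norm_sub_norm_le (1 : ℂ) (-z)
  rw [norm_neg, norm_one, sub_neg_eq_add] at h2
  linarith

/-- The integrand of `selfKernel` as a function of the difference quotient `q` and the derivative
`y`. The bounds `2` and `1` are those of a `UnitBounded` profile, and `|η| ≤ 1 / 4` keeps the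
denominators above `1 / 2`. -/
theorem norm_selfQuotient_sub_le {η : ℝ} (hη : |η| ≤ 1 / 4) {q q' y y' : ℂ} (hq : ‖q‖ ≤ 2)
    (hq' : ‖q'‖ ≤ 2) (hy : ‖y‖ ≤ 1) (hy' : ‖y'‖ ≤ 1) :
    ‖(conj q - q) * (y - q) / (1 + η * q) - (conj q' - q') * (y' - q') / (1 + η * q')‖ ≤
      60 * (‖q - q'‖ + ‖y - y'‖) := by
  have hb : ∀ q : ℂ, ‖q‖ ≤ 2 → 1 / 2 ≤ ‖1 + (η : ℂ) * q‖ := fun q hq => norm_one_add_ge <| by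
    rw [norm_mul, Complex.norm_real, Real.norm_eq_abs]
    nlinarith [norm_nonneg q, abs_nonneg η]
  have hcq : ∀ q : ℂ, ‖conj q - q‖ ≤ 2 * ‖q‖ := fun q => by
    refine (norm_sub_le _ _).trans ?_
    rw [Complex.norm_conj]; linarith
  have h3 : ∀ q y : ℂ, ‖q‖ ≤ 2 → ‖y‖ ≤ 1 → ‖y - q‖ ≤ 3 := fun q y hq hy =>
    (norm_sub_le _ _).trans (by linarith)
  have hn' : ‖(conj q' - q') * (y' - q')‖ ≤ 12 := by
    rw [norm_mul]
    nlinarith [hcq q', h3 q' y' hq' hy', norm_nonneg (conj q' - q'), norm_nonneg (y' - q')]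
  refine (norm_div_sub_div_le (by norm_num) (hb q hq) (hb q' hq') hn').trans ?_
  have e1 : (1 + (η : ℂ) * q) - (1 + (η : ℂ) * q') = η * (q - q') := by ring
  have e2 : (conj q - q) * (y - q) - (conj q' - q') * (y' - q') =
      (conj (q - q') - (q - q')) * (y - q) + (conj q' - q') * ((y - y') - (q - q')) := by
    rw [map_sub]; ring
  have h5 : ‖(conj q - q) * (y - q) - (conj q' - q') * (y' - q')‖ ≤
      2 * ‖q - q'‖ * 3 + 4 * (‖y - y'‖ + ‖q - q'‖) := by
    rw [e2]
    refine (norm_add_le _ _).trans (add_le_add ?_ ?_) <;> rw [norm_mul]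
    · exact mul_le_mul (hcq _) (h3 q y hq hy) (norm_nonneg _) (by positivity)
    · exact mul_le_mul ((hcq q').trans (by linarith)) (norm_sub_le _ _) (norm_nonneg _) (by norm_num)
  rw [e1, norm_mul, Complex.norm_real, Real.norm_eq_abs]
  have h6 : |η| * ‖q - q'‖ ≤ 1 / 4 * ‖q - q'‖ := by gcongr
  have h7 := norm_nonneg (y - y')
  have h8 := norm_nonneg (q - q')
  rw [div_eq_mul_inv _ ((1 / 2 : ℝ)), div_eq_mul_inv _ ((1 / 2 : ℝ) ^ 2)]
  norm_num only
  linarith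

/-- The bounds used for the boundary perturbations. -/
structure UnitBounded (f : Circle → ℂ) : Prop where
  norm_le : ∀ w, ‖f w‖ ≤ 1
  norm_deriv_le : ∀ w, ‖circleDeriv f w‖ ≤ 1

variable {f f₁ g g₁ : Circle → ℂ} {a a₁ a' a₁' : ℕ → ℝ}

theorem UnitBounded.eta_le (hf : UnitBounded f) {η : ℝ} (hη : |η| ≤ 1 / 4) (w : Circle) :
    ‖(η : ℂ) * circleDeriv f w‖ ≤ 1 / 4 := by
  rw [norm_mul, Complex.norm_real, Real.norm_eq_abs]
  nlinarith [hf.norm_deriv_le w, norm_nonneg (circleDeriv f w), abs_nonneg η]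

theorem norm_circleMean_le_circleMean {F : Circle → ℂ} {G : Circle → ℝ}
    (hG : Integrable (fun t => G (Circle.exp t)) angleMeasure) (h : ∀ τ, ‖F τ‖ ≤ G τ) :
    ‖circleMean F‖ ≤ circleMean G :=
  norm_integral_le_of_norm_le hG (Eventually.of_forall fun _ => h _)

/-- The pointwise Lipschitz bound is integrated over `τ`. The difference quotients of `f - f₁` need
to be small only in mean, and `derivNorm` controls that. -/
theorem exists_selfKernel_lipschitz : ∃ C : ℝ, 0 ≤ C ∧
    ∀ (f f₁ : Circle → ℂ) (a a₁ : ℕ → ℝ), IsProfile f a → IsProfile f₁ a₁ → UnitBounded f →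
      UnitBounded f₁ → ∀ η : ℝ, |η| ≤ 1 / 4 → ∀ w,
      ‖circleMean (selfKernel η f w) - circleMean (selfKernel η f₁ w)‖ ≤
        C * derivNorm (fun τ => f τ - f₁ τ) := by
  obtain ⟨C, hC0, hC⟩ := exists_circleMean_norm_diffQuot_le
  refine ⟨60 * (C + 1), by positivity, fun f f₁ a a₁ hf hf₁ bf bf₁ η hη w => ?_⟩
  have hh := hf.sub hf₁
  have hq : Tame (fun τ => diffQuot (fun τ => f τ - f₁ τ) τ w) := hh.tame_diffQuot w
  have hd : Tame (circleDeriv (fun τ => f τ - f₁ τ)) := Tame.of_continuous hh.cont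
  rw [← circleMean_sub (tame_selfKernel hf (bf.eta_le hη) w) (tame_selfKernel hf₁ (bf₁.eta_le hη) w)]
  have hb := norm_circleMean_le_circleMean (F := fun τ => selfKernel η f w τ - selfKernel η f₁ w τ)
    (G := fun τ => 60 * (‖diffQuot (fun τ => f τ - f₁ τ) τ w‖ +
      ‖circleDeriv (fun τ => f τ - f₁ τ) τ‖)) ((hq.norm.add hd.norm).const_mul 60) (fun τ => by
        have e : diffQuot (fun τ => f τ - f₁ τ) τ w = diffQuot f τ w - diffQuot f₁ τ w := by
          simp only [diffQuot]; ring
        rw [e, hf.circleDeriv_sub hf₁]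
        refine norm_selfQuotient_sub_le hη ?_ ?_ (bf.norm_deriv_le τ) (bf₁.norm_deriv_le τ)
        · simpa using IsProfile.norm_diffQuot_le hf.diff bf.norm_deriv_le τ w
        · simpa using IsProfile.norm_diffQuot_le hf₁.diff bf₁.norm_deriv_le τ w)
  refine hb.trans ?_
  have e2 : circleMean (fun τ => 60 * (‖diffQuot (fun τ => f τ - f₁ τ) τ w‖ +
      ‖circleDeriv (fun τ => f τ - f₁ τ) τ‖)) = 60 * (circleMean (fun τ =>
        ‖diffQuot (fun τ => f τ - f₁ τ) τ w‖) + circleMean (fun τ =>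
      ‖circleDeriv (fun τ => f τ - f₁ τ) τ‖)) := by
    simp only [circleMean]
    rw [integral_const_mul, integral_add hq.norm hd.norm]
  rw [e2]
  have h1 := hC _ _ hh w
  have h2 := circleMean_norm_circleDeriv_le hh.cont
  linarith

theorem norm_patch_le (hf : UnitBounded f) {η : ℝ} (hη : |η| ≤ 1 / 4) (w : Circle) :
    ‖(w : ℂ) + η * f w‖ ≤ 2 := by
  refine (norm_add_le _ _).trans ?_
  rw [norm_mul, Complex.norm_real, Real.norm_eq_abs, Circle.norm_coe]
  nlinarith [hf.norm_le w, norm_nonneg (f w), abs_nonneg η]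

theorem norm_patch_deriv_le (hf : UnitBounded f) {η : ℝ} (hη : |η| ≤ 1 / 4) (w : Circle) :
    ‖1 + (η : ℂ) * circleDeriv f w‖ ≤ 2 := by
  refine (norm_add_le _ _).trans ?_
  have := hf.eta_le hη w
  rw [norm_one]
  linarith

/-- Each of the two curves has size at most `2 * (d / 8)`, so a gap of `d / 2` is left. -/
theorem le_re_separation {d κ η η' : ℝ} (hκ : κ ≤ 1 / 4) (hκd : κ ≤ d / 8) (hη : |η| ≤ κ)
    (hη' : |η'| ≤ κ) (hf : UnitBounded f) (hg : UnitBounded g) (w τ : Circle) :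
    d / 2 ≤ ((d : ℂ) - η * ((w : ℂ) + η * f w) - η' * ((τ : ℂ) + η' * g τ)).re := by
  have h1 := norm_patch_le hf (hη.trans hκ) w
  have h2 := norm_patch_le hg (hη'.trans hκ) τ
  have h3 : ‖(η : ℂ) * ((w : ℂ) + η * f w)‖ ≤ d / 8 * 2 := by
    rw [norm_mul, Complex.norm_real, Real.norm_eq_abs]
    have := abs_nonneg η
    exact mul_le_mul (hη.trans hκd) h1 (norm_nonneg _) (by linarith)
  have h4 : ‖(η' : ℂ) * ((τ : ℂ) + η' * g τ)‖ ≤ d / 8 * 2 := by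
    rw [norm_mul, Complex.norm_real, Real.norm_eq_abs]
    have := abs_nonneg η'
    exact mul_le_mul (hη'.trans hκd) h2 (norm_nonneg _) (by linarith)
  have h5 := (Complex.re_le_norm _).trans h3
  have h6 := (Complex.re_le_norm _).trans h4
  rw [Complex.sub_re, Complex.sub_re, Complex.ofReal_re]
  linarith

theorem tame_crossKernel {d κ η η' : ℝ} (hd : 0 < d) (hκ : κ ≤ 1 / 4) (hκd : κ ≤ d / 8) (hη : |η| ≤ κ)
    (hη' : |η'| ≤ κ) (hf : UnitBounded f) (hg : UnitBounded g) (hpg : IsProfile g a') (w : Circle) :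
    Tame (crossKernel η' g (d - η * ((w : ℂ) + η * f w))) := by
  have hτ : Tame (fun τ : Circle => (τ : ℂ)) := Tame.of_continuous continuous_circle_coe
  have hφ : Tame (fun τ : Circle => (τ : ℂ) + η' * g τ) :=
    hτ.add ((Tame.const _).mul (Tame.of_continuous hpg.diff.continuous))
  refine ((hτ.mul hφ.star).mul ((Tame.const 1).add ((Tame.const _).mul
    (Tame.of_continuous hpg.cont)))).div ((Tame.const _).sub ((Tame.const _).mul hφ)) (half_pos hd)
    fun τ => ?_
  exact (le_re_separation hκ hκd hη hη' hf hg w τ).trans (Complex.re_le_norm _)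

/-- The kernel sees the profiles only after multiplication by `η` or `η'`, which produces the factor
`κ`. The values of the differences are bounded uniformly by `derivNorm`, and the derivative of `g -
g₁` only in mean. -/
theorem exists_crossKernel_lipschitz {d : ℝ} (hd : 0 < d) : ∃ C : ℝ, 0 ≤ C ∧
    ∀ (f f₁ g g₁ : Circle → ℂ) (a a₁ a' a₁' : ℕ → ℝ), IsProfile f a → IsProfile f₁ a₁ →
      IsProfile g a' → IsProfile g₁ a₁' → UnitBounded f → UnitBounded f₁ → UnitBounded g →
      UnitBounded g₁ → ∀ κ η η' : ℝ, κ ≤ 1 / 4 → κ ≤ d / 8 → |η| ≤ κ → |η'| ≤ κ → ∀ w : Circle,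
      ‖circleMean (crossKernel η' g (d - η * ((w : ℂ) + η * f w))) -
        circleMean (crossKernel η' g₁ (d - η * ((w : ℂ) + η * f₁ w)))‖ ≤
        C * κ * (derivNorm (fun τ => f τ - f₁ τ) + derivNorm (fun τ => g τ - g₁ τ)) := by
  set c := d / 2 with hc
  have hc0 : 0 < c := half_pos hd
  set M := 2 / c + 2 * Real.pi * (2 / c) + 2 * Real.pi * (4 / c ^ 2) with hM
  have hπ := Real.pi_pos
  refine ⟨M, by positivity, fun f f₁ g g₁ a a₁ a' a₁' hf hf₁ hg hg₁ bf bf₁ bg bg₁ κ η η' hκ hκd hη hη' w =>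
    ?_⟩
  have hκ0 : 0 ≤ κ := (abs_nonneg _).trans hη
  have hh := hf.sub hf₁
  have hk := hg.sub hg₁
  have hkd : Tame (circleDeriv (fun τ => g τ - g₁ τ)) := Tame.of_continuous hk.cont
  have hw := hh.norm_le_derivNorm w
  set N := derivNorm (fun τ => f τ - f₁ τ) with hN
  set N' := derivNorm (fun τ => g τ - g₁ τ) with hN'
  have hN0 : 0 ≤ N := derivNorm_nonneg _
  have hN0' : 0 ≤ N' := derivNorm_nonneg _
  rw [← circleMean_sub (tame_crossKernel hd hκ hκd hη hη' bf bg hg w)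
    (tame_crossKernel hd hκ hκd hη hη' bf₁ bg₁ hg₁ w)]
  have hb := norm_circleMean_le_circleMean (F := fun τ => crossKernel η' g (d - η * ((w : ℂ) + η * f w)) τ -
    crossKernel η' g₁ (d - η * ((w : ℂ) + η * f₁ w)) τ)
    (G := fun τ => κ * (2 / c) * ‖circleDeriv (fun τ => g τ - g₁ τ) τ‖ +
      κ * (2 * Real.pi * (2 / c) * N' + 2 * Real.pi * (4 / c ^ 2) * (N + N')))
      ((hkd.norm.const_mul _).add (integrable_const _)) (fun τ => by
    have hτ := hk.norm_le_derivNorm τ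
    have k1 := (le_re_separation hκ hκd hη hη' bf bg w τ).trans (Complex.re_le_norm _)
    have k2 := (le_re_separation hκ hκd hη hη' bf₁ bg₁ w τ).trans (Complex.re_le_norm _)
    have p1 := norm_patch_le bg (hη'.trans hκ) τ
    have p2 := norm_patch_le bg₁ (hη'.trans hκ) τ
    have p3 := norm_patch_deriv_le bg (hη'.trans hκ) τ
    have p4 := norm_patch_deriv_le bg₁ (hη'.trans hκ) τ
    have n1 : ‖(τ : ℂ) * conj ((τ : ℂ) + η' * g₁ τ) * (1 + η' * circleDeriv g₁ τ)‖ ≤ 4 := by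
      rw [norm_mul, norm_mul, Circle.norm_coe, one_mul, Complex.norm_conj]
      nlinarith [norm_nonneg ((τ : ℂ) + η' * g₁ τ), norm_nonneg (1 + η' * circleDeriv g₁ τ)]
    refine (norm_div_sub_div_le hc0 k1 k2 n1).trans ?_
    have e1 : (τ : ℂ) * conj ((τ : ℂ) + η' * g τ) * (1 + η' * circleDeriv g τ) -
        (τ : ℂ) * conj ((τ : ℂ) + η' * g₁ τ) * (1 + η' * circleDeriv g₁ τ) =
        τ * (η' * (conj (g τ - g₁ τ) * (1 + η' * circleDeriv g τ) +
          conj ((τ : ℂ) + η' * g₁ τ) * circleDeriv (fun τ => g τ - g₁ τ) τ)) := by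
      rw [hg.circleDeriv_sub hg₁]
      simp only [map_add, map_mul, map_sub, Complex.conj_ofReal]
      ring
    have e2 : (d : ℂ) - η * ((w : ℂ) + η * f w) - η' * ((τ : ℂ) + η' * g τ) -
        ((d : ℂ) - η * ((w : ℂ) + η * f₁ w) - η' * ((τ : ℂ) + η' * g₁ τ)) =
        -(η * (η * (f w - f₁ w)) + η' * (η' * (g τ - g₁ τ))) := by ring
    have n2 : ‖(τ : ℂ) * conj ((τ : ℂ) + η' * g τ) * (1 + η' * circleDeriv g τ) -
        (τ : ℂ) * conj ((τ : ℂ) + η' * g₁ τ) * (1 + η' * circleDeriv g₁ τ)‖ ≤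
        κ * (2 * Real.pi * N' * 2 + 2 * ‖circleDeriv (fun τ => g τ - g₁ τ) τ‖) := by
      rw [e1, norm_mul, norm_mul, Circle.norm_coe, one_mul, Complex.norm_real, Real.norm_eq_abs]
      refine mul_le_mul hη' ((norm_add_le _ _).trans (add_le_add ?_ ?_)) (norm_nonneg _) hκ0 <;>
        rw [norm_mul, Complex.norm_conj]
      · exact mul_le_mul hτ p3 (norm_nonneg _) (by positivity)
      · exact mul_le_mul_of_nonneg_right p2 (norm_nonneg _)
    have n3 : ‖(d : ℂ) - η * ((w : ℂ) + η * f w) - η' * ((τ : ℂ) + η' * g τ) -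
        ((d : ℂ) - η * ((w : ℂ) + η * f₁ w) - η' * ((τ : ℂ) + η' * g₁ τ))‖ ≤
        κ * (2 * Real.pi * (N + N')) := by
      have aux : ∀ (ξ : ℝ) (x : ℂ) (R : ℝ), |ξ| ≤ κ → ‖x‖ ≤ R → ‖(ξ : ℂ) * (ξ * x)‖ ≤ κ * R := by
        intro ξ x R h1 h2
        rw [norm_mul, norm_mul, Complex.norm_real, Real.norm_eq_abs]
        have := abs_nonneg ξ
        have h3 : |ξ| * ‖x‖ ≤ 1 * R := mul_le_mul (by linarith) h2 (norm_nonneg _) (by norm_num)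
        exact mul_le_mul h1 (by linarith) (by positivity) hκ0
      rw [e2, norm_neg]
      refine (norm_add_le _ _).trans ((add_le_add (aux _ _ _ hη hw) (aux _ _ _ hη' hτ)).trans ?_)
      exact le_of_eq (by ring)
    calc _ ≤ κ * (2 * Real.pi * N' * 2 + 2 * ‖circleDeriv (fun τ => g τ - g₁ τ) τ‖) / c +
        4 * (κ * (2 * Real.pi * (N + N'))) / c ^ 2 := by gcongr
      _ = _ := by ring)
  refine hb.trans ?_
  have e2 : circleMean (fun τ => κ * (2 / c) * ‖circleDeriv (fun τ => g τ - g₁ τ) τ‖ +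
      κ * (2 * Real.pi * (2 / c) * N' + 2 * Real.pi * (4 / c ^ 2) * (N + N'))) =
      κ * (2 / c) * circleMean (fun τ => ‖circleDeriv (fun τ => g τ - g₁ τ) τ‖) +
      κ * (2 * Real.pi * (2 / c) * N' + 2 * Real.pi * (4 / c ^ 2) * (N + N')) := by
    simp only [circleMean]
    rw [integral_add (hkd.norm.const_mul _) (integrable_const _), integral_const_mul]
    simp
  rw [e2]
  have h2 := circleMean_norm_circleDeriv_le hk.cont
  calc _ ≤ κ * (2 / c) * N' +
        κ * (2 * Real.pi * (2 / c) * N' + 2 * Real.pi * (4 / c ^ 2) * (N + N')) := by gcongr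
    _ ≤ M * κ * (N + N') := by
      rw [hM]
      have : 0 ≤ κ * (2 / c) * N := by positivity
      have : 0 ≤ κ * (2 * Real.pi * (2 / c)) * N := by positivity
      nlinarith

variable {f f₁ g g₁ : Circle → ℂ} {a a₁ a' a₁' : ℕ → ℝ}

theorem norm_circleMean_selfKernel_le (hf : IsProfile f a) (bf : UnitBounded f) {η : ℝ}
    (hη : |η| ≤ 1 / 4) (w : Circle) : ‖circleMean (selfKernel η f w)‖ ≤ 180 := by
  refine norm_circleMean_le fun τ => ?_
  have h1 := IsProfile.norm_diffQuot_le hf.diff bf.norm_deriv_le τ w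
  rw [mul_one] at h1
  have h2 := norm_selfQuotient_sub_le hη (q' := 0) (y' := 0) h1 (by simp) (bf.norm_deriv_le τ) (by simp)
  simp only [map_zero, sub_self, zero_mul, zero_div, sub_zero] at h2
  refine h2.trans ?_
  linarith [bf.norm_deriv_le τ]

theorem norm_circleMean_crossKernel_le {d κ η η' : ℝ} (hd : 0 < d) (hκ : κ ≤ 1 / 4) (hκd : κ ≤ d / 8)
    (hη : |η| ≤ κ) (hη' : |η'| ≤ κ) (hf : UnitBounded f) (hg : UnitBounded g) (w : Circle) :
    ‖circleMean (crossKernel η' g (d - η * ((w : ℂ) + η * f w)))‖ ≤ 8 / d := by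
  refine norm_circleMean_le fun τ => ?_
  have k1 := (le_re_separation hκ hκd hη hη' hf hg w τ).trans (Complex.re_le_norm _)
  have p1 := norm_patch_le hg (hη'.trans hκ) τ
  have p3 := norm_patch_deriv_le hg (hη'.trans hκ) τ
  have n1 : ‖(τ : ℂ) * conj ((τ : ℂ) + η' * g τ) * (1 + η' * circleDeriv g τ)‖ ≤ 4 := by
    rw [norm_mul, norm_mul, Circle.norm_coe, one_mul, Complex.norm_conj]
    nlinarith [norm_nonneg ((τ : ℂ) + η' * g τ), norm_nonneg (1 + η' * circleDeriv g τ)]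
  rw [crossKernel, norm_div]
  calc _ ≤ 4 / (d / 2) := by gcongr
    _ = 8 / d := by field_simp; norm_num

/-- At `η = η' = 0` the variable part of the field is `-(γ / 2 * f' + A * w)`. Once the difference
of these parts is removed, every term carries a factor `η` or is a difference of cross velocities,
which is `O(κ)` as well. The telescoping is arranged so that `Ω` and `A` occur only in `Ω - Ω₁` and
`A - A₁`. Hence an a priori bound is needed for `Ω₁` and `A₁` alone, which will belong to the
approximate solution. -/
theorem exists_reducedField_lipschitz {d : ℝ} (hd : 0 < d) (γ γ' M : ℝ) (hM : 0 ≤ M) :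
    ∃ C : ℝ, 0 ≤ C ∧
    ∀ (f f₁ g g₁ : Circle → ℂ) (a a₁ a' a₁' : ℕ → ℝ), IsProfile f a → IsProfile f₁ a₁ →
      IsProfile g a' → IsProfile g₁ a₁' → UnitBounded f → UnitBounded f₁ → UnitBounded g →
      UnitBounded g₁ → ∀ κ η η' : ℝ, κ ≤ 1 / 4 → κ ≤ d / 8 → |η| ≤ κ → |η'| ≤ κ →
      ∀ Ω Ω₁ A A₁ : ℝ, |Ω₁| ≤ M → |A₁| ≤ M → ∀ w : Circle,
      ‖reducedField γ γ' η η' d Ω A f g w - reducedField γ γ' η η' d Ω₁ A₁ f₁ g₁ w +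
        (γ / 2 * circleDeriv (fun τ => f τ - f₁ τ) w + (A - A₁) * w)‖ ≤
        C * κ * (|Ω - Ω₁| + |A - A₁| + derivNorm (fun τ => f τ - f₁ τ) +
          derivNorm (fun τ => g τ - g₁ τ) + ‖circleDeriv (fun τ => f τ - f₁ τ) w‖) := by
  obtain ⟨C₁, hC₁, H₁⟩ := exists_selfKernel_lipschitz
  obtain ⟨C₂, hC₂, H₂⟩ := exists_crossKernel_lipschitz hd
  have hπ := Real.pi_pos
  refine ⟨4 + 4 * Real.pi * M + |γ| * C₁ + |γ'| * C₂ + 1 + (3 * M + 90 * |γ| + 4 * |γ'| / d),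
    by positivity, fun f f₁ g g₁ a a₁ a' a₁' hf hf₁ hg hg₁ bf bf₁ bg bg₁ κ η η' hκ hκd hη hη' Ω Ω₁ A A₁
      hΩ hA w => ?_⟩
  have hκ0 : 0 ≤ κ := (abs_nonneg _).trans hη
  have hη4 := hη.trans hκ
  have s1 := H₁ f f₁ a a₁ hf hf₁ bf bf₁ η hη4 w
  have s2 := H₂ f f₁ g g₁ a a₁ a' a₁' hf hf₁ hg hg₁ bf bf₁ bg bg₁ κ η η' hκ hκd hη hη' w
  have s3 := norm_circleMean_selfKernel_le hf₁ bf₁ hη4 w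
  have s4 := norm_circleMean_crossKernel_le hd hκ hκd hη hη' bf₁ bg₁ w
  have s5 := (hf.sub hf₁).norm_le_derivNorm w
  have s6 := norm_patch_le bf hη4 w
  have s6' := norm_patch_le bf₁ hη4 w
  have s7 := norm_patch_deriv_le bf hη4 w
  have s8 := bf.norm_deriv_le w
  have hN0 := derivNorm_nonneg (fun τ => f τ - f₁ τ)
  have hN0' := derivNorm_nonneg (fun τ => g τ - g₁ τ)
  have e0 : circleDeriv (fun τ => f τ - f₁ τ) w = circleDeriv f w - circleDeriv f₁ w := by
    rw [hf.circleDeriv_sub hf₁]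
  rw [reducedField, reducedField]
  set S := circleMean (selfKernel η f w)
  set S₁ := circleMean (selfKernel η f₁ w)
  set J := circleMean (crossKernel η' g (d - η * ((w : ℂ) + η * f w)))
  set J₁ := circleMean (crossKernel η' g₁ (d - η * ((w : ℂ) + η * f₁ w)))
  set N := derivNorm (fun τ => f τ - f₁ τ)
  set N' := derivNorm (fun τ => g τ - g₁ τ)
  set D := circleDeriv (fun τ => f τ - f₁ τ) w
  have e1 : -((γ : ℂ) / 2) * circleDeriv f w + (Ω * η * conj ((w : ℂ) + η * f w) - A -
        γ / 2 * (η * conj (w : ℂ) * S) + γ' / 2 * J) * (w * (1 + η * circleDeriv f w)) -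
      (-((γ : ℂ) / 2) * circleDeriv f₁ w + (Ω₁ * η * conj ((w : ℂ) + η * f₁ w) - A₁ -
        γ / 2 * (η * conj (w : ℂ) * S₁) + γ' / 2 * J₁) * (w * (1 + η * circleDeriv f₁ w))) +
      (γ / 2 * D + (A - A₁) * w) =
      ((η : ℂ) * ((Ω - Ω₁ : ℝ) * conj ((w : ℂ) + η * f w)) + η * (Ω₁ * (η * conj (f w - f₁ w))) -
        η * (γ / 2 * conj (w : ℂ) * (S - S₁)) + γ' / 2 * (J - J₁)) *
          (w * (1 + η * circleDeriv f w)) -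
      η * ((A - A₁ : ℝ) * (w * circleDeriv f w)) +
      (η * (Ω₁ * conj ((w : ℂ) + η * f₁ w)) - A₁ - η * (γ / 2 * conj (w : ℂ) * S₁) + γ' / 2 * J₁) *
        (η * (w * D)) := by
    rw [e0]
    simp only [map_add, map_mul, map_sub, Complex.conj_ofReal]
    push_cast
    ring
  rw [e1]
  have nη : ∀ (x : ℂ) (R : ℝ), ‖x‖ ≤ R → ‖(η : ℂ) * x‖ ≤ κ * R := fun x R hx => by
    rw [norm_mul, Complex.norm_real, Real.norm_eq_abs]
    exact mul_le_mul hη hx (norm_nonneg _) hκ0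
  have nη1 : ∀ (x : ℂ) (R : ℝ), ‖x‖ ≤ R → ‖(η : ℂ) * x‖ ≤ R := fun x R hx => by
    refine (nη x R hx).trans ?_
    nlinarith [(norm_nonneg x).trans hx]
  have hγ2 : ‖(γ : ℂ) / 2‖ = |γ| / 2 := by
    rw [norm_div, Complex.norm_real, Real.norm_eq_abs]; norm_num
  have hγ2' : ‖(γ' : ℂ) / 2‖ = |γ'| / 2 := by
    rw [norm_div, Complex.norm_real, Real.norm_eq_abs]; norm_num
  have t1 : ‖(η : ℂ) * ((Ω - Ω₁ : ℝ) * conj ((w : ℂ) + η * f w))‖ ≤ κ * (|Ω - Ω₁| * 2) := by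
    refine nη _ _ ?_
    rw [norm_mul, Complex.norm_real, Real.norm_eq_abs, Complex.norm_conj]
    gcongr
  have t2 : ‖(η : ℂ) * (Ω₁ * (η * conj (f w - f₁ w)))‖ ≤ κ * (M * (2 * Real.pi * N)) := by
    refine nη _ _ ?_
    rw [norm_mul, Complex.norm_real, Real.norm_eq_abs]
    refine mul_le_mul hΩ (nη1 _ _ ?_) (norm_nonneg _) hM
    rwa [Complex.norm_conj]
  have t3 : ‖(η : ℂ) * (γ / 2 * conj (w : ℂ) * (S - S₁))‖ ≤ κ * (|γ| / 2 * (C₁ * N)) := by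
    refine nη _ _ ?_
    rw [norm_mul, norm_mul, hγ2, Complex.norm_conj, Circle.norm_coe, mul_one]
    gcongr
  have t4 : ‖(γ' : ℂ) / 2 * (J - J₁)‖ ≤ κ * (|γ'| / 2 * (C₂ * (N + N'))) := by
    rw [norm_mul, hγ2']
    calc _ ≤ |γ'| / 2 * (C₂ * κ * (N + N')) := by gcongr
      _ = _ := by ring
  have t5 : ‖(w : ℂ) * (1 + η * circleDeriv f w)‖ ≤ 2 := by
    rw [norm_mul, Circle.norm_coe, one_mul]; exact s7
  have t6 : ‖(η : ℂ) * ((A - A₁ : ℝ) * (w * circleDeriv f w))‖ ≤ κ * (|A - A₁| * 1) := by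
    refine nη _ _ ?_
    rw [norm_mul, norm_mul, Circle.norm_coe, one_mul, Complex.norm_real, Real.norm_eq_abs]
    gcongr
  have t7 : ‖(η : ℂ) * (w * D)‖ ≤ κ * ‖D‖ := by
    refine nη _ _ ?_
    rw [norm_mul, Circle.norm_coe, one_mul]
  have t8 : ‖(η : ℂ) * (Ω₁ * conj ((w : ℂ) + η * f₁ w))‖ ≤ M * 2 := by
    refine nη1 _ _ ?_
    rw [norm_mul, Complex.norm_real, Real.norm_eq_abs, Complex.norm_conj]
    exact mul_le_mul hΩ s6' (norm_nonneg _) hM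
  have t9 : ‖(η : ℂ) * (γ / 2 * conj (w : ℂ) * S₁)‖ ≤ |γ| / 2 * 180 := by
    refine nη1 _ _ ?_
    rw [norm_mul, norm_mul, hγ2, Complex.norm_conj, Circle.norm_coe, mul_one]
    gcongr
  have t10 : ‖(γ' : ℂ) / 2 * J₁‖ ≤ |γ'| / 2 * (8 / d) := by
    rw [norm_mul, hγ2']
    gcongr
  have t11 : ‖(A₁ : ℂ)‖ ≤ M := by rwa [Complex.norm_real, Real.norm_eq_abs]
  have u1 : ‖(η : ℂ) * ((Ω - Ω₁ : ℝ) * conj ((w : ℂ) + η * f w)) + η * (Ω₁ * (η * conj (f w - f₁ w))) -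
        η * (γ / 2 * conj (w : ℂ) * (S - S₁)) + γ' / 2 * (J - J₁)‖ ≤
      κ * (|Ω - Ω₁| * 2) + κ * (M * (2 * Real.pi * N)) + κ * (|γ| / 2 * (C₁ * N)) +
        κ * (|γ'| / 2 * (C₂ * (N + N'))) :=
    (norm_add_le _ _).trans (add_le_add ((norm_sub_le _ _).trans (add_le_add
      ((norm_add_le _ _).trans (add_le_add t1 t2)) t3)) t4)
  have u2 : ‖(η : ℂ) * (Ω₁ * conj ((w : ℂ) + η * f₁ w)) - A₁ - η * (γ / 2 * conj (w : ℂ) * S₁) +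
      γ' / 2 * J₁‖ ≤ M * 2 + M + |γ| / 2 * 180 + |γ'| / 2 * (8 / d) :=
    (norm_add_le _ _).trans (add_le_add ((norm_sub_le _ _).trans (add_le_add
      ((norm_sub_le _ _).trans (add_le_add t8 t11)) t9)) t10)
  refine (norm_add_le _ _).trans ((add_le_add ((norm_sub_le _ _).trans (add_le_add
    ((norm_mul_le _ _).trans (mul_le_mul u1 t5 (norm_nonneg _) (by positivity))) t6))
    ((norm_mul_le _ _).trans (mul_le_mul u2 t7 (norm_nonneg _) (by positivity)))).trans ?_)
  have v1 := abs_nonneg (Ω - Ω₁)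
  have v2 := abs_nonneg (A - A₁)
  have v3 := norm_nonneg D
  have v4 := abs_nonneg γ
  have v5 := abs_nonneg γ'
  set p := |γ'| / 2 * (8 / d) with hp
  have hp2 : 4 * |γ'| / d = p := by rw [hp]; field_simp; ring
  have hp0 : 0 ≤ p := by positivity
  rw [hp2]
  set P := |Ω - Ω₁| + |A - A₁| + N + N' + ‖D‖ with hP
  have w1 : |Ω - Ω₁| ≤ P := by linarith
  have w2 : |A - A₁| ≤ P := by linarith
  have w3 : N ≤ P := by linarith
  have w4 : N + N' ≤ P := by linarith
  have w5 : ‖D‖ ≤ P := by linarith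
  calc _ ≤ (κ * (P * 2) + κ * (M * (2 * Real.pi * P)) + κ * (|γ| / 2 * (C₁ * P)) +
        κ * (|γ'| / 2 * (C₂ * P))) * 2 + κ * (P * 1) +
        (M * 2 + M + |γ| / 2 * 180 + p) * (κ * P) := by gcongr
    _ = _ := by ring

/-! ### Coercivity of the linearization at `ε = 0`. -/

/-- The Fourier coefficient of `Im F` at `k` is `(c k - conj (c (-k))) / (2 I)`. If one of every two
opposite coefficients vanishes, nothing can cancel, and Parseval gives half of the total mass. -/
theorem circleMean_im_sq {F : Circle → ℂ} (hF : Tame F)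
    (h : ∀ k : ℤ, circleMean (fun τ => (τ : ℂ) ^ (-k) * F τ) = 0 ∨
      circleMean (fun τ => (τ : ℂ) ^ k * F τ) = 0) :
    circleMean (fun τ => (F τ).im ^ 2) = circleMean (fun τ => ‖F τ‖ ^ 2) / 2 := by
  set c : ℤ → ℂ := fun k => circleMean (fun τ => (τ : ℂ) ^ (-k) * F τ) with hc
  have hz : ∀ k : ℤ, Tame (fun τ : Circle => (τ : ℂ) ^ k) := fun k =>
    Tame.of_continuous (continuous_circle_zpow k)
  have h1 : HasSum (fun k => ‖c k‖ ^ 2) _ := hasSum_sq_circleMean hF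
  have h1' : HasSum (fun k => ‖c (-k)‖ ^ 2) _ := (Equiv.neg ℤ).hasSum_iff.2 h1
  have h2 := hasSum_sq_circleMean ((Tame.const (1 / (2 * Complex.I))).mul (hF.sub hF.star))
  have e1 : ∀ k : ℤ, circleMean (fun τ : Circle => (τ : ℂ) ^ (-k) *
      (1 / (2 * Complex.I) * (F τ - conj (F τ)))) = 1 / (2 * Complex.I) * (c k - conj (c (-k))) := by
    intro k
    rw [hc]
    simp only
    rw [← circleMean_conj, ← circleMean_sub ((hz _).mul hF) ((hz _).mul hF).star, ← circleMean_const_mul]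
    congr 1
    ext τ
    rw [map_mul, map_zpow₀, conj_circle, inv_zpow, ← zpow_neg, neg_neg]
    ring
  have e2 : ∀ k : ℤ, ‖1 / (2 * Complex.I) * (c k - conj (c (-k)))‖ ^ 2 =
      1 / 4 * (‖c k‖ ^ 2 + ‖c (-k)‖ ^ 2) := by
    intro k
    have : ‖1 / (2 * Complex.I)‖ = 1 / 2 := by simp
    rw [norm_mul, this]
    rcases h k with h0 | h0
    · have : c k = 0 := h0
      rw [this, zero_sub, norm_neg, Complex.norm_conj, norm_zero]; ring
    · have : c (-k) = 0 := by simp only [hc, neg_neg]; exact h0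
      rw [this, map_zero, sub_zero, norm_zero]; ring
  simp only [e1, e2] at h2
  have h3 := h2.unique ((h1.add h1').mul_left (1 / 4))
  have e3 : ∀ τ : Circle, ‖1 / (2 * Complex.I) * (F τ - conj (F τ))‖ ^ 2 = (F τ).im ^ 2 := by
    intro τ
    rw [Complex.sub_conj]
    have : 1 / (2 * Complex.I) * ((2 * (F τ).im : ℝ) * Complex.I) = ((F τ).im : ℂ) := by
      push_cast
      field_simp
    rw [this, Complex.norm_real, Real.norm_eq_abs, sq_abs]
  simp only [e3] at h3
  rw [h3]
  ring

/-- The frequencies of `f'` are at most `-2` and that of `w` is `1`. No two of them are opposite,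
and the two parts are orthogonal, so their squares add. -/
theorem IsProfile.circleMean_im_sq (hf : IsProfile f a) (γ α : ℝ) :
    circleMean (fun w => ((γ : ℂ) / 2 * circleDeriv f w + α * w).im ^ 2) =
      γ ^ 2 / 8 * derivNorm f ^ 2 + α ^ 2 / 2 := by
  have hz : ∀ k : ℤ, Tame (fun τ : Circle => (τ : ℂ) ^ k) := fun k =>
    Tame.of_continuous (continuous_circle_zpow k)
  have hd : Tame (circleDeriv f) := Tame.of_continuous hf.cont
  have hw : Tame (fun w : Circle => (w : ℂ)) := Tame.of_continuous continuous_circle_coe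
  have hk : ∀ k : ℤ, circleMean (fun τ : Circle => (τ : ℂ) ^ k * ((γ : ℂ) / 2 * circleDeriv f τ + α * τ)) =
      γ / 2 * circleMean (fun τ : Circle => (τ : ℂ) ^ k * circleDeriv f τ) +
        α * if k + 1 = 0 then 1 else 0 := by
    intro k
    rw [← circleMean_zpow, ← circleMean_const_mul, ← circleMean_const_mul,
      ← circleMean_add ((Tame.const _).mul ((hz k).mul hd)) ((Tame.const _).mul (hz (k + 1)))]
    congr 1
    ext τ
    rw [zpow_add_one₀ (Circle.coe_ne_zero τ)]
    ring
  have h0 : ∀ k : ℤ, k ≤ 1 → k ≠ -1 →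
      circleMean (fun τ : Circle => (τ : ℂ) ^ k * ((γ : ℂ) / 2 * circleDeriv f τ + α * τ)) = 0 := by
    intro k h1 h2
    rw [hk, hf.circleMean_zpow_mul_circleDeriv_eq_zero h1, if_neg (by omega)]
    ring
  rw [VortexPair.circleMean_im_sq (((Tame.const _).mul hd).add ((Tame.const _).mul hw)) fun k => by
    by_cases h1 : k ≤ 1 ∧ k ≠ -1
    · exact Or.inr (h0 k h1.1 h1.2)
    · exact Or.inl (h0 (-k) (by omega) (by omega))]
  have e : ∀ τ : Circle, ‖(γ : ℂ) / 2 * circleDeriv f τ + α * τ‖ ^ 2 =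
      γ ^ 2 / 4 * ‖circleDeriv f τ‖ ^ 2 + (γ * α * ((τ : ℂ) ^ (-1 : ℤ) * circleDeriv f τ).re + α ^ 2) := by
    intro τ
    have hτ : (τ : ℂ).re * (τ : ℂ).re + (τ : ℂ).im * (τ : ℂ).im = 1 := by
      rw [← Complex.normSq_apply, Circle.normSq_coe]
    have e2 : (γ : ℂ) / 2 = ((γ / 2 : ℝ) : ℂ) := by push_cast; rfl
    rw [zpow_neg_one, ← conj_circle, ← Complex.normSq_eq_norm_sq, ← Complex.normSq_eq_norm_sq, e2,
      Complex.normSq_apply, Complex.normSq_apply]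
    simp only [Complex.add_re, Complex.add_im, Complex.ofReal_re, Complex.ofReal_im, Complex.mul_im,
      Complex.mul_re, Complex.conj_re, Complex.conj_im]
    linear_combination α ^ 2 * hτ
  have hre : circleMean (fun τ : Circle => ((τ : ℂ) ^ (-1 : ℤ) * circleDeriv f τ).re) = 0 := by
    have := hf.circleMean_zpow_mul_circleDeriv_eq_zero (k := -1) (by norm_num)
    have h2 := integral_re (μ := angleMeasure) ((hz (-1)).mul hd).integrable
    have h3 : circleMean (fun τ : Circle => ((τ : ℂ) ^ (-1 : ℤ) * circleDeriv f τ).re) =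
      (circleMean (fun τ : Circle => (τ : ℂ) ^ (-1 : ℤ) * circleDeriv f τ)).re := h2
    rw [h3, this, Complex.zero_re]
  simp only [e]
  have i1 : Integrable (fun t => γ ^ 2 / 4 * ‖circleDeriv f (Circle.exp t)‖ ^ 2) angleMeasure := by
    have := (hd.mul hd).norm
    refine (this.const_mul (γ ^ 2 / 4)).congr (Eventually.of_forall fun t => ?_)
    simp only [norm_mul]
    ring
  have i2 : Integrable (fun t => γ * α * (((Circle.exp t : Circle) : ℂ) ^ (-1 : ℤ) *
      circleDeriv f (Circle.exp t)).re) angleMeasure :=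
    ((hz (-1)).mul hd).integrable.re.const_mul _
  rw [derivNorm_sq]
  have e3 : circleMean (fun τ => γ ^ 2 / 4 * ‖circleDeriv f τ‖ ^ 2 +
      (γ * α * ((τ : ℂ) ^ (-1 : ℤ) * circleDeriv f τ).re + α ^ 2)) =
      γ ^ 2 / 4 * circleMean (fun τ => ‖circleDeriv f τ‖ ^ 2) +
      (γ * α * circleMean (fun τ : Circle => ((τ : ℂ) ^ (-1 : ℤ) * circleDeriv f τ).re) + α ^ 2) := by
    simp only [circleMean]
    have i3 : Integrable (fun t => γ * α * (((Circle.exp t : Circle) : ℂ) ^ (-1 : ℤ) *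
      circleDeriv f (Circle.exp t)).re + α ^ 2) angleMeasure := i2.add (integrable_const _)
    rw [integral_add i1 i3, integral_add i2 (integrable_const _),
      integral_const_mul, integral_const_mul]
    simp
  rw [e3, hre]
  ring

/-! ### Uniform orders of vanishing -/

/-- `F ε p = O(ε^k)` as `ε → 0`, uniformly in `p`. -/
def UniformO {P : Type*} (k : ℕ) (F : ℝ → P → ℂ) : Prop :=
  ∃ C : ℝ, 0 ≤ C ∧ ∀ᶠ ε in 𝓝 (0 : ℝ), ∀ p, ‖F ε p‖ ≤ C * |ε| ^ k

namespace UniformO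

variable {P : Type*} {k l : ℕ} {F G : ℝ → P → ℂ}

theorem congr (hF : UniformO k F) (h : ∀ ε p, G ε p = F ε p) : UniformO k G := by
  have : G = F := funext fun ε => funext fun p => h ε p
  rwa [this]

theorem congr' (hF : UniformO k F) (h : ∀ᶠ ε in 𝓝 (0 : ℝ), ∀ p, G ε p = F ε p) : UniformO k G := by
  obtain ⟨C, hC0, hC⟩ := hF
  refine ⟨C, hC0, ?_⟩
  filter_upwards [hC, h] with ε h1 h2 p
  rw [h2]; exact h1 p

theorem add (hF : UniformO k F) (hG : UniformO k G) : UniformO k (fun ε p => F ε p + G ε p) := by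
  obtain ⟨C, hC0, hC⟩ := hF
  obtain ⟨C', hC0', hC'⟩ := hG
  refine ⟨C + C', by positivity, ?_⟩
  filter_upwards [hC, hC'] with ε h1 h2 p
  rw [add_mul]
  exact (norm_add_le _ _).trans (add_le_add (h1 p) (h2 p))

theorem neg (hF : UniformO k F) : UniformO k (fun ε p => -F ε p) := by
  obtain ⟨C, hC0, hC⟩ := hF
  exact ⟨C, hC0, hC.mono fun ε h p => by rw [norm_neg]; exact h p⟩

theorem sub (hF : UniformO k F) (hG : UniformO k G) : UniformO k (fun ε p => F ε p - G ε p) := by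
  simp only [sub_eq_add_neg]
  exact hF.add hG.neg

theorem star (hF : UniformO k F) : UniformO k (fun ε p => conj (F ε p)) := by
  obtain ⟨C, hC0, hC⟩ := hF
  exact ⟨C, hC0, hC.mono fun ε h p => by rw [Complex.norm_conj]; exact h p⟩

theorem mul (hF : UniformO k F) (hG : UniformO l G) : UniformO (k + l) (fun ε p => F ε p * G ε p) := by
  obtain ⟨C, hC0, hC⟩ := hF
  obtain ⟨C', hC0', hC'⟩ := hG
  refine ⟨C * C', by positivity, ?_⟩
  filter_upwards [hC, hC'] with ε h1 h2 p
  rw [norm_mul]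
  calc ‖F ε p‖ * ‖G ε p‖ ≤ (C * |ε| ^ k) * (C' * |ε| ^ l) := by
        gcongr
        · exact h1 p
        · exact h2 p
    _ = _ := by ring

theorem mono (hF : UniformO k F) (h : l ≤ k) : UniformO l F := by
  obtain ⟨C, hC0, hC⟩ := hF
  refine ⟨C, hC0, ?_⟩
  have h1 : ∀ᶠ ε : ℝ in 𝓝 0, |ε| < 1 := by
    have := (continuous_abs (G := ℝ)).tendsto 0
    rw [abs_zero] at this
    exact this.eventually (gt_mem_nhds one_pos)
  filter_upwards [hC, h1] with ε h2 h3 p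
  exact (h2 p).trans (mul_le_mul_of_nonneg_left
    (pow_le_pow_of_le_one (abs_nonneg _) h3.le h) hC0)

theorem of_bound {F : P → ℂ} (C : ℝ) (h : ∀ p, ‖F p‖ ≤ C) : UniformO 0 (fun _ p => F p) :=
  ⟨max C 0, le_max_right _ _, Eventually.of_forall fun ε p => by
    rw [pow_zero, mul_one]; exact (h p).trans (le_max_left _ _)⟩

theorem const (c : ℂ) : UniformO 0 (fun (_ : ℝ) (_ : P) => c) := of_bound ‖c‖ fun _ => le_rfl

theorem pow (hF : UniformO k F) (n : ℕ) : UniformO (n * k) (fun ε p => F ε p ^ n) := by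
  induction n with
  | zero =>
    simp only [pow_zero, zero_mul]
    exact const 1
  | succ n ih =>
    simp only [pow_succ]
    rw [Nat.succ_mul]
    exact ih.mul hF

theorem const_mul (hF : UniformO k F) (c : ℂ) : UniformO k (fun ε p => c * F ε p) := by
  have := (const (P := P) c).mul hF
  rwa [zero_add] at this

theorem bdd_mul (hG : UniformO 0 G) (hF : UniformO k F) : UniformO k (fun ε p => G ε p * F ε p) := by
  have := hG.mul hF
  rwa [zero_add] at this

theorem mul_bdd (hF : UniformO k F) (hG : UniformO 0 G) : UniformO k (fun ε p => F ε p * G ε p) :=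
  hF.mul hG

theorem comp {Q : Type*} (hF : UniformO k F) (φ : Q → P) : UniformO k (fun ε q => F ε (φ q)) := by
  obtain ⟨C, hC0, hC⟩ := hF
  exact ⟨C, hC0, hC.mono fun _ h _ => h _⟩

theorem circleMean {F : ℝ → P × Circle → ℂ} (hF : UniformO k F) :
    UniformO k (fun ε p => circleMean (fun τ => F ε (p, τ))) := by
  obtain ⟨C, hC0, hC⟩ := hF
  exact ⟨C, hC0, hC.mono fun ε h _ => norm_circleMean_le fun _ => h _⟩

theorem circleCoe {φ : P → Circle} : UniformO 0 (fun _ p => ((φ p : Circle) : ℂ)) :=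
  of_bound 1 fun _ => (Circle.norm_coe _).le

theorem circleConj {φ : P → Circle} : UniformO 0 (fun _ p => (starRingEnd ℂ) ((φ p : Circle) : ℂ)) :=
  circleCoe.star

theorem inv_one_add (hF : UniformO 1 F) : UniformO 0 (fun ε p => (1 + F ε p)⁻¹) := by
  obtain ⟨C, hC0, hC⟩ := hF
  refine ⟨2, by norm_num, ?_⟩
  have h1 : ∀ᶠ ε : ℝ in 𝓝 0, C * |ε| ^ 1 < 1 / 2 := by
    have : Continuous (fun ε : ℝ => C * |ε| ^ 1) := by fun_prop
    have h2 := this.tendsto 0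
    simp only [abs_zero, pow_one, mul_zero] at h2
    simpa using h2.eventually (gt_mem_nhds (show (0 : ℝ) < 1 / 2 by norm_num))
  filter_upwards [hC, h1] with ε h2 h3 p
  have h4 := norm_one_add_ge ((h2 p).trans h3.le)
  rw [norm_inv, pow_zero, mul_one]
  calc ‖1 + F ε p‖⁻¹ ≤ (1 / 2 : ℝ)⁻¹ := inv_anti₀ (by norm_num) h4
    _ = 2 := by norm_num

end UniformO

theorem eventually_norm_le_half {P : Type*} {F : ℝ → P → ℂ} (hF : UniformO 1 F) {c : ℝ} (hc : 0 < c) :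
    ∀ᶠ ε in 𝓝 (0 : ℝ), ∀ p, ‖F ε p‖ ≤ c := by
  obtain ⟨C, hC0, hC⟩ := hF
  have h1 : ∀ᶠ ε : ℝ in 𝓝 0, C * |ε| ^ 1 < c := by
    have : Continuous (fun ε : ℝ => C * |ε| ^ 1) := by fun_prop
    have h2 := this.tendsto 0
    simp only [abs_zero, pow_one, mul_zero] at h2
    simpa using h2.eventually (gt_mem_nhds hc)
  filter_upwards [hC, h1] with ε h2 h3 p
  exact (h2 p).trans h3.le

/-! ### The approximate profile -/

theorem hasDerivAt_conj_pow (w : Circle) (n : ℕ) :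
    HasDerivAt (fun s : ℝ => conj ((w * Circle.exp s : Circle) : ℂ) ^ n)
      (-n * conj (w : ℂ) ^ (n + 1) * (Complex.I * w)) 0 := by
  have h := hasDerivAt_circleExp w 0
  simp only [Circle.exp_zero, mul_one] at h
  have h2 : HasDerivAt (fun s : ℝ => conj ((w * Circle.exp s : Circle) : ℂ))
      (conj (Complex.I * (w : ℂ))) 0 := h.star
  refine (h2.pow n).congr_deriv ?_
  rw [Circle.exp_zero, mul_one, map_mul, Complex.conj_I]
  have hw : conj (w : ℂ) * w = 1 := by rw [conj_circle, inv_mul_cancel₀ (Circle.coe_ne_zero w)]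
  rcases n with _ | n
  · simp
  · rw [Nat.add_sub_cancel]
    linear_combination (((n + 1 : ℕ) : ℂ) * conj (w : ℂ) ^ (n + 1) * Complex.I) * hw

/-- The trigonometric polynomial with four coefficients. -/
noncomputable def quarticProfile (c : Fin 4 → ℝ) (w : Circle) : ℂ :=
  c 0 * conj (w : ℂ) + c 1 * conj (w : ℂ) ^ 2 + c 2 * conj (w : ℂ) ^ 3 + c 3 * conj (w : ℂ) ^ 4

theorem quarticProfile_deriv (c : Fin 4 → ℝ) : CircleDifferentiable (quarticProfile c) ∧
    circleDeriv (quarticProfile c) = fun w : Circle => -(c 0 * conj (w : ℂ) ^ 2 +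
      2 * c 1 * conj (w : ℂ) ^ 3 + 3 * c 2 * conj (w : ℂ) ^ 4 + 4 * c 3 * conj (w : ℂ) ^ 5) := by
  apply CircleDifferentiable.of_hasDerivAt
  intro w
  have h := ((((hasDerivAt_conj_pow w 1).const_mul (c 0 : ℂ)).add
    ((hasDerivAt_conj_pow w 2).const_mul (c 1 : ℂ))).add
    ((hasDerivAt_conj_pow w 3).const_mul (c 2 : ℂ))).add
    ((hasDerivAt_conj_pow w 4).const_mul (c 3 : ℂ))
  refine (h.congr_deriv (by push_cast; ring)).congr_of_eventuallyEq (Eventually.of_forall fun s => ?_)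
  simp only [quarticProfile, Pi.add_apply, pow_one]

theorem isProfile_quarticProfile (c : Fin 4 → ℝ) :
    IsProfile (quarticProfile c) (fun n => if h : n < 4 then c ⟨n, h⟩ else 0) := by
  obtain ⟨h1, h2⟩ := quarticProfile_deriv c
  refine ⟨h1, ?_, fun w => ?_⟩
  · rw [h2]
    have : Continuous (fun w : Circle => conj (w : ℂ)) :=
      Complex.continuous_conj.comp continuous_circle_coe
    fun_prop
  · have := hasSum_sum_of_ne_finset_zero (L := SummationFilter.unconditional ℕ) (s := Finset.range 4) (f := fun n : ℕ =>
      (((if h : n < 4 then c ⟨n, h⟩ else 0 : ℝ) : ℂ)) * conj (w : ℂ) ^ (n + 1)) (fun n hn => by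
        rw [Finset.mem_range] at hn
        simp [hn])
    convert this using 1
    simp [Finset.sum_range_succ, quarticProfile]

/-! ### The self-induced velocity of the approximate profile -/

theorem UniformO.circleMean_sub {P : Type*} {k : ℕ} {F G : ℝ → P × Circle → ℂ}
    (hF : ∀ᶠ ε in 𝓝 (0 : ℝ), ∀ p, Tame fun τ => F ε (p, τ))
    (hG : ∀ ε p, Tame fun τ => G ε (p, τ)) (h : UniformO k fun ε p => F ε p - G ε p) :
    UniformO k fun ε p => VortexPair.circleMean (fun τ => F ε (p, τ)) -
      VortexPair.circleMean (fun τ => G ε (p, τ)) := by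
  refine h.circleMean.congr' ?_
  filter_upwards [hF] with ε h1 p
  rw [VortexPair.circleMean_sub (h1 p) (hG ε p)]

theorem UniformO.of_eq_pow_mul {P : Type*} {k : ℕ} {F : ℝ → P → ℂ} {r : ℝ → ℝ} (hr : Continuous r)
    (h : ∀ ε p, F ε p = ((ε ^ k * r ε : ℝ) : ℂ)) : UniformO k F := by
  have h1 : ∀ᶠ ε in 𝓝 (0 : ℝ), |r ε| < |r 0| + 1 :=
    (hr.abs.tendsto 0).eventually (gt_mem_nhds (lt_add_one _))
  refine ⟨|r 0| + 1, by positivity, ?_⟩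
  filter_upwards [h1] with ε h2 p
  rw [h, Complex.norm_real, Real.norm_eq_abs, abs_mul, abs_pow, mul_comm]
  gcongr

theorem tame_polynomial (p : Polynomial ℂ) : Tame fun τ : Circle => p.eval (τ : ℂ) :=
  Tame.of_continuous (p.continuous.comp continuous_circle_coe)

theorem tame_polynomial_conj (p : Polynomial ℂ) : Tame fun τ : Circle => p.eval (conj (τ : ℂ)) :=
  Tame.of_continuous (p.continuous.comp (Complex.continuous_conj.comp continuous_circle_coe))

/-- Only the constant term survives. With the conjugate version below, the mean of a trigonometric
polynomial is found by writing it as a polynomial in `τ` plus one in `conj τ` and evaluating both at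
`0`. -/
theorem circleMean_polynomial (p : Polynomial ℂ) :
    circleMean (fun τ : Circle => p.eval (τ : ℂ)) = p.eval 0 := by
  induction p using Polynomial.induction_on' with
  | add p q hp hq =>
    simp only [Polynomial.eval_add]
    rw [circleMean_add (tame_polynomial p) (tame_polynomial q), hp, hq]
  | monomial n a =>
    simp only [Polynomial.eval_monomial]
    have h := circleMean_zpow n
    simp only [zpow_natCast, Nat.cast_eq_zero] at h
    rw [circleMean_const_mul, h]
    rcases n with _ | n <;> simp

theorem circleMean_polynomial_conj (p : Polynomial ℂ) :
    circleMean (fun τ : Circle => p.eval (conj (τ : ℂ))) = p.eval 0 := by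
  induction p using Polynomial.induction_on' with
  | add p q hp hq =>
    simp only [Polynomial.eval_add]
    rw [circleMean_add (tame_polynomial_conj p) (tame_polynomial_conj q), hp, hq]
  | monomial n a =>
    simp only [Polynomial.eval_monomial]
    have h := circleMean_zpow n
    simp only [zpow_natCast, Nat.cast_eq_zero] at h
    have h2 := circleMean_conj (fun τ : Circle => (τ : ℂ) ^ n)
    rw [h] at h2
    simp only [map_pow] at h2
    rw [circleMean_const_mul, h2]
    rcases n with _ | n <;> simp

/-- The difference quotient of the trigonometric polynomial, for `τ ≠ w`. -/
noncomputable def quarticQuot (c : Fin 4 → ℝ) (w τ : Circle) : ℂ :=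
  -(conj (τ : ℂ) * conj (w : ℂ) * (c 0 + c 1 * (conj (τ : ℂ) + conj (w : ℂ)) +
    (c 2 * (conj (τ : ℂ) ^ 2 + conj (τ : ℂ) * conj (w : ℂ) + conj (w : ℂ) ^ 2) +
    c 3 * (conj (τ : ℂ) ^ 3 + conj (τ : ℂ) ^ 2 * conj (w : ℂ) +
      conj (τ : ℂ) * conj (w : ℂ) ^ 2 + conj (w : ℂ) ^ 3))))

theorem diffQuot_quarticProfile (c : Fin 4 → ℝ) {τ w : Circle} (h : τ ≠ w) :
    diffQuot (quarticProfile c) τ w = quarticQuot c w τ := by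
  have h1 : (τ : ℂ) - w ≠ 0 := sub_ne_zero.2 fun h' => h (Circle.ext h')
  have hτ := Circle.coe_ne_zero τ
  have hw := Circle.coe_ne_zero w
  rw [diffQuot, div_eq_iff h1, quarticProfile, quarticProfile, quarticQuot, conj_circle, conj_circle]
  field_simp
  ring

/-- Since `c i` has order `i + 1`, the parts of the quotient and of the derivative that contain `c
2` or `c 3` have order three and are always multiplied by a factor of order one. The denominator
differs from `1` by order two and multiplies a product of order two. What is left is the mean of an
explicit trigonometric polynomial in `c 0` and `c 1`. -/
theorem uniformO_circleMean_selfKernel {η : ℝ → ℝ} {c : ℝ → Fin 4 → ℝ}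
    (hη : UniformO 1 fun ε (_ : Unit) => (η ε : ℂ))
    (hc : ∀ i : Fin 4, UniformO (i + 1) fun ε (_ : Unit) => (c ε i : ℂ)) :
    UniformO 4 fun ε w => circleMean (selfKernel (η ε) (quarticProfile (c ε)) w) +
      (c ε 0 ^ 2 + c ε 0 * c ε 1 * conj (w : ℂ)) := by
  have hw : UniformO 0 fun (_ : ℝ) (p : Circle × Circle) => conj (p.1 : ℂ) := UniformO.circleConj
  have hz : UniformO 0 fun (_ : ℝ) (p : Circle × Circle) => conj (p.2 : ℂ) := UniformO.circleConj
  have hη' : UniformO 1 fun ε (_ : Circle × Circle) => (η ε : ℂ) := hη.comp fun _ => ()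
  have hC : ∀ i : Fin 4, UniformO (i + 1) fun ε (_ : Circle × Circle) => (c ε i : ℂ) := fun i =>
    (hc i).comp fun _ => ()
  have h0 : UniformO 1 fun ε (_ : Circle × Circle) => (c ε 0 : ℂ) := hC 0
  have h1 : UniformO 2 fun ε (_ : Circle × Circle) => (c ε 1 : ℂ) := hC 1
  have h2 : UniformO 3 fun ε (_ : Circle × Circle) => (c ε 2 : ℂ) := hC 2
  have h3 : UniformO 4 fun ε (_ : Circle × Circle) => (c ε 3 : ℂ) := hC 3
  -- the quotient and the derivative split into leading part and remainder
  set r : ℝ → Circle × Circle → ℂ := fun ε p => -(conj (p.2 : ℂ) * conj (p.1 : ℂ) *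
    (c ε 2 * (conj (p.2 : ℂ) ^ 2 + conj (p.2 : ℂ) * conj (p.1 : ℂ) + conj (p.1 : ℂ) ^ 2) +
    c ε 3 * (conj (p.2 : ℂ) ^ 3 + conj (p.2 : ℂ) ^ 2 * conj (p.1 : ℂ) +
      conj (p.2 : ℂ) * conj (p.1 : ℂ) ^ 2 + conj (p.1 : ℂ) ^ 3))) with hr
  set q₀ : ℝ → Circle × Circle → ℂ := fun ε p => -(conj (p.2 : ℂ) * conj (p.1 : ℂ) *
    (c ε 0 + c ε 1 * (conj (p.2 : ℂ) + conj (p.1 : ℂ)))) with hq₀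
  set y₀ : ℝ → Circle × Circle → ℂ := fun ε p => -(c ε 0 * conj (p.2 : ℂ) ^ 2 +
      2 * c ε 1 * conj (p.2 : ℂ) ^ 3) with hy₀
  set s : ℝ → Circle × Circle → ℂ := fun ε p => -(3 * c ε 2 * conj (p.2 : ℂ) ^ 4 +
      4 * c ε 3 * conj (p.2 : ℂ) ^ 5) with hs
  have O0 : ∀ {F : ℝ → Circle × Circle → ℂ} (n : ℕ), UniformO 0 F →
      UniformO 0 (fun ε p => F ε p ^ n) := fun n hF => by simpa using hF.pow n
  have Hq₀ : UniformO 1 q₀ := ((hz.bdd_mul hw).bdd_mul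
    (h0.add ((h1.mul_bdd (hz.add hw)).mono (by norm_num)))).neg
  have Hr : UniformO 3 r := ((hz.bdd_mul hw).bdd_mul ((h2.mul_bdd (((O0 2 hz).add
    (hz.bdd_mul hw)).add (O0 2 hw))).add ((h3.mul_bdd ((((O0 3 hz).add ((O0 2 hz).bdd_mul hw)).add
    (hz.bdd_mul (O0 2 hw))).add (O0 3 hw))).mono (by norm_num)))).neg
  have Hy₀ : UniformO 1 y₀ := ((h0.mul_bdd (O0 2 hz)).add
    (((h1.const_mul 2).mul_bdd (O0 3 hz)).mono (by norm_num))).neg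
  have Hs : UniformO 3 s := (((h2.const_mul 3).mul_bdd (O0 4 hz)).add
    (((h3.const_mul 4).mul_bdd (O0 5 hz)).mono (by norm_num))).neg
  set Q : ℝ → Circle × Circle → ℂ := fun ε p => q₀ ε p + r ε p with hQ
  have hQe : ∀ ε w τ, quarticQuot (c ε) w τ = Q ε (w, τ) := fun ε w τ => by
    simp only [quarticQuot, hQ, hq₀, hr]; ring
  have hYe : ∀ ε τ (w : Circle), circleDeriv (quarticProfile (c ε)) τ = y₀ ε (w, τ) + s ε (w, τ) :=
    fun ε τ w => by
      rw [(quarticProfile_deriv (c ε)).2]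
      simp only [hy₀, hs]; ring
  have HQ : UniformO 1 Q := Hq₀.add (Hr.mono (by norm_num))
  have HηQ : UniformO 2 fun ε p => (η ε : ℂ) * Q ε p := hη'.mul HQ
  set K : ℝ → Circle × Circle → ℂ := fun ε p =>
    (conj (Q ε p) - Q ε p) * (y₀ ε p + s ε p - Q ε p) * (1 + η ε * Q ε p)⁻¹ with hK
  set G : ℝ → Circle × Circle → ℂ := fun ε p => (conj (q₀ ε p) - q₀ ε p) * (y₀ ε p - q₀ ε p) with hG
  have HKG : UniformO 4 fun ε p => K ε p - G ε p := by
    have A : UniformO 4 fun ε p => (conj (r ε p) - r ε p) * (y₀ ε p + s ε p - Q ε p) +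
        (conj (q₀ ε p) - q₀ ε p) * (s ε p - r ε p) :=
      ((Hr.star.sub Hr).mul ((Hy₀.add (Hs.mono (by norm_num))).sub HQ)).add
        ((Hq₀.star.sub Hq₀).mul (Hs.sub Hr))
    have B : UniformO 4 fun ε p => (conj (Q ε p) - Q ε p) * (y₀ ε p + s ε p - Q ε p) *
        ((η ε * Q ε p) * (1 + η ε * Q ε p)⁻¹) :=
      ((HQ.star.sub HQ).mul ((Hy₀.add (Hs.mono (by norm_num))).sub HQ)).mul
        (HηQ.mul (HηQ.mono (by norm_num) : UniformO 1 _).inv_one_add)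
    refine (A.sub B).congr' ?_
    filter_upwards [eventually_norm_le_half (HηQ.mono (by norm_num)) (c := 1 / 2) (by norm_num)]
      with ε hε p
    have hne : 1 + (η ε : ℂ) * Q ε p ≠ 0 := fun h0 => by
      have := norm_one_add_ge (hε p)
      rw [h0, norm_zero] at this
      norm_num at this
    have e1 : (η ε * Q ε p) * (1 + η ε * Q ε p)⁻¹ = 1 - (1 + η ε * Q ε p)⁻¹ := by
      field_simp
      ring
    rw [e1]
    simp only [hK, hG, hQ, map_add]
    ring
  have hcont : ∀ (F : ℝ → Circle × Circle → ℂ) ε, Continuous (F ε) → ∀ w, Tame fun τ => F ε (w, τ) :=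
    fun F ε h w => Tame.of_continuous (h.comp (by fun_prop))
  have c1 : Continuous fun p : Circle × Circle => (p.1 : ℂ) := continuous_circle_coe.comp continuous_fst
  have c2 : Continuous fun p : Circle × Circle => (p.2 : ℂ) := continuous_circle_coe.comp continuous_snd
  have cq₀ : ∀ ε, Continuous (q₀ ε) := fun ε => by simp only [hq₀]; fun_prop
  have cr : ∀ ε, Continuous (r ε) := fun ε => by simp only [hr]; fun_prop
  have cy₀ : ∀ ε, Continuous (y₀ ε) := fun ε => by simp only [hy₀]; fun_prop
  have cs : ∀ ε, Continuous (s ε) := fun ε => by simp only [hs]; fun_prop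
  have cQ : ∀ ε, Continuous (Q ε) := fun ε => (cq₀ ε).add (cr ε)
  have := UniformO.circleMean_sub (F := K) (G := G) ?_ (fun ε => hcont G ε (by
    simp only [hG]; exact ((Complex.continuous_conj.comp (cq₀ ε)).sub (cq₀ ε)).mul
      ((cy₀ ε).sub (cq₀ ε)))) HKG
  -- The mean of the leading product also contains `-2 * c₁ ^ 2`, which is already of order four.
  · have hm : UniformO 4 fun ε (_ : Circle) => 2 * (c ε 1 : ℂ) ^ 2 :=
      ((((hc 1).comp fun _ => ()).pow 2).const_mul 2)
    refine (this.sub hm).congr fun ε w => ?_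
    have hG0 : circleMean (fun τ => G ε (w, τ)) =
        -(c ε 0 ^ 2 + c ε 0 * c ε 1 * conj (w : ℂ) + 2 * c ε 1 ^ 2) := by
      -- The product is separated into nonnegative powers of `τ` and of `conj τ`, so that the mean
      -- is a sum of two constant terms.
      open Polynomial in
      have e1 : ∀ τ : Circle, G ε (w, τ) =
          (Polynomial.C ((-(c ε 0 ^ 2 + c ε 0 * c ε 1 * conj (w : ℂ) + 2 * c ε 1 ^ 2) : ℂ)) +
            X * Polynomial.C (-(c ε 1 * w * (c ε 0 * conj (w : ℂ) + c ε 1 * conj (w : ℂ) ^ 2)) : ℂ)).eval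
              (τ : ℂ) +
          (X * (Polynomial.C ((-(c ε 0 * w + c ε 1 * (w : ℂ) ^ 2) * (c ε 1 * conj (w : ℂ) - c ε 0) +
                c ε 1 * w * (2 * c ε 1) : ℂ)) +
              X * (Polynomial.C ((c ε 0 * w + c ε 1 * (w : ℂ) ^ 2) * (2 * c ε 1) + 
                (c ε 0 * conj (w : ℂ) + c ε 1 * conj (w : ℂ) ^ 2) ^ 2 : ℂ) + 
               X * (Polynomial.C ((c ε 0 * conj (w : ℂ) + c ε 1 * conj (w : ℂ) ^ 2) *
                  (2 * c ε 1 * conj (w : ℂ) - c ε 0) : ℂ) +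
               X * (Polynomial.C (-(2 * c ε 1) * (c ε 0 * conj (w : ℂ) + c ε 1 * conj (w : ℂ) ^ 2) +
                  c ε 1 * conj (w : ℂ) * (c ε 1 * conj (w : ℂ) - c ε 0) : ℂ) +
               X * Polynomial.C (-(2 * c ε 1) * (c ε 1 * conj (w : ℂ)) : ℂ)))))).eval
            (conj (τ : ℂ)) := fun τ => by
        have hw1 := Circle.coe_ne_zero w
        have hτ1 := Circle.coe_ne_zero τ
        simp only [eval_add, eval_mul, eval_X, eval_C]
        simp only [hG, hq₀, hy₀, map_neg, map_mul, map_add, Complex.conj_conj, Complex.conj_ofReal]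
        rw [conj_circle, conj_circle]
        field_simp
        ring
      simp only [e1]
      rw [VortexPair.circleMean_add (tame_polynomial _) (tame_polynomial_conj _),
        circleMean_polynomial, circleMean_polynomial_conj]
      simp
    have hK0 : circleMean (selfKernel (η ε) (quarticProfile (c ε)) w) =
        circleMean (fun τ => K ε (w, τ)) := by
      refine circleMean_congr (w := w) fun τ hτ => ?_
      rw [selfKernel, diffQuot_quarticProfile _ hτ, hQe, hYe ε τ w, div_eq_mul_inv]
    rw [hG0, hK0]
    ring
  · filter_upwards [eventually_norm_le_half (HηQ.mono (by norm_num)) (c := 1 / 2) (by norm_num)]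
      with ε hε w
    have t := Tame.inv (F := fun τ => 1 + (η ε : ℂ) * Q ε (w, τ)) (hcont (fun ε p =>
      1 + (η ε : ℂ) * Q ε p) ε (continuous_const.add (continuous_const.mul (cQ ε))) w) (c := 1 / 2)
      (by norm_num) fun τ => norm_one_add_ge (hε (w, τ))
    exact (hcont (fun ε p => (conj (Q ε p) - Q ε p) * (y₀ ε p + s ε p - Q ε p)) ε
      (((Complex.continuous_conj.comp (cQ ε)).sub (cQ ε)).mul
        (((cy₀ ε).add (cs ε)).sub (cQ ε))) w).mul t

/-! ### The velocity induced by the other approximate patch -/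

-- The reciprocal is expanded as a geometric series in `Y = u + η τ + η E`, where `E` is the profile
-- of the other patch. The unperturbed part is a polynomial in `τ` whose constant term gives the
-- powers of `u`. The deformation contributes to the mean only where powers of `τ` and of `conj τ`
-- meet, and below order five this leaves two constants.
set_option maxHeartbeats 1000000 in
theorem uniformO_circleMean_crossKernel {η : ℝ → ℝ} {c : ℝ → Fin 4 → ℝ} {u : ℝ → Circle → ℂ} {d : ℝ}
    (hd : 0 < d) (hη : UniformO 1 fun ε (_ : Unit) => (η ε : ℂ))
    (hc : ∀ i : Fin 4, UniformO (i + 1) fun ε (_ : Unit) => (c ε i : ℂ)) (hu : UniformO 1 u) :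
    UniformO 5 fun ε w => circleMean (crossKernel (η ε) (quarticProfile (c ε)) (d - u ε w)) -
      (1 / d + u ε w / d ^ 2 + u ε w ^ 2 / d ^ 3 + u ε w ^ 3 / d ^ 4 + u ε w ^ 4 / d ^ 5 +
        ((η ε : ℂ) ^ 2 * (η ε * c ε 0) / d ^ 3 - (η ε * c ε 0) ^ 2 / d)) := by
  have hdC : (d : ℂ) ≠ 0 := by exact_mod_cast hd.ne'
  -- An opaque name for the inverse of `d` makes all the expansions polynomial identities.
  obtain ⟨D, hD⟩ : ∃ D : ℂ, D = (d : ℂ)⁻¹ := ⟨_, rfl⟩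
  have hdD : (d : ℂ) * D = 1 := by rw [hD, mul_inv_cancel₀ hdC]
  have hτz : ∀ τ : Circle, (τ : ℂ) * conj (τ : ℂ) = 1 := fun τ => by
    rw [Complex.mul_conj, Circle.normSq_coe, Complex.ofReal_one]
  suffices H : UniformO 5 fun ε w =>
      circleMean (crossKernel (η ε) (quarticProfile (c ε)) (d - u ε w)) -
      (D + u ε w * D ^ 2 + u ε w ^ 2 * D ^ 3 + u ε w ^ 3 * D ^ 4 + u ε w ^ 4 * D ^ 5 +
        ((η ε : ℂ) ^ 2 * (η ε * c ε 0) * D ^ 3 - (η ε * c ε 0) ^ 2 * D)) by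
    refine H.congr fun ε w => ?_
    simp only [hD, div_eq_mul_inv, inv_pow, one_mul]
  have hw : UniformO 0 fun (_ : ℝ) (p : Circle × Circle) => (p.2 : ℂ) := UniformO.circleCoe
  have hz : UniformO 0 fun (_ : ℝ) (p : Circle × Circle) => conj (p.2 : ℂ) := UniformO.circleConj
  have hη' : UniformO 1 fun ε (_ : Circle × Circle) => (η ε : ℂ) := hη.comp fun _ => ()
  have hC : ∀ i : Fin 4, UniformO (1 + (i + 1)) fun ε (_ : Circle × Circle) => (η ε * c ε i : ℂ) :=
    fun i => (hη.mul (hc i)).comp fun _ => ()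
  have hU : UniformO 1 fun ε (p : Circle × Circle) => u ε p.1 := hu.comp fun p : Circle × Circle => p.1
  set e0 : ℝ → ℂ := fun ε => η ε * c ε 0 with he0
  set e1 : ℝ → ℂ := fun ε => η ε * c ε 1 with he1
  set e2 : ℝ → ℂ := fun ε => η ε * c ε 2 with he2
  set e3 : ℝ → ℂ := fun ε => η ε * c ε 3 with he3
  have h0 : UniformO 2 fun ε (_ : Circle × Circle) => e0 ε := hC 0
  have h1 : UniformO 3 fun ε (_ : Circle × Circle) => e1 ε := hC 1
  have h2 : UniformO 4 fun ε (_ : Circle × Circle) => e2 ε := hC 2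
  have h3 : UniformO 5 fun ε (_ : Circle × Circle) => e3 ε := hC 3
  have O0 : ∀ {F : ℝ → Circle × Circle → ℂ} (n : ℕ), UniformO 0 F →
      UniformO 0 (fun ε p => F ε p ^ n) := fun n hF => by simpa using hF.pow n
  set A : ℝ → Circle × Circle → ℂ := fun ε p => e0 ε * (p.2 : ℂ) ^ 2 + e1 ε * (p.2 : ℂ) ^ 3 +
    e2 ε * (p.2 : ℂ) ^ 4 + e3 ε * (p.2 : ℂ) ^ 5 with hA
  set B : ℝ → Circle × Circle → ℂ := fun ε p => e0 ε * conj (p.2 : ℂ) ^ 2 +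
    2 * e1 ε * conj (p.2 : ℂ) ^ 3 + 3 * e2 ε * conj (p.2 : ℂ) ^ 4 + 4 * e3 ε * conj (p.2 : ℂ) ^ 5 with hB
  set E : ℝ → Circle × Circle → ℂ := fun ε p => e0 ε * conj (p.2 : ℂ) + e1 ε * conj (p.2 : ℂ) ^ 2 +
    e2 ε * conj (p.2 : ℂ) ^ 3 + e3 ε * conj (p.2 : ℂ) ^ 4 with hE
  set s : ℝ → Circle × Circle → ℂ := fun ε p => u ε p.1 + η ε * (p.2 : ℂ) with hs
  set Y : ℝ → Circle × Circle → ℂ := fun ε p => s ε p + η ε * E ε p with hY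
  -- orders
  have HA1 : UniformO 3 fun ε (p : Circle × Circle) => e1 ε * (p.2 : ℂ) ^ 3 +
      e2 ε * (p.2 : ℂ) ^ 4 + e3 ε * (p.2 : ℂ) ^ 5 :=
    ((h1.mul_bdd (O0 3 hw)).add ((h2.mul_bdd (O0 4 hw)).mono (by norm_num))).add
      ((h3.mul_bdd (O0 5 hw)).mono (by norm_num))
  have HA0 : UniformO 2 fun ε (p : Circle × Circle) => e0 ε * (p.2 : ℂ) ^ 2 := h0.mul_bdd (O0 2 hw)
  have HA : UniformO 2 A := (HA0.add (HA1.mono (by norm_num))).congr fun ε p => by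
    simp only [hA]; ring
  have HB3 : UniformO 5 fun ε (p : Circle × Circle) => 4 * e3 ε * conj (p.2 : ℂ) ^ 5 :=
    (h3.const_mul 4).mul_bdd (O0 5 hz)
  have HB2 : UniformO 4 fun ε (p : Circle × Circle) => 3 * e2 ε * conj (p.2 : ℂ) ^ 4 :=
    (h2.const_mul 3).mul_bdd (O0 4 hz)
  have HB1 : UniformO 3 fun ε (p : Circle × Circle) => 2 * e1 ε * conj (p.2 : ℂ) ^ 3 :=
    (h1.const_mul 2).mul_bdd (O0 3 hz)
  have HB0 : UniformO 2 fun ε (p : Circle × Circle) => e0 ε * conj (p.2 : ℂ) ^ 2 := h0.mul_bdd (O0 2 hz)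
  have HB : UniformO 2 B := ((HB0.add (HB1.mono (by norm_num))).add (HB2.mono (by norm_num))).add
    (HB3.mono (by norm_num))
  have HE2 : UniformO 4 fun ε (p : Circle × Circle) => e2 ε * conj (p.2 : ℂ) ^ 3 +
      e3 ε * conj (p.2 : ℂ) ^ 4 :=
    (h2.mul_bdd (O0 3 hz)).add ((h3.mul_bdd (O0 4 hz)).mono (by norm_num))
  have HE1 : UniformO 3 fun ε (p : Circle × Circle) => e1 ε * conj (p.2 : ℂ) ^ 2 +
      (e2 ε * conj (p.2 : ℂ) ^ 3 + e3 ε * conj (p.2 : ℂ) ^ 4) :=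
    (h1.mul_bdd (O0 2 hz)).add (HE2.mono (by norm_num))
  have HE : UniformO 2 E := ((h0.mul_bdd hz).add (HE1.mono (by norm_num))).congr fun ε p => by
    simp only [hE]; ring
  have Hs : UniformO 1 s := hU.add (hη'.mul_bdd hw)
  have HηE : UniformO 3 fun ε p => (η ε : ℂ) * E ε p := hη'.mul HE
  have HY : UniformO 1 Y := Hs.add (HηE.mono (by norm_num))
  clear_value A B E s Y e0 e1 e2 e3
  -- `S₀` and `S` are the geometric series for `(d - s)⁻¹` and `(d - Y)⁻¹`, truncated after the
  -- fourth power.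
  set S₀ : ℝ → Circle × Circle → ℂ := fun ε p =>
    D + s ε p * D ^ 2 + s ε p ^ 2 * D ^ 3 + s ε p ^ 3 * D ^ 4 + s ε p ^ 4 * D ^ 5 with hS₀
  set S : ℝ → Circle × Circle → ℂ := fun ε p =>
    D + Y ε p * D ^ 2 + Y ε p ^ 2 * D ^ 3 + Y ε p ^ 3 * D ^ 4 + Y ε p ^ 4 * D ^ 5 with hS
  have cst : ∀ z : ℂ, UniformO 0 fun (_ : ℝ) (_ : Circle × Circle) => z := fun z => UniformO.const z
  have HS₂ : UniformO 3 fun ε p => s ε p ^ 3 * D ^ 4 + s ε p ^ 4 * D ^ 5 :=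
    ((Hs.pow 3).mul_bdd (cst _)).add (((Hs.pow 4).mul_bdd (cst _)).mono (by norm_num))
  have HS₁ : UniformO 2 fun ε p => s ε p ^ 2 * D ^ 3 +
      (s ε p ^ 3 * D ^ 4 + s ε p ^ 4 * D ^ 5) :=
    ((Hs.pow 2).mul_bdd (cst _)).add (HS₂.mono (by norm_num))
  have HS₁' : UniformO 1 fun ε p => s ε p * D ^ 2 + (s ε p ^ 2 * D ^ 3 +
      (s ε p ^ 3 * D ^ 4 + s ε p ^ 4 * D ^ 5)) :=
    (Hs.mul_bdd (cst _)).add (HS₁.mono (by norm_num))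
  have HSd : UniformO 1 fun ε p => Y ε p * D ^ 2 + Y ε p ^ 2 * D ^ 3 +
      Y ε p ^ 3 * D ^ 4 + Y ε p ^ 4 * D ^ 5 :=
    (((HY.mul_bdd (cst _)).add (((HY.pow 2).mul_bdd (cst _)).mono (by norm_num))).add
      (((HY.pow 3).mul_bdd (cst _)).mono (by norm_num))).add
      (((HY.pow 4).mul_bdd (cst _)).mono (by norm_num))
  have HS : UniformO 0 S := ((cst D).add (HSd.mono (by norm_num))).congr fun ε p => by
    simp only [hS]; ring
  clear_value S S₀
  have HT : UniformO 5 fun ε p => (η ε : ℂ) * E ε p * ((s ε p ^ 2 * 3 + s ε p * 3 * (η ε * E ε p) +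
      (η ε * E ε p) ^ 2) * D ^ 4 + (s ε p ^ 3 * 4 + s ε p ^ 2 * 6 * (η ε * E ε p) +
      s ε p * 4 * (η ε * E ε p) ^ 2 + (η ε * E ε p) ^ 3) * D ^ 5) := by
    refine UniformO.mul (l := 2) HηE (UniformO.add ?_ ?_)
    · exact ((((Hs.pow 2).mul_bdd (cst 3)).add (((Hs.mul_bdd (cst 3)).mul HηE).mono (by norm_num))).add
        ((HηE.pow 2).mono (by norm_num))).mul_bdd (cst _)
    · exact ((((((Hs.pow 3).mul_bdd (cst 4)).mono (by norm_num) : UniformO 2 _).add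
        (((((Hs.pow 2).mul_bdd (cst 6)).mul HηE)).mono (by norm_num))).add
        ((((Hs.mul_bdd (cst 4)).mul (HηE.pow 2))).mono (by norm_num))).add
        ((HηE.pow 3).mono (by norm_num))).mul_bdd (cst _)
  -- The part of `S - S₀` of order below five; it is linear in the deformation.
  set T₁ : ℝ → Circle × Circle → ℂ := fun ε p =>
    (η ε * e0 ε * conj (p.2 : ℂ) + η ε * e1 ε * conj (p.2 : ℂ) ^ 2) * D ^ 2 +
      2 * s ε p * (η ε * e0 ε * conj (p.2 : ℂ)) * D ^ 3 with hT₁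
  have HST : UniformO 5 fun ε p => S ε p - S₀ ε p - T₁ ε p := by
    have a1 : UniformO 5 fun ε (p : Circle × Circle) => (η ε : ℂ) * (e2 ε * conj (p.2 : ℂ) ^ 3 +
      e3 ε * conj (p.2 : ℂ) ^ 4) * D ^ 2 := (hη'.mul HE2).mul_bdd (cst _)
    have a2 : UniformO 5 fun ε (p : Circle × Circle) => s ε p * ((η ε : ℂ) * (e1 ε * conj (p.2 : ℂ) ^ 2 +
      (e2 ε * conj (p.2 : ℂ) ^ 3 + e3 ε * conj (p.2 : ℂ) ^ 4))) * (2 * D ^ 3) :=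
      (Hs.mul (hη'.mul HE1)).mul_bdd (cst _)
    have a3 : UniformO 5 fun ε (p : Circle × Circle) => ((η ε : ℂ) * E ε p) ^ 2 * D ^ 3 :=
      ((HηE.pow 2).mul_bdd (cst _)).mono (by norm_num)
    refine (((a1.add a2).add a3).add HT).congr fun ε p => ?_
    simp only [hS, hS₀, hT₁, hY, hE]
    ring
  have HT₁ : UniformO 3 T₁ := by
    refine UniformO.add (((hη'.mul h0).mul_bdd hz).add (((hη'.mul h1).mul_bdd
      (O0 2 hz)).mono (by norm_num)) |>.mul_bdd (cst _)) ?_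
    exact ((((Hs.const_mul 2).mul ((hη'.mul h0).mul_bdd hz))).mul_bdd (cst _)).mono (by norm_num)
  clear_value T₁
  have HSS₀ : UniformO 3 fun ε p => S ε p - S₀ ε p :=
    ((HST.mono (by norm_num)).add HT₁).congr fun ε p => by ring
  -- The part of `B * S` of order below five.
  set T₃ : ℝ → Circle × Circle → ℂ := fun ε p =>
    e0 ε * conj (p.2 : ℂ) ^ 2 * (D + s ε p * D ^ 2 + s ε p ^ 2 * D ^ 3) +
    2 * e1 ε * conj (p.2 : ℂ) ^ 3 * (D + s ε p * D ^ 2) + 3 * e2 ε * conj (p.2 : ℂ) ^ 4 * D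
    with hT₃
  clear_value T₃
  have HBT : UniformO 5 fun ε p => B ε p * S ε p - T₃ ε p := by
    have HS₀ : UniformO 0 S₀ := ((cst D).add (HS₁'.mono (by norm_num))).congr fun ε p => by
      simp only [hS₀]; ring
    refine ((((HB.mul HSS₀).add (HB0.mul HS₂)).add (HB1.mul HS₁)).add
      ((HB2.mul HS₁').add (HB3.mul_bdd HS₀))).congr fun ε p => ?_
    simp only [hT₃, hB, hS₀]
    ring
  -- In `A * B` only the product of the two leading terms has order below five, and there the powers
  -- of `τ` and `conj τ` cancel.
  have HABT : UniformO 5 fun ε p => A ε p * B ε p * S ε p - e0 ε ^ 2 * D := by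
    have a1 : UniformO 5 fun ε (p : Circle × Circle) => (e1 ε * (p.2 : ℂ) ^ 3 + e2 ε * (p.2 : ℂ) ^ 4 + e3 ε * (p.2 : ℂ) ^ 5) *
      B ε p * S ε p := (HA1.mul HB).mul_bdd HS
    have a2 : UniformO 5 fun ε (p : Circle × Circle) => (e0 ε * (p.2 : ℂ) ^ 2) * (2 * e1 ε * conj (p.2 : ℂ) ^ 3 +
        3 * e2 ε * conj (p.2 : ℂ) ^ 4 + 4 * e3 ε * conj (p.2 : ℂ) ^ 5) * S ε p :=
      (HA0.mul ((HB1.add (HB2.mono (by norm_num))).add (HB3.mono (by norm_num)))).mul_bdd HS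
    have a3 := (h0.pow 2).mul HSd
    refine ((a1.add a2).add a3).congr fun ε p => ?_
    have hp : (p.2 : ℂ) ^ 2 * conj (p.2 : ℂ) ^ 2 = 1 := by
      rw [← mul_pow, hτz, one_pow]
    have hS' : S ε p = D + (Y ε p * D ^ 2 + Y ε p ^ 2 * D ^ 3 +
      Y ε p ^ 3 * D ^ 4 + Y ε p ^ 4 * D ^ 5) := by simp only [hS]; ring
    have hAB : A ε p * B ε p = (e1 ε * (p.2 : ℂ) ^ 3 + e2 ε * (p.2 : ℂ) ^ 4 + e3 ε * (p.2 : ℂ) ^ 5) *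
      B ε p + (e0 ε * (p.2 : ℂ) ^ 2) * (2 * e1 ε * conj (p.2 : ℂ) ^ 3 +
        3 * e2 ε * conj (p.2 : ℂ) ^ 4 + 4 * e3 ε * conj (p.2 : ℂ) ^ 5) + e0 ε ^ 2 := by
      simp only [hA, hB]
      linear_combination (e0 ε ^ 2) * hp
    rw [hAB]
    linear_combination (e0 ε ^ 2) * hS'
  set K : ℝ → Circle × Circle → ℂ := fun ε p => (1 + A ε p) * (1 - B ε p) * (d - Y ε p)⁻¹ with hK
  set G : ℝ → Circle × Circle → ℂ := fun ε p =>
    (1 + A ε p) * S₀ ε p + (T₁ ε p - T₃ ε p - e0 ε ^ 2 * D) with hG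
  have hYd : ∀ᶠ ε in 𝓝 (0 : ℝ), ∀ p, d / 2 ≤ ‖(d : ℂ) - Y ε p‖ := by
    filter_upwards [eventually_norm_le_half HY (half_pos hd)] with ε hε p
    have h1 := norm_sub_norm_le (d : ℂ) (Y ε p)
    rw [Complex.norm_real, Real.norm_eq_abs, abs_of_pos hd] at h1
    linarith [hε p]
  have Hinv : UniformO 0 fun ε p => ((d : ℂ) - Y ε p)⁻¹ := by
    refine ⟨2 / d, by positivity, hYd.mono fun ε h p => ?_⟩
    rw [norm_inv, pow_zero, mul_one]
    calc ‖(d : ℂ) - Y ε p‖⁻¹ ≤ (d / 2)⁻¹ := inv_anti₀ (half_pos hd) (h p)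
      _ = 2 / d := by rw [inv_div]
  have HKG : UniformO 5 fun ε p => K ε p - G ε p := by
    have a1 : UniformO 5 fun ε (p : Circle × Circle) => (1 + A ε p) * (1 - B ε p) * (Y ε p ^ 5 * (D ^ 5 *
        (d - Y ε p)⁻¹)) :=
      (((cst 1).add (HA.mono (by norm_num))).mul ((cst 1).sub (HB.mono (by norm_num)))).mul
        ((HY.pow 5).mul ((cst _).mul Hinv))
    refine ((((a1.add HST).add (HA.mul HSS₀)).sub HBT).sub HABT).congr' ?_
    filter_upwards [hYd] with ε hε p
    have hne : (d : ℂ) - Y ε p ≠ 0 := fun h0 => by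
      have := hε p
      rw [h0, norm_zero] at this
      linarith
    have e : ((d : ℂ) - Y ε p)⁻¹ = S ε p + Y ε p ^ 5 * (D ^ 5 * (d - Y ε p)⁻¹) := by
      have e1 : S ε p * (d - Y ε p) = 1 - Y ε p ^ 5 * D ^ 5 := by
        simp only [hS]
        linear_combination (1 + Y ε p * D + Y ε p ^ 2 * D ^ 2 + Y ε p ^ 3 * D ^ 3 +
          Y ε p ^ 4 * D ^ 4) * hdD
      rw [← mul_assoc, ← sub_eq_iff_eq_add, ← one_sub_mul, ← e1, mul_assoc, mul_inv_cancel₀ hne,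
        mul_one]
    simp only [hK, hG]
    linear_combination ((1 + A ε p) * (1 - B ε p)) * e
  clear_value K G
  have c2 : Continuous fun τ : Circle => (τ : ℂ) := continuous_circle_coe
  have cA : ∀ ε w, Continuous fun τ => A ε (w, τ) := fun ε w => by simp only [hA]; fun_prop
  have cB : ∀ ε w, Continuous fun τ => B ε (w, τ) := fun ε w => by simp only [hB]; fun_prop
  have cY : ∀ ε w, Continuous fun τ => Y ε (w, τ) := fun ε w => by simp only [hY, hs, hE]; fun_prop
  have := UniformO.circleMean_sub (F := K) (G := G) ?_ (fun ε w => Tame.of_continuous (by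
    simp only [hG, hA, hS₀, hT₁, hT₃, hs]; fun_prop)) HKG
  · refine this.congr fun ε w => ?_
    have hKe : ∀ τ, crossKernel (η ε) (quarticProfile (c ε)) (d - u ε w) τ = K ε (w, τ) := fun τ => by
      have hτ1 := Circle.coe_ne_zero τ
      simp only [crossKernel, (quarticProfile_deriv (c ε)).2, quarticProfile, hK]
      rw [div_eq_mul_inv]
      congr 1
      · simp only [hA, hB, he0, he1, he2, he3, map_add, map_mul, map_pow, Complex.conj_conj,
          Complex.conj_ofReal]
        linear_combination (1 - η ε * (c ε 0 * conj (τ : ℂ) ^ 2 + 2 * c ε 1 * conj (τ : ℂ) ^ 3 +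
          3 * c ε 2 * conj (τ : ℂ) ^ 4 + 4 * c ε 3 * conj (τ : ℂ) ^ 5)) * hτz τ
      · congr 1
        simp only [hY, hs, hE, he0, he1, he2, he3]
        ring
    have hK0 : circleMean (crossKernel (η ε) (quarticProfile (c ε)) (d - u ε w)) =
        circleMean (fun τ => K ε (w, τ)) := by
      congr 1; ext τ; exact hKe τ
    have hG0 : circleMean (fun τ => G ε (w, τ)) =
        D + u ε w * D ^ 2 + u ε w ^ 2 * D ^ 3 + u ε w ^ 3 * D ^ 4 + u ε w ^ 4 * D ^ 5 +
        ((η ε : ℂ) ^ 2 * e0 ε * D ^ 3 - e0 ε ^ 2 * D) := by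
      -- By `τ * conj τ = 1`, everything outside `(1 + A) * S₀` becomes a polynomial in `conj τ`;
      -- its constant term is the correction of order four.
      open Polynomial in
      have e1 : ∀ τ : Circle, G ε (w, τ) =
          ((1 + (Polynomial.C (e0 ε) * X ^ 2 + Polynomial.C (e1 ε) * X ^ 3 +
              Polynomial.C (e2 ε) * X ^ 4 + Polynomial.C (e3 ε) * X ^ 5)) *
            (Polynomial.C D +
              (Polynomial.C (u ε w) + Polynomial.C (η ε : ℂ) * X) * Polynomial.C (D ^ 2) +
              (Polynomial.C (u ε w) + Polynomial.C (η ε : ℂ) * X) ^ 2 * Polynomial.C (D ^ 3) +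
              (Polynomial.C (u ε w) + Polynomial.C (η ε : ℂ) * X) ^ 3 * Polynomial.C (D ^ 4) +
              (Polynomial.C (u ε w) + Polynomial.C (η ε : ℂ) * X) ^ 4 *
                Polynomial.C (D ^ 5))).eval (τ : ℂ) +
          (Polynomial.C ((η ε : ℂ) ^ 2 * e0 ε * D ^ 3 - e0 ε ^ 2 * D) +
            X * Polynomial.C ((η ε * e0 ε : ℂ) * D ^ 2 + 2 * u ε w * η ε * e0 ε * D ^ 3 -
              e0 ε * (η ε * D ^ 2 + 2 * u ε w * η ε * D ^ 3)) +
            X ^ 2 * Polynomial.C (η ε * e1 ε * D ^ 2 - e0 ε * (D + u ε w * D ^ 2 + u ε w ^ 2 * D ^ 3) -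
              2 * e1 ε * η ε * D ^ 2) -
            X ^ 3 * Polynomial.C (2 * e1 ε * (D + u ε w * D ^ 2)) -
            X ^ 4 * Polynomial.C (3 * e2 ε * D)).eval (conj (τ : ℂ)) := fun τ => by
        simp only [eval_add, eval_mul, eval_X, eval_C, eval_pow, eval_sub, eval_one]
        simp only [hG, hA, hS₀, hT₁, hT₃, hs]
        congr 1
        have h := hτz τ
        generalize conj (τ : ℂ) = z at h ⊢
        generalize (τ : ℂ) = t at h ⊢
        generalize (η ε : ℂ) = y
        generalize u ε w = v
        linear_combination (2 * y ^ 2 * e0 ε * D ^ 3 - e0 ε * y * D ^ 2 * z -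
          2 * e0 ε * v * y * D ^ 3 * z - e0 ε * D ^ 3 * y ^ 2 * (t * z + 1) -
          2 * e1 ε * D ^ 2 * y * z ^ 2) * h
      simp only [e1]
      rw [VortexPair.circleMean_add (tame_polynomial _) (tame_polynomial_conj _),
        circleMean_polynomial, circleMean_polynomial_conj]
      simp
    rw [hG0, hK0, he0]
  · filter_upwards [hYd] with ε hε w
    simp only [hK]
    exact (Tame.of_continuous ((continuous_const.add (cA ε w)).mul (continuous_const.sub (cB ε w)))).mul
      (Tame.inv (Tame.of_continuous (continuous_const.sub (cY ε w))) (half_pos hd) fun τ => hε (w, τ))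

/-! ### The residual of the approximate solution -/

/-- The coefficients of the approximate profile. -/
noncomputable def approxCoeff (D d x : ℝ) : Fin 4 → ℝ :=
  ![(D * x + 2 * D * (1 + D) * x ^ 3) / d, (D / 2 * x ^ 2 + 3 / 4 * D * (1 + D) * x ^ 4) / d,
    D * x ^ 3 / (3 * d), D * x ^ 4 / (4 * d)]

/-- The correction of order four of the angular speed at the centre of a patch. -/
noncomputable def approxCorrection (D D' x x' : ℝ) : ℝ := D * x ^ 4 + x' ^ 4 * (D' - D' ^ 2)

theorem uniformO_approxCoeff (D b d : ℝ) (i : Fin 4) :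
    UniformO (i + 1) fun ε (_ : Unit) => (approxCoeff D d (ε * b / d) i : ℂ) := by
  fin_cases i
  · refine UniformO.of_eq_pow_mul (r := fun ε => (D * (b / d) + 2 * D * (1 + D) * (b / d) ^ 3 * ε ^ 2) / d)
      (by fun_prop) fun ε _ => ?_
    simp only [approxCoeff]
    congr 1
    simp
    ring
  · refine UniformO.of_eq_pow_mul (r := fun ε => (D / 2 * (b / d) ^ 2 +
      3 / 4 * D * (1 + D) * (b / d) ^ 4 * ε ^ 2) / d) (by fun_prop) fun ε _ => ?_
    simp only [approxCoeff]
    congr 1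
    simp
    ring
  · refine UniformO.of_eq_pow_mul (r := fun ε => D * (b / d) ^ 3 / (3 * d)) (by fun_prop) fun ε _ => ?_
    simp only [approxCoeff]
    congr 1
    simp
    ring
  · refine UniformO.of_eq_pow_mul (r := fun ε => D * (b / d) ^ 4 / (4 * d)) (by fun_prop) fun ε _ => ?_
    simp only [approxCoeff]
    congr 1
    simp
    ring

theorem uniformO_real_mul {P : Type*} (b : ℝ) : UniformO 1 fun (ε : ℝ) (_ : P) => ((ε * b : ℝ) : ℂ) :=
  UniformO.of_eq_pow_mul (r := fun _ => b) continuous_const fun ε _ => by rw [pow_one]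

/-- The coefficients `approxCoeff` are the ones of the claimed expansion divided by `ε * b`. -/
theorem add_eta_mul_quarticProfile_approxCoeff {d : ℝ} (hd : d ≠ 0) (D ε b : ℝ) (w : Circle) :
    (w : ℂ) + (ε * b : ℝ) * quarticProfile (approxCoeff D d (ε * b / d)) w =
      conformalExpansion D (ε * b / d) w := by
  have hdC : (d : ℂ) ≠ 0 := by exact_mod_cast hd
  simp only [quarticProfile, approxCoeff, conformalExpansion, Matrix.cons_val]
  push_cast
  field_simp
  ring

/-- The leading part of the boundary field, which is real on the circle. -/
noncomputable def leadingField (D x : ℂ) (w v : ℂ) : ℂ :=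
  x * (1 + D + D * (w ^ 2 + v ^ 2)) + x ^ 2 * (D * (w ^ 3 + v ^ 3)) +
    x ^ 3 * (D * (1 + D) * (w ^ 2 + v ^ 2) + D * (w ^ 4 + v ^ 4) + D ^ 2) +
    x ^ 4 * (D * (1 + D) / 2 * (w ^ 3 + v ^ 3) + D * (w ^ 5 + v ^ 5))

/-- On the circle, conjugation exchanges `w` and `conj w`, and the polynomial is symmetric in the
two with real coefficients. -/
theorem leadingField_im (D x : ℝ) (w : Circle) : (leadingField D x w (conj (w : ℂ))).im = 0 := by
  rw [← Complex.conj_eq_iff_im]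
  simp only [leadingField, map_add, map_mul, map_pow, map_div₀, Complex.conj_ofReal,
    Complex.conj_conj, map_one, Complex.conj_ofNat]
  ring

/-- A polynomial identity modulo `w * v = 1`. The coefficients of the profile and the corrections
`μ`, `μ'` are such that, through order four, the field normalized by `γ / (2 d)` is symmetric in `w`
and `v`. Each other term on the right displays the remainders or powers of `x` that make it of order
five. -/
theorem reducedField_approx_algebra {D x w v μ μ' φ φc ψ₃ ψ ω κ r ρ₁ ρ₂ d self cross c₀ c₁ : ℂ}
    (hwv : w * v = 1)
    (hφ : φ = w + D * x ^ 2 * v + ψ₃) (hψ : ψ₃ = D / 2 * x ^ 3 * v ^ 2 + ψ)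
    (hself : self = -(c₀ ^ 2 + c₀ * c₁ * v) + ρ₁)
    (hr : x * d ^ 2 * v * (c₀ ^ 2 + c₀ * c₁ * v) = D ^ 2 * x ^ 3 * v + D ^ 2 / 2 * x ^ 4 * v ^ 2 + r)
    (hcross : cross * d = 1 + x * φ + (x * φ) ^ 2 + (x * φ) ^ 3 + (x * φ) ^ 4 + κ + ρ₂) 
    (f' ψc : ℂ) (hf' : -d * f' = (D * x + 2 * D * (1 + D) * x ^ 3) * v ^ 2 +
      (D * x ^ 2 + 3 / 2 * D * (1 + D) * x ^ 4) * v ^ 3 + D * x ^ 3 * v ^ 4 + D * x ^ 4 * v ^ 5) 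
    (hφc : φc = v + D * x ^ 2 * w + D / 2 * x ^ 3 * w ^ 2 + ψc) :
    -d * f' + (x * (D * (1 + μ) + (1 + μ')) * φc - D * (1 + μ) - x * d ^ 2 * v * self +
      D * (cross * d)) * (w * (1 - D * x ^ 2 * v ^ 2 - D * x ^ 3 * v ^ 3 + ω)) =
    leadingField D x w v + 
      ((x * (D * μ + μ') * φc + x * (1 + D) * ψc + D * (κ - (μ - D * x ^ 4)) + r -
        x * d ^ 2 * v * ρ₁ + D * ρ₂ +
        D * (x * ψ + x ^ 2 * (2 * w * ψ₃ + (D * x ^ 2 * v + ψ₃) ^ 2) +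
        x ^ 3 * (D * x ^ 2 * v + ψ₃) * (φ ^ 2 + φ * w + w ^ 2) +
        x ^ 4 * (D * x ^ 2 * v + ψ₃) * (φ ^ 3 + φ ^ 2 * w + φ * w ^ 2 + w ^ 3))) *
        (w * (1 - D * x ^ 2 * v ^ 2 - D * x ^ 3 * v ^ 3 + ω)) +
      (x * ((1 + D) * v + D * w) + x ^ 2 * (D * w ^ 2) +
        x ^ 3 * (D * (1 + D) * w + 2 * D ^ 2 * v + D * w ^ 3) +
        x ^ 4 * (D * (1 + D) / 2 * w ^ 2 + D ^ 2 + D ^ 2 * v ^ 2 + D * w ^ 4)) * w * ω +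
      x ^ 5 * (-(D * (1 + D) * w + 2 * D ^ 2 * v + D * w ^ 3) * (D * v) - D * w ^ 2 * (D * v ^ 2) +
        x * (-(D * (1 + D) / 2 * w ^ 2 + D ^ 2 + D ^ 2 * v ^ 2 + D * w ^ 4) * (D * v) -
          (D * (1 + D) * w + 2 * D ^ 2 * v + D * w ^ 3) * (D * v ^ 2)) -
        x ^ 2 * (D * (1 + D) / 2 * w ^ 2 + D ^ 2 + D ^ 2 * v ^ 2 + D * w ^ 4) * (D * v ^ 2))) := by
  -- The square of `x * φ` produces the resonant constant `2 * D * x ^ 4`. The summand `D * x ^ 4`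
  -- of `μ` cancels half of it; the other half is the `D ^ 2` in the coefficient of `x ^ 4`.
  have hB : x * (D * (1 + μ) + (1 + μ')) * φc - D * (1 + μ) - x * d ^ 2 * v * self + D * (cross * d) =
      (x * ((1 + D) * v + D * w) + x ^ 2 * (D * w ^ 2) +
        x ^ 3 * (D * (1 + D) * w + 2 * D ^ 2 * v + D * w ^ 3) +
        x ^ 4 * (D * (1 + D) / 2 * w ^ 2 + D ^ 2 + D ^ 2 * v ^ 2 + D * w ^ 4)) +
      (x * (D * μ + μ') * φc + x * (1 + D) * ψc + D * (κ - (μ - D * x ^ 4)) + r -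
        x * d ^ 2 * v * ρ₁ + D * ρ₂ +
        D * (x * ψ + x ^ 2 * (2 * w * ψ₃ + (D * x ^ 2 * v + ψ₃) ^ 2) +
        x ^ 3 * (D * x ^ 2 * v + ψ₃) * (φ ^ 2 + φ * w + w ^ 2) +
        x ^ 4 * (D * x ^ 2 * v + ψ₃) * (φ ^ 3 + φ ^ 2 * w + φ * w ^ 2 + w ^ 3))) := by
    rw [hcross, hself]
    have e1 : (x * φ) ^ 3 = x ^ 3 * w ^ 3 + x ^ 3 * (D * x ^ 2 * v + ψ₃) * (φ ^ 2 + φ * w + w ^ 2) := by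
      rw [hφ]; ring
    have e2 : (x * φ) ^ 4 = x ^ 4 * w ^ 4 + x ^ 4 * (D * x ^ 2 * v + ψ₃) *
        (φ ^ 3 + φ ^ 2 * w + φ * w ^ 2 + w ^ 3) := by
      rw [hφ]; ring
    have e3 : (x * φ) ^ 2 = x ^ 2 * (w ^ 2 + 2 * D * x ^ 2) +
        x ^ 2 * (2 * w * ψ₃ + (D * x ^ 2 * v + ψ₃) ^ 2) := by
      rw [hφ]; linear_combination (2 * D * x ^ 4) * hwv
    rw [e1, e2, e3]
    have e4 : x * φ = x * (w + D * x ^ 2 * v + D / 2 * x ^ 3 * v ^ 2) + x * ψ := by rw [hφ, hψ]; ring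
    have e5 : φc * (x * (1 + D)) = (v + D * x ^ 2 * w + D / 2 * x ^ 3 * w ^ 2 + ψc) * (x * (1 + D)) := by
      rw [hφc]
    linear_combination hr + D * e4 + e5
  rw [hB, hf']
  have hq : w * (1 - D * x ^ 2 * v ^ 2 - D * x ^ 3 * v ^ 3 + ω) =
      w - D * x ^ 2 * v - D * x ^ 3 * v ^ 2 + w * ω := by
    linear_combination (-(D * x ^ 2 * v) - D * x ^ 3 * v ^ 2) * hwv
  generalize (x * (D * μ + μ') * φc + x * (1 + D) * ψc + D * (κ - (μ - D * x ^ 4)) + r -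
        x * d ^ 2 * v * ρ₁ + D * ρ₂ +
        D * (x * ψ + x ^ 2 * (2 * w * ψ₃ + (D * x ^ 2 * v + ψ₃) ^ 2) +
        x ^ 3 * (D * x ^ 2 * v + ψ₃) * (φ ^ 2 + φ * w + w ^ 2) +
        x ^ 4 * (D * x ^ 2 * v + ψ₃) * (φ ^ 3 + φ ^ 2 * w + φ * w ^ 2 + w ^ 3))) = R
  rw [hq, leadingField]
  linear_combination (x * (1 + D) + x ^ 3 * D ^ 2 - x ^ 4 * D ^ 2 * w) * hwv

-- The expansions of the two kernels are inserted into `reducedField_approx_algebra`, and every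
-- remainder there receives its order. Since `leadingField` is real on the circle, the imaginary
-- part of the residual is `O(ε⁵)`.
set_option maxHeartbeats 1000000 in
theorem uniformO_reducedField_approx {γ γ' b b' d : ℝ} (hγ : γ ≠ 0) (hγ' : γ' ≠ 0) (hd : 0 < d) :
    UniformO 5 fun ε w =>
      reducedField γ γ' (ε * b) (ε * b') d
        ((γ' / (2 * d) * (1 + approxCorrection (γ' / γ) (γ / γ') (ε * b / d) (ε * b' / d)) +
          γ / (2 * d) * (1 + approxCorrection (γ / γ') (γ' / γ) (ε * b' / d) (ε * b / d))) / d)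
        (γ' / (2 * d) * (1 + approxCorrection (γ' / γ) (γ / γ') (ε * b / d) (ε * b' / d)))
        (quarticProfile (approxCoeff (γ' / γ) d (ε * b / d)))
        (quarticProfile (approxCoeff (γ / γ') d (ε * b' / d))) w -
      (γ / (2 * d) : ℝ) * leadingField (γ' / γ : ℝ) (ε * b / d : ℝ) w (conj (w : ℂ)) := by
  have hdC : (d : ℂ) ≠ 0 := by exact_mod_cast hd.ne'
  have hγC : (γ : ℂ) ≠ 0 := by exact_mod_cast hγ
  have hγC' : (γ' : ℂ) ≠ 0 := by exact_mod_cast hγ'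
  obtain ⟨D, hD⟩ : ∃ D : ℝ, D = γ' / γ := ⟨_, rfl⟩
  obtain ⟨D', hD'⟩ : ∃ D : ℝ, D = γ / γ' := ⟨_, rfl⟩
  rw [← hD, ← hD']
  have hw : UniformO 0 fun (_ : ℝ) (p : Circle) => (p : ℂ) := UniformO.circleCoe
  have hv : UniformO 0 fun (_ : ℝ) (p : Circle) => conj (p : ℂ) := UniformO.circleConj
  have O0 : ∀ {F : ℝ → Circle → ℂ} (n : ℕ), UniformO 0 F → UniformO 0 (fun ε p => F ε p ^ n) :=
    fun n hF => by simpa using hF.pow n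
  have cst : ∀ z : ℂ, UniformO 0 fun (_ : ℝ) (_ : Circle) => z := fun z => UniformO.const z
  have Hx : ∀ b : ℝ, UniformO 1 fun (ε : ℝ) (_ : Circle) => ((ε * b / d : ℝ) : ℂ) := fun b =>
    (uniformO_real_mul (b / d)).congr fun ε _ => by rw [mul_div_assoc]
  set x : ℝ → ℂ := fun ε => ((ε * b / d : ℝ) : ℂ) with hx
  set x' : ℝ → ℂ := fun ε => ((ε * b' / d : ℝ) : ℂ) with hx'
  have hxO : UniformO 1 fun ε (_ : Circle) => x ε := Hx b
  have hxO' : UniformO 1 fun ε (_ : Circle) => x' ε := Hx b'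
  have hφbound : UniformO 0 fun ε (w : Circle) => conformalExpansion D (ε * b / d) w := by
    have h : UniformO 1 fun (ε : ℝ) (w : Circle) => ((ε * b : ℝ) : ℂ) *
        quarticProfile (approxCoeff D d (ε * b / d)) w := by
      have hC : ∀ i : Fin 4, UniformO 0 fun ε (_ : Circle) => (approxCoeff D d (ε * b / d) i : ℂ) :=
        fun i => ((uniformO_approxCoeff D b d i).comp fun _ => ()).mono (Nat.zero_le _)
      exact (uniformO_real_mul b).mul_bdd (((((hC 0).mul hv).add ((hC 1).mul (O0 2 hv))).add
        ((hC 2).mul (O0 3 hv))).add ((hC 3).mul (O0 4 hv)))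
    refine (hw.add (h.mono (Nat.zero_le _))).congr fun ε w => ?_
    rw [add_eta_mul_quarticProfile_approxCoeff hd.ne']
  set φ : ℝ → Circle → ℂ := fun ε w => conformalExpansion D (ε * b / d) w with hφ
  -- the remainders of the kernels
  have Hself := uniformO_circleMean_selfKernel (uniformO_real_mul (P := Unit) b)
    (uniformO_approxCoeff D b d)
  have Hcross := uniformO_circleMean_crossKernel (u := fun ε w => (ε * b : ℝ) * φ ε w) hd
    (uniformO_real_mul (P := Unit) b') (uniformO_approxCoeff D' b' d)
    ((uniformO_real_mul b).mul_bdd hφbound)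
  set ρ₁ : ℝ → Circle → ℂ := fun ε w =>
    circleMean (selfKernel (ε * b) (quarticProfile (approxCoeff D d (ε * b / d))) w) +
      ((approxCoeff D d (ε * b / d) 0 : ℂ) ^ 2 + (approxCoeff D d (ε * b / d) 0 : ℂ) *
        (approxCoeff D d (ε * b / d) 1 : ℂ) * conj (w : ℂ)) with hρ₁
  set ρ₂ : ℝ → Circle → ℂ := fun ε w =>
    circleMean (crossKernel (ε * b') (quarticProfile (approxCoeff D' d (ε * b' / d)))
      (d - (ε * b : ℝ) * φ ε w)) -
      (1 / d + (ε * b : ℝ) * φ ε w / d ^ 2 + ((ε * b : ℝ) * φ ε w) ^ 2 / d ^ 3 +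
        ((ε * b : ℝ) * φ ε w) ^ 3 / d ^ 4 + ((ε * b : ℝ) * φ ε w) ^ 4 / d ^ 5 +
        (((ε * b' : ℝ) : ℂ) ^ 2 * ((ε * b' : ℝ) * approxCoeff D' d (ε * b' / d) 0) / d ^ 3 -
          ((ε * b' : ℝ) * approxCoeff D' d (ε * b' / d) 0) ^ 2 / d)) with hρ₂
  -- the other remainders
  set ψ : ℝ → Circle → ℂ := fun ε w => 2 * D * (1 + D) * x ε ^ 4 * conj (w : ℂ) +
    3 / 4 * D * (1 + D) * x ε ^ 5 * conj (w : ℂ) ^ 2 + D / 3 * x ε ^ 4 * conj (w : ℂ) ^ 3 +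
    D / 4 * x ε ^ 5 * conj (w : ℂ) ^ 4 with hψ
  have Hψ : UniformO 4 ψ := (((((hxO.pow 4).const_mul (2 * D * (1 + D))).mul_bdd hv).add
    (((((hxO.pow 5).const_mul (3 / 4 * D * (1 + D))).mul_bdd (O0 2 hv))).mono (by norm_num))).add
    (((hxO.pow 4).const_mul (D / 3)).mul_bdd (O0 3 hv))).add
    ((((hxO.pow 5).const_mul (D / 4)).mul_bdd (O0 4 hv)).mono (by norm_num))
  set ψ₃ : ℝ → Circle → ℂ := fun ε w => D / 2 * x ε ^ 3 * conj (w : ℂ) ^ 2 + ψ ε w with hψ₃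
  have Hψ₃ : UniformO 3 ψ₃ := (((hxO.pow 3).const_mul (D / 2)).mul_bdd (O0 2 hv)).add
    (Hψ.mono (by norm_num))
  set χ : ℝ → Circle → ℂ := fun ε w => D * x ε ^ 2 * conj (w : ℂ) + ψ₃ ε w with hχ
  have Hχ : UniformO 2 χ := (((hxO.pow 2).const_mul D).mul_bdd hv).add (Hψ₃.mono (by norm_num))
  set ω : ℝ → Circle → ℂ := fun ε w => -(2 * D * (1 + D) * x ε ^ 4 * conj (w : ℂ) ^ 2 +
    3 / 2 * D * (1 + D) * x ε ^ 5 * conj (w : ℂ) ^ 3 + D * x ε ^ 4 * conj (w : ℂ) ^ 4 +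
    D * x ε ^ 5 * conj (w : ℂ) ^ 5) with hω
  have Hω : UniformO 4 ω := ((((((hxO.pow 4).const_mul (2 * D * (1 + D))).mul_bdd (O0 2 hv)).add
    (((((hxO.pow 5).const_mul (3 / 2 * D * (1 + D))).mul_bdd (O0 3 hv))).mono (by norm_num))).add
    (((hxO.pow 4).const_mul D).mul_bdd (O0 4 hv))).add
    ((((hxO.pow 5).const_mul D).mul_bdd (O0 5 hv)).mono (by norm_num))).neg
  set g : ℝ → ℂ := fun ε => 2 * D * (1 + D) * x ε ^ 3 with hg
  have Hg : UniformO 3 fun ε (_ : Circle) => g ε := (hxO.pow 3).const_mul _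
  set h : ℝ → ℂ := fun ε => 3 / 4 * D * (1 + D) * x ε ^ 4 with hh
  have Hh : UniformO 4 fun ε (_ : Circle) => h ε := (hxO.pow 4).const_mul _
  set r : ℝ → Circle → ℂ := fun ε w => x ε * conj (w : ℂ) * (g ε * (2 * D * x ε + g ε)) +
    x ε * conj (w : ℂ) ^ 2 * (D * x ε * h ε + g ε * (D / 2 * x ε ^ 2 + h ε)) with hr
  have Hr : UniformO 5 r := ((hxO.mul_bdd hv).mul (Hg.mul ((hxO.const_mul (2 * D)).add
    (Hg.mono (by norm_num))))).add (((hxO.mul_bdd (O0 2 hv)).mul (k := 1) (l := 5)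
      (((hxO.const_mul D).mul Hh).add (Hg.mul (((hxO.pow 2).const_mul (D / 2)).add
        (Hh.mono (by norm_num)))))).mono (by norm_num))
  set κ : ℝ → ℂ := fun ε => x' ε ^ 2 * (D' * x' ε ^ 2 + 2 * D' * (1 + D') * x' ε ^ 4) -
    (D' * x' ε ^ 2 + 2 * D' * (1 + D') * x' ε ^ 4) ^ 2 with hκ
  set μ : ℝ → ℂ := fun ε => (approxCorrection D D' (ε * b / d) (ε * b' / d) : ℂ) with hμ
  set μ' : ℝ → ℂ := fun ε => (approxCorrection D' D (ε * b' / d) (ε * b / d) : ℂ) with hμ'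
  have Hμ : UniformO 4 fun ε (_ : Circle) => μ ε :=
    (((hxO.pow 4).const_mul D).add ((hxO'.pow 4).mul_bdd (cst (D' - D' ^ 2)))).congr fun ε _ => by
      simp only [hμ, approxCorrection, hx, hx']; push_cast; ring
  have Hμ' : UniformO 4 fun ε (_ : Circle) => μ' ε :=
    (((hxO'.pow 4).const_mul D').add ((hxO.pow 4).mul_bdd (cst (D - D ^ 2)))).congr fun ε _ => by
      simp only [hμ', approxCorrection, hx, hx']; push_cast; ring
  -- `κ` is the effect of the deformation of the other patch. The summand `x' ^ 4 * (D' - D' ^ 2)`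
  -- of `approxCorrection` removes its leading term, and the rest has order six.
  have Hκ : UniformO 5 fun ε (_ : Circle) => κ ε - (μ ε - D * x ε ^ 4) := by
    have a1 : UniformO 4 fun ε (_ : Circle) => 2 * D' * (1 + D') * x' ε ^ 4 := (hxO'.pow 4).const_mul _
    refine (((((hxO'.pow 2).mul a1).sub ((((hxO'.pow 2).const_mul (2 * D')).mul a1))).mono
      (by norm_num)).sub ((a1.pow 2).mono (by norm_num))).congr fun ε _ => ?_
    simp only [hκ, hμ, approxCorrection, hx, hx']
    push_cast
    ring
  have HR : UniformO 5 fun ε (w : Circle) => x ε * (D * μ ε + μ' ε) * conj (φ ε w) +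
        x ε * (1 + D) * conj (ψ ε w) + D * (κ ε - (μ ε - D * x ε ^ 4)) + r ε w -
        x ε * d ^ 2 * conj (w : ℂ) * ρ₁ ε w + D * (d * ρ₂ ε w) +
        D * (x ε * ψ ε w + x ε ^ 2 * (2 * (w : ℂ) * ψ₃ ε w + χ ε w ^ 2) +
        x ε ^ 3 * χ ε w * (φ ε w ^ 2 + φ ε w * w + (w : ℂ) ^ 2) +
        x ε ^ 4 * χ ε w * (φ ε w ^ 3 + φ ε w ^ 2 * w + φ ε w * (w : ℂ) ^ 2 + (w : ℂ) ^ 3)) := by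
    have b1 : UniformO 5 fun ε (w : Circle) => x ε * (D * μ ε + μ' ε) * conj (φ ε w) :=
      (hxO.mul ((Hμ.const_mul D).add Hμ')).mul_bdd hφbound.star
    have b2 : UniformO 5 fun ε (w : Circle) => x ε * (1 + D) * conj (ψ ε w) :=
      (hxO.mul_bdd (cst (1 + D))).mul Hψ.star
    have b3 : UniformO 5 fun ε (w : Circle) => x ε * d ^ 2 * conj (w : ℂ) * ρ₁ ε w :=
      ((hxO.mul_bdd (cst (d ^ 2))).mul_bdd hv).mul Hself
    have b4 : UniformO 5 fun ε (w : Circle) => x ε * ψ ε w := hxO.mul Hψ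
    have b5 : UniformO 5 fun ε (w : Circle) => x ε ^ 2 * (2 * (w : ℂ) * ψ₃ ε w + χ ε w ^ 2) :=
      (hxO.pow 2).mul (l := 3) (((hw.const_mul 2).bdd_mul Hψ₃).add ((Hχ.pow 2).mono (by norm_num)))
    have b6 : UniformO 5 fun ε (w : Circle) => x ε ^ 3 * χ ε w * (φ ε w ^ 2 + φ ε w * w + (w : ℂ) ^ 2) :=
      ((hxO.pow 3).mul Hχ).mul_bdd (((O0 2 hφbound).add (hφbound.mul hw)).add (O0 2 hw))
    have b7 : UniformO 5 fun ε (w : Circle) => x ε ^ 4 * χ ε w *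
        (φ ε w ^ 3 + φ ε w ^ 2 * w + φ ε w * (w : ℂ) ^ 2 + (w : ℂ) ^ 3) :=
      ((((hxO.pow 4).mul Hχ).mul_bdd ((((O0 3 hφbound).add ((O0 2 hφbound).mul hw)).add
        (hφbound.mul (O0 2 hw))).add (O0 3 hw)))).mono (by norm_num)
    exact (((((b1.add b2).add (Hκ.const_mul D)).add Hr).sub b3).add
      ((Hcross.const_mul d).const_mul D)).add ((((b4.add b5).add b6).add b7).const_mul D)
  have x0 : UniformO 0 fun ε (_ : Circle) => x ε := hxO.mono (by norm_num)
  have HQ : UniformO 0 fun ε (w : Circle) =>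
      (w : ℂ) * (1 - D * x ε ^ 2 * conj (w : ℂ) ^ 2 - D * x ε ^ 3 * conj (w : ℂ) ^ 3 + ω ε w) :=
    hw.mul ((((cst 1).sub (((O0 2 x0).const_mul D).mul (O0 2 hv))).sub
      (((O0 3 x0).const_mul D).mul (O0 3 hv))).add (Hω.mono (by norm_num)))
  have B3 : UniformO 0 fun (_ : ℝ) (w : Circle) =>
      D * (1 + D) * (w : ℂ) + 2 * D ^ 2 * conj (w : ℂ) + D * (w : ℂ) ^ 3 :=
    ((hw.const_mul (D * (1 + D))).add (hv.const_mul (2 * D ^ 2))).add ((O0 3 hw).const_mul D)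
  have B4 : UniformO 0 fun (_ : ℝ) (w : Circle) => D * (1 + D) / 2 * (w : ℂ) ^ 2 + (D : ℂ) ^ 2 +
      D ^ 2 * conj (w : ℂ) ^ 2 + D * (w : ℂ) ^ 4 :=
    ((((O0 2 hw).const_mul (D * (1 + D) / 2)).add (cst (D ^ 2))).add
      ((O0 2 hv).const_mul (D ^ 2))).add ((O0 4 hw).const_mul D)
  have Hω2 : UniformO 5 fun ε (w : Circle) => (x ε * ((1 + D) * conj (w : ℂ) + D * w) +
        x ε ^ 2 * (D * (w : ℂ) ^ 2) +
        x ε ^ 3 * (D * (1 + D) * w + 2 * D ^ 2 * conj (w : ℂ) + D * (w : ℂ) ^ 3) +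
        x ε ^ 4 * (D * (1 + D) / 2 * (w : ℂ) ^ 2 + D ^ 2 + D ^ 2 * conj (w : ℂ) ^ 2 + D * (w : ℂ) ^ 4)) *
        w * ω ε w := by
    refine (UniformO.mul_bdd (k := 1) ?_ hw).mul Hω
    exact (((hxO.mul_bdd ((hv.const_mul (1 + D)).add (hw.const_mul D))).add
      (((hxO.pow 2).mul_bdd ((O0 2 hw).const_mul D)).mono (by norm_num))).add
      (((hxO.pow 3).mul_bdd B3).mono (by norm_num))).add (((hxO.pow 4).mul_bdd B4).mono (by norm_num))
  have H5 : UniformO 5 fun ε (w : Circle) => x ε ^ 5 *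
      (-(D * (1 + D) * w + 2 * D ^ 2 * conj (w : ℂ) + D * (w : ℂ) ^ 3) * (D * conj (w : ℂ)) -
        D * (w : ℂ) ^ 2 * (D * conj (w : ℂ) ^ 2) +
        x ε * (-(D * (1 + D) / 2 * (w : ℂ) ^ 2 + D ^ 2 + D ^ 2 * conj (w : ℂ) ^ 2 + D * (w : ℂ) ^ 4) *
          (D * conj (w : ℂ)) - (D * (1 + D) * w + 2 * D ^ 2 * conj (w : ℂ) + D * (w : ℂ) ^ 3) *
          (D * conj (w : ℂ) ^ 2)) -
        x ε ^ 2 * (D * (1 + D) / 2 * (w : ℂ) ^ 2 + D ^ 2 + D ^ 2 * conj (w : ℂ) ^ 2 + D * (w : ℂ) ^ 4) *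
          (D * conj (w : ℂ) ^ 2)) :=
    (hxO.pow 5).mul_bdd ((((B3.neg.mul (hv.const_mul D)).sub (((O0 2 hw).const_mul D).mul
      ((O0 2 hv).const_mul D))).add (x0.mul ((B4.neg.mul (hv.const_mul D)).sub
      (B3.mul ((O0 2 hv).const_mul D))))).sub (((O0 2 x0).mul B4).mul ((O0 2 hv).const_mul D)))
  refine ((((HR.mul_bdd HQ).add Hω2).add H5).const_mul ((γ / (2 * d) : ℝ) : ℂ)).congr fun ε w => ?_
  have hwv : (w : ℂ) * conj (w : ℂ) = 1 := by
    rw [Complex.mul_conj, Circle.normSq_coe, Complex.ofReal_one]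
  have hφψ : φ ε w = w + D * x ε ^ 2 * conj (w : ℂ) + ψ₃ ε w := by
    simp only [hφ, hψ₃, hψ, hx, conformalExpansion]
    ring
  have hconjx : conj (x ε) = x ε := Complex.conj_ofReal _
  have alg := reducedField_approx_algebra (D := D) (x := x ε) (w := w) (v := conj (w : ℂ)) (μ := μ ε)
    (μ' := μ' ε) (φ := φ ε w) (φc := conj (φ ε w)) (ψ₃ := ψ₃ ε w) (ψ := ψ ε w) (ω := ω ε w) (κ := κ ε)
    (r := r ε w) (ρ₁ := ρ₁ ε w) (ρ₂ := d * ρ₂ ε w) (d := d)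
    (self := circleMean (selfKernel (ε * b) (quarticProfile (approxCoeff D d (ε * b / d))) w))
    (cross := circleMean (crossKernel (ε * b') (quarticProfile (approxCoeff D' d (ε * b' / d)))
      (d - (ε * b : ℝ) * φ ε w))) (c₀ := approxCoeff D d (ε * b / d) 0)
    (c₁ := approxCoeff D d (ε * b / d) 1) hwv hφψ rfl (by simp only [hρ₁]; ring)
    (by
      simp only [hr, hg, hh, hx, approxCoeff, Matrix.cons_val]
      push_cast
      field_simp
      ring)
    (by
      have hη : ((ε * b : ℝ) : ℂ) = d * x ε := by simp only [hx]; push_cast; field_simp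
      have hη' : ((ε * b' : ℝ) : ℂ) = d * x' ε := by simp only [hx']; push_cast; field_simp
      have hc : (approxCoeff D' d (ε * b' / d) 0 : ℂ) = (D' * x' ε + 2 * D' * (1 + D') * x' ε ^ 3) / d := by
        simp only [approxCoeff, hx', Matrix.cons_val]; push_cast; rfl
      simp only [hρ₂, hκ, hη, hη', hc]
      field_simp
      ring)
    (circleDeriv (quarticProfile (approxCoeff D d (ε * b / d))) w) (conj (ψ ε w))
    (by
      rw [(quarticProfile_deriv _).2]
      simp only [hx, approxCoeff, Matrix.cons_val]
      push_cast
      field_simp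
      ring)
    (by
      rw [hφψ]
      simp only [hψ₃, map_add, map_mul, map_pow, map_div₀, hconjx, Complex.conj_ofReal,
        Complex.conj_conj, Complex.conj_ofNat]
      ring)
  have hω' : (1 : ℂ) + (ε * b : ℝ) * circleDeriv (quarticProfile (approxCoeff D d (ε * b / d))) w =
      1 - D * x ε ^ 2 * conj (w : ℂ) ^ 2 - D * x ε ^ 3 * conj (w : ℂ) ^ 3 + ω ε w := by
    rw [(quarticProfile_deriv _).2]
    simp only [hω, hx, approxCoeff, Matrix.cons_val]
    push_cast
    field_simp
    ring
  have hfield : reducedField γ γ' (ε * b) (ε * b') d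
        ((γ' / (2 * d) * (1 + approxCorrection D D' (ε * b / d) (ε * b' / d)) +
          γ / (2 * d) * (1 + approxCorrection D' D (ε * b' / d) (ε * b / d))) / d)
        (γ' / (2 * d) * (1 + approxCorrection D D' (ε * b / d) (ε * b' / d)))
        (quarticProfile (approxCoeff D d (ε * b / d)))
        (quarticProfile (approxCoeff D' d (ε * b' / d))) w = (γ / (2 * d) : ℝ) *
      (-d * circleDeriv (quarticProfile (approxCoeff D d (ε * b / d))) w +
        (x ε * (D * (1 + μ ε) + (1 + μ' ε)) * conj (φ ε w) - D * (1 + μ ε) -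
        x ε * d ^ 2 * conj (w : ℂ) *
          circleMean (selfKernel (ε * b) (quarticProfile (approxCoeff D d (ε * b / d))) w) +
        D * (circleMean (crossKernel (ε * b') (quarticProfile (approxCoeff D' d (ε * b' / d)))
          (d - (ε * b : ℝ) * φ ε w)) * d)) *
        (w * (1 - D * x ε ^ 2 * conj (w : ℂ) ^ 2 - D * x ε ^ 3 * conj (w : ℂ) ^ 3 + ω ε w))) := by
    rw [← hω', reducedField, add_eta_mul_quarticProfile_approxCoeff hd.ne']
    simp only [hμ, hμ', hx, hφ]
    rw [hD]
    generalize (approxCorrection (γ' / γ) D' (ε * b / d) (ε * b' / d)) = m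
    generalize (approxCorrection D' (γ' / γ) (ε * b' / d) (ε * b / d)) = m'
    push_cast
    field_simp
  rw [hfield, alg]
  simp only [hχ]
  ring

/-! ### Rotating pairs are close to the approximate solution -/

/-- The pointwise bound is squared and averaged, and the left side is evaluated by the coercivity
identity. The derivative may appear pointwise on the right because only its mean square survives. -/
theorem IsProfile.sq_le_of_im_le {h : Circle → ℂ} {a : ℕ → ℝ} (hh : IsProfile h a) {γ α P Q : ℝ}
    (H : ∀ w : Circle, |((γ : ℂ) / 2 * circleDeriv h w + α * w).im| ≤ P + Q * ‖circleDeriv h w‖) :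
    γ ^ 2 / 8 * derivNorm h ^ 2 + α ^ 2 / 2 ≤ 2 * P ^ 2 + 2 * Q ^ 2 * derivNorm h ^ 2 := by
  have hd : Tame (circleDeriv h) := Tame.of_continuous hh.cont
  rw [← hh.circleMean_im_sq γ α, derivNorm_sq]
  have i1 : Integrable (fun t => 2 * Q ^ 2 * ‖circleDeriv h (Circle.exp t)‖ ^ 2) angleMeasure := by
    refine ((hd.mul hd).norm.const_mul (2 * Q ^ 2)).congr (Eventually.of_forall fun t => ?_)
    simp only [norm_mul]
    ring
  have i2 : Integrable (fun t => 2 * P ^ 2 + 2 * Q ^ 2 * ‖circleDeriv h (Circle.exp t)‖ ^ 2)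
      angleMeasure := (integrable_const _).add i1
  have i3 : Integrable (fun t => (((γ : ℂ) / 2 * circleDeriv h (Circle.exp t) +
      α * (Circle.exp t : ℂ)).im) ^ 2) angleMeasure := by
    have t : Tame (fun w => ((((γ : ℂ) / 2 * circleDeriv h w + α * w).im ^ 2 : ℝ) : ℂ)) := by
      refine Tame.of_continuous ?_
      have := hh.cont
      have h2 := continuous_circle_coe
      fun_prop
    exact t.integrable.re.congr (Eventually.of_forall fun _ => Complex.ofReal_re _)
  have : circleMean (fun w => ((γ : ℂ) / 2 * circleDeriv h w + α * w).im ^ 2) ≤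
      circleMean (fun w => 2 * P ^ 2 + 2 * Q ^ 2 * ‖circleDeriv h w‖ ^ 2) := by
    refine integral_mono i3 i2 fun t => ?_
    have h1 := H (Circle.exp t)
    have h2 : ((γ : ℂ) / 2 * circleDeriv h (Circle.exp t) + α * (Circle.exp t : ℂ)).im ^ 2 ≤
        (P + Q * ‖circleDeriv h (Circle.exp t)‖) ^ 2 := by
      rw [← sq_abs]
      exact pow_le_pow_left₀ (abs_nonneg _) h1 2
    simp only
    nlinarith [sq_nonneg (P - Q * ‖circleDeriv h (Circle.exp t)‖)]
  refine this.trans (le_of_eq ?_)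
  simp only [circleMean]
  rw [integral_add (integrable_const _) i1, integral_const_mul (2 * Q ^ 2)]
  simp

/-- The approximate profiles of the two patches. -/
noncomputable def approxProfile (γ b : Fin 2 → ℝ) (d ε : ℝ) (j : Fin 2) : Circle → ℂ :=
  quarticProfile (approxCoeff (γ (1 - j) / γ j) d (ε * b j / d))

/-- The approximate speeds of the centres of the patches. -/
noncomputable def approxSpeed (γ b : Fin 2 → ℝ) (d ε : ℝ) (j : Fin 2) : ℝ :=
  γ (1 - j) / (2 * d) * (1 + approxCorrection (γ (1 - j) / γ j) (γ j / γ (1 - j))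
    (ε * b j / d) (ε * b (1 - j) / d))

variable {γ b : Fin 2 → ℝ} {d : ℝ}

theorem continuous_approxSpeed (γ b : Fin 2 → ℝ) (d : ℝ) (j : Fin 2) :
    Continuous fun ε => approxSpeed γ b d ε j := by
  simp only [approxSpeed, approxCorrection]
  fun_prop

theorem exists_residual_le (hγ : ∀ j, γ j ≠ 0) (hd : 0 < d) (j : Fin 2) : ∃ C : ℝ, 0 ≤ C ∧
    ∀ᶠ ε in 𝓝 (0 : ℝ), ∀ w, |(reducedField (γ j) (γ (1 - j)) (ε * b j) (ε * b (1 - j)) d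
      ((approxSpeed γ b d ε 0 + approxSpeed γ b d ε 1) / d) (approxSpeed γ b d ε j)
      (approxProfile γ b d ε j) (approxProfile γ b d ε (1 - j)) w).im| ≤ C * |ε| ^ 5 := by
  obtain ⟨C, hC0, hC⟩ := uniformO_reducedField_approx (b := b j) (b' := b (1 - j)) (hγ j) (hγ (1 - j)) hd
  refine ⟨C, hC0, hC.mono fun ε h w => ?_⟩
  have h1 := (Complex.abs_im_le_norm _).trans (h w)
  rw [Complex.sub_im, Complex.im_ofReal_mul, leadingField_im, mul_zero, sub_zero] at h1
  have hj : (1 : Fin 2) - (1 - j) = j := by fin_cases j <;> rfl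
  have e : approxSpeed γ b d ε 0 + approxSpeed γ b d ε 1 =
      approxSpeed γ b d ε j + approxSpeed γ b d ε (1 - j) := by
    fin_cases j
    · rfl
    · simp [add_comm]
  rw [e]
  simp only [approxSpeed, approxProfile, hj]
  exact h1

theorem eventually_unitBounded_approxProfile (γ b : Fin 2 → ℝ) (d : ℝ) (j : Fin 2) :
    ∀ᶠ ε in 𝓝 (0 : ℝ), UnitBounded (approxProfile γ b d ε j) := by
  have hv : UniformO 0 fun (_ : ℝ) (p : Circle) => conj (p : ℂ) := UniformO.circleConj
  have O0 : ∀ n : ℕ, UniformO 0 (fun (_ : ℝ) (p : Circle) => conj (p : ℂ) ^ n) :=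
    fun n => by simpa using hv.pow n
  have hC : ∀ i : Fin 4, UniformO 1 fun ε (_ : Circle) =>
      (approxCoeff (γ (1 - j) / γ j) d (ε * b j / d) i : ℂ) :=
    fun i => ((uniformO_approxCoeff _ (b j) d i).comp fun _ => ()).mono (Nat.le_add_left 1 _)
  have h1 : UniformO 1 fun ε (w : Circle) => approxProfile γ b d ε j w :=
    ((((hC 0).mul_bdd hv).add ((hC 1).mul_bdd (O0 2))).add ((hC 2).mul_bdd (O0 3))).add
      ((hC 3).mul_bdd (O0 4))
  have h2 : UniformO 1 fun ε (w : Circle) => circleDeriv (approxProfile γ b d ε j) w :=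
    (((((hC 0).mul_bdd (O0 2)).add (((hC 1).const_mul 2).mul_bdd (O0 3))).add
      (((hC 2).const_mul 3).mul_bdd (O0 4))).add (((hC 3).const_mul 4).mul_bdd (O0 5))).neg.congr
      fun ε w => by rw [approxProfile, (quarticProfile_deriv _).2]
  filter_upwards [eventually_norm_le_half h1 one_pos, eventually_norm_le_half h2 one_pos] with ε k1 k2
  exact ⟨k1, k2⟩

theorem sq_add_four_le (p q r s : ℝ) :
    (p + q + r + s) ^ 2 ≤ 4 * (p ^ 2 + q ^ 2 + r ^ 2 + s ^ 2) := by
  nlinarith [sq_nonneg (p - q), sq_nonneg (p - r), sq_nonneg (p - s), sq_nonneg (q - r),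
    sq_nonneg (q - s), sq_nonneg (r - s)]

-- Rigidity: the equations of the rotating pair and of the approximate pair are subtracted. The
-- coercive linear part bounds the squared errors by the square of `O(ε)` times the errors plus
-- `O(ε⁵)`, and for small `ε` the first contribution is absorbed. About the pair only the unit
-- bounds on the profiles are assumed; `Ω` and `Z` are arbitrary.
set_option maxHeartbeats 800000 in
theorem exists_dist_approx_le (hγ : ∀ j, γ j ≠ 0) (hb : ∀ j, 0 < b j) (hd : 0 < d) :
    ∃ C : ℝ, 0 ≤ C ∧ ∀ᶠ ε in 𝓝 (0 : ℝ), ε ≠ 0 → ∀ (Ω Z : ℝ) (f : Fin 2 → Circle → ℂ)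
      (a : Fin 2 → ℕ → ℝ), (∀ j, IsProfile (f j) (a j)) → (∀ j, UnitBounded (f j)) →
      RotatesUniformly γ b ε Ω Z (patchBoundary b d ε (conformalMap b ε f)) → ∀ j,
      derivNorm (fun τ => f j τ - approxProfile γ b d ε j τ) ≤ C * |ε| ^ 5 ∧
      |![Ω * Z, Ω * (d - Z)] j - approxSpeed γ b d ε j| ≤ C * |ε| ^ 5 := by
  -- The values of the approximate speeds at `ε = 0`; the summand `1` leaves room for nearby `ε`.
  set M : ℝ := |approxSpeed γ b d 0 0| + |approxSpeed γ b d 0 1| +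
    |(approxSpeed γ b d 0 0 + approxSpeed γ b d 0 1) / d| + 1 with hM
  have hM0 : 0 ≤ M := by positivity
  have hS : ∀ j, ∀ᶠ ε in 𝓝 (0 : ℝ), |approxSpeed γ b d ε j| ≤ M := fun j => by
    have h1 : |approxSpeed γ b d 0 j| < M := by
      have a0 := abs_nonneg (approxSpeed γ b d 0 0)
      have a1 := abs_nonneg (approxSpeed γ b d 0 1)
      have a2 := abs_nonneg ((approxSpeed γ b d 0 0 + approxSpeed γ b d 0 1) / d)
      fin_cases j <;> simp only [Fin.zero_eta, Fin.mk_one] <;> linarith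
    exact (((continuous_approxSpeed γ b d j).abs.tendsto 0).eventually (gt_mem_nhds h1)).mono
      fun _ h => h.le
  have hΩ : ∀ᶠ ε in 𝓝 (0 : ℝ), |(approxSpeed γ b d ε 0 + approxSpeed γ b d ε 1) / d| ≤ M := by
    have h1 : |(approxSpeed γ b d 0 0 + approxSpeed γ b d 0 1) / d| < M := by
      have a0 := abs_nonneg (approxSpeed γ b d 0 0)
      have a1 := abs_nonneg (approxSpeed γ b d 0 1)
      linarith
    exact ((((continuous_approxSpeed γ b d 0).add (continuous_approxSpeed γ b d 1)).div_const
      d).abs.tendsto 0 |>.eventually (gt_mem_nhds h1)).mono fun _ h => h.le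
  choose C₁ hC₁ H₁ using fun j : Fin 2 => exists_reducedField_lipschitz hd (γ j) (γ (1 - j)) M hM0
  choose C₂ hC₂ H₂ using fun j : Fin 2 => exists_residual_le (b := b) hγ hd j
  set β := b 0 + b 1 with hβ
  have hβ0 : 0 < β := add_pos (hb 0) (hb 1)
  have hbβ : ∀ j, b j ≤ β := fun j => by
    have := hb 0
    have := hb 1
    fin_cases j <;> simp only [Fin.zero_eta, Fin.mk_one] <;> linarith
  -- The term `2 / d` pays for the error of the angular velocity, which is at most `V / d` because
  -- `Ω * d` is the sum of the two speeds.
  set C₃ := (C₁ 0 + C₁ 1) * β * (2 + 2 / d) with hC₃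
  have hC₃0 : 0 ≤ C₃ := by have := hC₁ 0; have := hC₁ 1; positivity
  set C₄ := C₂ 0 + C₂ 1 with hC₄
  have hC₄0 : 0 ≤ C₄ := add_nonneg (hC₂ 0) (hC₂ 1)
  -- `m` is a coercivity constant common to both profiles and both speeds.
  obtain ⟨m, hm0, hm⟩ : ∃ m : ℝ, 0 < m ∧ (∀ j, m ≤ γ j ^ 2 / 8) ∧ m ≤ 1 / 2 := by
    refine ⟨min (min (γ 0 ^ 2 / 8) (γ 1 ^ 2 / 8)) (1 / 2), ?_, fun j => ?_, min_le_right _ _⟩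
    · have := hγ 0
      have := hγ 1
      positivity
    · fin_cases j
      · exact (min_le_left _ _).trans (min_le_left _ _)
      · exact (min_le_left _ _).trans (min_le_right _ _)
  set C₅ := 2 * (√(16 * C₄ ^ 2 / m)) with hC₅
  -- `34 = 8 * 4 + 2`: the square of `C₃ * |ε| * V` enters with the factor `8` and `V ^ 2 ≤ 4 * S`,
  -- while the pointwise derivative term enters with the factor `2`.
  have hsmall : ∀ᶠ ε in 𝓝 (0 : ℝ), |ε| * β ≤ 1 / 4 ∧ |ε| * β ≤ d / 8 ∧
      34 * C₃ ^ 2 * |ε| ^ 2 ≤ m / 2 := by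
    have c1 : Tendsto (fun ε : ℝ => |ε| * β) (𝓝 0) (𝓝 0) := by
      have : Continuous fun ε : ℝ => |ε| * β := by fun_prop
      simpa using this.tendsto 0
    have c2 : Tendsto (fun ε : ℝ => 34 * C₃ ^ 2 * |ε| ^ 2) (𝓝 0) (𝓝 0) := by
      have : Continuous fun ε : ℝ => 34 * C₃ ^ 2 * |ε| ^ 2 := by fun_prop
      simpa using this.tendsto 0
    filter_upwards [c1.eventually (gt_mem_nhds (show (0 : ℝ) < 1 / 4 by norm_num)),
      c1.eventually (gt_mem_nhds (show (0 : ℝ) < d / 8 by positivity)),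
      c2.eventually (gt_mem_nhds (half_pos hm0))] with ε h1 h2 h3
    exact ⟨h1.le, h2.le, h3.le⟩
  refine ⟨C₅, by positivity, ?_⟩
  filter_upwards [hS 0, hS 1, hΩ, H₂ 0, H₂ 1, hsmall,
    eventually_unitBounded_approxProfile γ b d 0, eventually_unitBounded_approxProfile γ b d 1] with
    ε hS0 hS1 hΩε hr0 hr1 hε hu0 hu1 hne Ω Z f a hf hfu hrot
  obtain ⟨hε1, hε2, hε3⟩ := hε
  have hSj : ∀ j, |approxSpeed γ b d ε j| ≤ M := fun j => by fin_cases j <;> assumption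
  have huj : ∀ j, UnitBounded (approxProfile γ b d ε j) := fun j => by fin_cases j <;> assumption
  have hrj : ∀ j w, |(reducedField (γ j) (γ (1 - j)) (ε * b j) (ε * b (1 - j)) d
      ((approxSpeed γ b d ε 0 + approxSpeed γ b d ε 1) / d) (approxSpeed γ b d ε j)
      (approxProfile γ b d ε j) (approxProfile γ b d ε (1 - j)) w).im| ≤ C₂ j * |ε| ^ 5 := fun j => by
    fin_cases j <;> assumption
  have hη : ∀ j, |ε * b j| ≤ |ε| * β := fun j => by
    rw [abs_mul, abs_of_pos (hb j)]
    exact mul_le_mul_of_nonneg_left (hbβ j) (abs_nonneg _)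
  set A : Fin 2 → ℝ := ![Ω * Z, Ω * (d - Z)] with hA
  have hΩA : Ω = (A 0 + A 1) / d := by
    simp only [hA, Matrix.cons_val_zero, Matrix.cons_val_one]
    field_simp
    ring
  have hfield := (rotatesUniformly_iff hf (fun j => mul_ne_zero hne (hb j).ne')
    (fun j w => (hfu j).eta_le ((hη j).trans hε1) w) (fun j w τ => (half_pos hd).trans_le
      (le_re_separation hε1 hε2 (hη j) (hη (1 - j)) (hfu j) (hfu (1 - j)) w τ))).1 hrot
  have happ : ∀ j, IsProfile (approxProfile γ b d ε j) _ := fun j => isProfile_quarticProfile _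
  set N : Fin 2 → ℝ := fun j => derivNorm (fun τ => f j τ - approxProfile γ b d ε j τ) with hN
  set α : Fin 2 → ℝ := fun j => A j - approxSpeed γ b d ε j with hα
  have hN0 : ∀ j, 0 ≤ N j := fun j => derivNorm_nonneg _
  set V := N 0 + N 1 + |α 0| + |α 1| with hV
  have hV0 : 0 ≤ V := by have := hN0 0; have := hN0 1; positivity
  have hΩV : |Ω - (approxSpeed γ b d ε 0 + approxSpeed γ b d ε 1) / d| ≤ V / d := by
    have : Ω - (approxSpeed γ b d ε 0 + approxSpeed γ b d ε 1) / d = (α 0 + α 1) / d := by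
      rw [hΩA]; simp only [hα]; ring
    rw [this, abs_div, abs_of_pos hd]
    have := abs_add_le (α 0) (α 1)
    have := hN0 0
    have := hN0 1
    gcongr
    linarith
  have key : ∀ j, γ j ^ 2 / 8 * N j ^ 2 + α j ^ 2 / 2 ≤
      2 * (C₃ * |ε| * V + C₄ * |ε| ^ 5) ^ 2 + 2 * (C₃ * |ε|) ^ 2 * N j ^ 2 := by
    intro j
    refine ((hf j).sub (happ j)).sq_le_of_im_le (γ := γ j) (α := α j) fun w => ?_
    have h1 := H₁ j (f j) (approxProfile γ b d ε j) (f (1 - j)) (approxProfile γ b d ε (1 - j)) _ _ _ _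
      (hf j) (happ j) (hf (1 - j)) (happ (1 - j)) (hfu j) (huj j) (hfu (1 - j)) (huj (1 - j))
      (|ε| * β) (ε * b j) (ε * b (1 - j)) hε1 hε2 (hη j) (hη (1 - j)) Ω
      ((approxSpeed γ b d ε 0 + approxSpeed γ b d ε 1) / d) (A j) (approxSpeed γ b d ε j) hΩε (hSj j) w
    set F := reducedField (γ j) (γ (1 - j)) (ε * b j) (ε * b (1 - j)) d Ω (A j) (f j) (f (1 - j)) w with hF
    set F₁ := reducedField (γ j) (γ (1 - j)) (ε * b j) (ε * b (1 - j)) d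
      ((approxSpeed γ b d ε 0 + approxSpeed γ b d ε 1) / d) (approxSpeed γ b d ε j)
      (approxProfile γ b d ε j) (approxProfile γ b d ε (1 - j)) w with hF₁
    set y := ‖circleDeriv (fun τ => f j τ - approxProfile γ b d ε j τ) w‖ with hy
    have hFim : F.im = 0 := hfield j w
    have h2 : (γ j / 2 * circleDeriv (fun τ => f j τ - approxProfile γ b d ε j τ) w + (α j : ℂ) * w).im =
        (F - F₁ + (γ j / 2 * circleDeriv (fun τ => f j τ - approxProfile γ b d ε j τ) w +
          (A j - approxSpeed γ b d ε j) * w)).im + F₁.im := by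
      simp only [hα, Complex.add_im, Complex.sub_im, hFim, Complex.ofReal_sub]
      ring
    have h3 := (Complex.abs_im_le_norm _).trans h1
    have h4 := (abs_add_le _ _).trans (add_le_add h3 (hrj j w))
    rw [← h2] at h4
    refine h4.trans ?_
    have hC₂j : C₂ j ≤ C₄ := by
      have := hC₂ 0; have := hC₂ 1
      fin_cases j <;> simp only [Fin.zero_eta, Fin.mk_one] <;> linarith
    have hC₁j : C₁ j ≤ C₁ 0 + C₁ 1 := by
      have := hC₁ 0; have := hC₁ 1
      fin_cases j <;> simp only [Fin.zero_eta, Fin.mk_one] <;> linarith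
    have hy0 : 0 ≤ y := norm_nonneg _
    have hsum : |Ω - (approxSpeed γ b d ε 0 + approxSpeed γ b d ε 1) / d| + |A j - approxSpeed γ b d ε j| +
        N j + N (1 - j) + y ≤ (2 + 2 / d) * (V + y) := by
      have q1 : |A j - approxSpeed γ b d ε j| + (N j + N (1 - j)) ≤ V := by
        have b0 := abs_nonneg (α 0)
        have b1 := abs_nonneg (α 1)
        have : |A j - approxSpeed γ b d ε j| = |α j| := rfl
        rw [this]
        fin_cases j
        · simp only [Fin.zero_eta, sub_zero]; linarith
        · simp only [Fin.mk_one, sub_self]; linarith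
      have q2 : V / d = 1 / d * V := by ring
      have q3 : 0 ≤ 1 / d * V := by positivity
      have q4 : 0 ≤ 1 / d * y := by positivity
      have q5 : (2 + 2 / d) * (V + y) = 2 * V + 2 * y + 2 * (1 / d * V) + 2 * (1 / d * y) := by ring
      rw [q5]
      linarith
    calc C₁ j * (|ε| * β) * (|Ω - (approxSpeed γ b d ε 0 + approxSpeed γ b d ε 1) / d| +
          |A j - approxSpeed γ b d ε j| + N j + N (1 - j) + y) + C₂ j * |ε| ^ 5
        ≤ (C₁ 0 + C₁ 1) * (|ε| * β) * ((2 + 2 / d) * (V + y)) + C₄ * |ε| ^ 5 := by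
          have := hC₁ 0
          have := hC₁ 1
          exact add_le_add (mul_le_mul (mul_le_mul_of_nonneg_right hC₁j (by positivity)) hsum
            (add_nonneg (add_nonneg (add_nonneg (add_nonneg (abs_nonneg _) (abs_nonneg _)) (hN0 j))
              (hN0 (1 - j))) hy0) (by positivity)) (mul_le_mul_of_nonneg_right hC₂j (by positivity))
      _ = C₃ * |ε| * V + C₄ * |ε| ^ 5 + C₃ * |ε| * y := by rw [hC₃]; ring
  have S_le : m * (N 0 ^ 2 + N 1 ^ 2 + α 0 ^ 2 + α 1 ^ 2) ≤
      2 * (2 * (C₃ * |ε| * V + C₄ * |ε| ^ 5) ^ 2) + 2 * (C₃ * |ε|) ^ 2 * (N 0 ^ 2 + N 1 ^ 2) := by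
    have k0 := key 0
    have k1 := key 1
    have m0 := mul_le_mul_of_nonneg_right (hm.1 0) (sq_nonneg (N 0))
    have m1 := mul_le_mul_of_nonneg_right (hm.1 1) (sq_nonneg (N 1))
    have m2 := mul_le_mul_of_nonneg_right hm.2 (sq_nonneg (α 0))
    have m3 := mul_le_mul_of_nonneg_right hm.2 (sq_nonneg (α 1))
    linarith
  set S := N 0 ^ 2 + N 1 ^ 2 + α 0 ^ 2 + α 1 ^ 2 with hS'
  have V_le : V ^ 2 ≤ 4 * S := by
    rw [hS', ← sq_abs (α 0), ← sq_abs (α 1)]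
    exact sq_add_four_le _ _ _ _
  have hsq : (C₃ * |ε| * V + C₄ * |ε| ^ 5) ^ 2 ≤ 2 * (C₃ * |ε|) ^ 2 * V ^ 2 + 2 * C₄ ^ 2 * (|ε| ^ 5) ^ 2 := by
    have := add_sq_le (a := C₃ * |ε| * V) (b := C₄ * |ε| ^ 5)
    rw [mul_pow _ V, mul_pow C₄] at this
    linarith
  have S_le' : S ≤ 16 * C₄ ^ 2 / m * (|ε| ^ 5) ^ 2 := by
    have h1 : N 0 ^ 2 + N 1 ^ 2 ≤ S := by
      have := sq_nonneg (α 0); have := sq_nonneg (α 1); linarith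
    have hS0' : 0 ≤ S := by positivity
    have h2 : (C₃ * |ε|) ^ 2 * V ^ 2 ≤ (C₃ * |ε|) ^ 2 * (4 * S) :=
      mul_le_mul_of_nonneg_left V_le (sq_nonneg _)
    have h3 : (C₃ * |ε|) ^ 2 * (N 0 ^ 2 + N 1 ^ 2) ≤ (C₃ * |ε|) ^ 2 * S :=
      mul_le_mul_of_nonneg_left h1 (sq_nonneg _)
    have h4 : 34 * C₃ ^ 2 * |ε| ^ 2 * S ≤ m / 2 * S := mul_le_mul_of_nonneg_right hε3 hS0'
    have h5 : m * S ≤ 16 * C₄ ^ 2 * (|ε| ^ 5) ^ 2 := by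
      rw [mul_pow] at hsq h2 h3 S_le
      linarith
    rw [div_mul_eq_mul_div, le_div_iff₀ hm0, mul_comm]
    exact h5
  have hfin : ∀ t : ℝ, t ^ 2 ≤ S → |t| ≤ C₅ * |ε| ^ 5 := by
    intro t ht
    have h1 : |t| ≤ √(16 * C₄ ^ 2 / m * (|ε| ^ 5) ^ 2) := Real.abs_le_sqrt (ht.trans S_le')
    rw [Real.sqrt_mul (by positivity), Real.sqrt_sq (by positivity)] at h1
    have h2 : 0 ≤ √(16 * C₄ ^ 2 / m) * |ε| ^ 5 := by positivity
    rw [hC₅]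
    linarith
  intro j
  have s0 := sq_nonneg (N 0)
  have s1 := sq_nonneg (N 1)
  have s2 := sq_nonneg (α 0)
  have s3 := sq_nonneg (α 1)
  refine ⟨(le_abs_self _).trans (hfin (N j) ?_), hfin (α j) ?_⟩ <;>
    fin_cases j <;> simp only [Fin.zero_eta, Fin.mk_one] <;> linarith

/-! ### The expansions of a branch -/

theorem MemX.exists_isProfile {α : ℝ≥0} (hα : 0 < α) {f : Circle → ℂ} (hf : MemX α f)
    (h1 : holderNorm α f < 1) : ∃ a, IsProfile f a ∧ UnitBounded f := by
  obtain ⟨a, ha⟩ := hf.series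
  have hH : eHolderNorm α (circleDeriv f) < ∞ :=
    lt_of_le_of_lt le_add_self hf.norm_lt_top
  have hc : Continuous (circleDeriv f) := by
    have : MemHolder α (circleDeriv f) := eHolderNorm_ne_top.1 hH.ne
    obtain ⟨C, hC⟩ := this
    exact hC.continuous hα
  refine ⟨a, ⟨hf.differentiable, hc, ha⟩, fun w => ?_, fun w => ?_⟩
  · have h2 : ‖f w‖ₑ ≤ 1 := (le_iSup (fun w => ‖f w‖ₑ) w).trans
      ((le_self_add.trans le_self_add).trans h1.le)
    rw [← toReal_enorm]
    exact ENNReal.toReal_le_of_le_ofReal zero_le_one (by simpa using h2)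
  · have h2 : ‖circleDeriv f w‖ₑ ≤ 1 := (le_iSup (fun w => ‖circleDeriv f w‖ₑ) w).trans
      ((le_add_self.trans le_self_add).trans h1.le)
    rw [← toReal_enorm]
    exact ENNReal.toReal_le_of_le_ofReal zero_le_one (by simpa using h2)

variable {γ b : Fin 2 → ℝ} {d : ℝ} {α : ℝ≥0} {ε₀ : ℝ} {Ω Z : ℝ → ℝ} {f : ℝ → Fin 2 → Circle → ℂ}

/-- The rigidity estimate is applied at each `ε ≠ 0` of the branch; the bound in `derivNorm` becomes
uniform at the cost of a factor `2π`. -/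
theorem IsCorotatingBranch.exists_le (hα : 0 < α) (hγ : ∀ j, γ j ≠ 0) (hb : ∀ j, 0 < b j) (hd : 0 < d)
    (hε₀ : 0 < ε₀) (h : IsCorotatingBranch α γ b d ε₀ Ω Z f) :
    ∃ C : ℝ, 0 ≤ C ∧ ∀ᶠ ε in 𝓝 (0 : ℝ), ε ≠ 0 → ∀ j,
      (∀ w, ‖f ε j w - approxProfile γ b d ε j w‖ ≤ C * |ε| ^ 5) ∧
      |![Ω ε * Z ε, Ω ε * (d - Z ε)] j - approxSpeed γ b d ε j| ≤ C * |ε| ^ 5 := by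
  obtain ⟨C, hC0, hC⟩ := exists_dist_approx_le hγ hb hd
  refine ⟨2 * Real.pi * C, by positivity, ?_⟩
  filter_upwards [hC, Icc_mem_nhds (neg_lt_zero.2 hε₀) hε₀] with ε h1 hε hne j
  choose a ha hu using fun j => ((h.contDiff_f j).1 ε hε).exists_isProfile hα (h.norm_f_lt ε hε j)
  obtain ⟨h2, h3⟩ := h1 hne (Ω ε) (Z ε) (f ε) a ha hu (h.rotates ε hε hne) j
  have hπ : 1 ≤ 2 * Real.pi := by linarith [Real.two_le_pi]
  refine ⟨fun w => ?_, h3.trans ?_⟩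
  · refine (((ha j).sub (isProfile_quarticProfile _)).norm_le_derivNorm w).trans ?_
    rw [mul_assoc (2 * Real.pi)]
    exact mul_le_mul_of_nonneg_left h2 (by positivity)
  · rw [mul_assoc]
    exact le_mul_of_one_le_left (by positivity) hπ

theorem conformalMap_approxProfile (hd : d ≠ 0) (ε : ℝ) (j : Fin 2) (w : Circle) :
    conformalMap b ε (approxProfile γ b d ε) j w =
      conformalExpansion (γ (1 - j) / γ j) (ε * b j / d) w := by
  rw [← add_eta_mul_quarticProfile_approxCoeff hd, conformalMap, approxProfile]
  push_cast
  rfl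

/-- The profile enters `conformalMap` multiplied by `ε * b j`, so its error `O(ε⁵)` becomes `O(ε⁶)`.
-/
theorem IsCorotatingBranch.conformalMap_sub_le (hα : 0 < α) (hγ : ∀ j, γ j ≠ 0) (hb : ∀ j, 0 < b j)
    (hd : 0 < d) (hε₀ : 0 < ε₀) (h : IsCorotatingBranch α γ b d ε₀ Ω Z f) (j : Fin 2) {c : ℝ}
    (hc : 0 < c) : ∀ᶠ ε in 𝓝 (0 : ℝ), ∀ w : Circle,
      ‖conformalMap b ε (f ε) j w - conformalExpansion (γ (1 - j) / γ j) (ε * b j / d) w‖ ≤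
        c * |ε| ^ 5 := by
  obtain ⟨C, hC0, hC⟩ := h.exists_le hα hγ hb hd hε₀
  have h1 : ∀ᶠ ε : ℝ in 𝓝 0, |ε| * b j * C < c := by
    have : Continuous fun ε : ℝ => |ε| * b j * C := by fun_prop
    have h2 := this.tendsto 0
    simp only [abs_zero, zero_mul] at h2
    exact h2.eventually (gt_mem_nhds hc)
  filter_upwards [hC, h1] with ε h2 h3 w
  rcases eq_or_ne ε 0 with rfl | hne
  · simp [conformalMap, conformalExpansion]
  · have h4 := (h2 hne j).1 w
    rw [← conformalMap_approxProfile hd.ne', conformalMap, conformalMap]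
    have e : (w : ℂ) + ε * b j * f ε j w - (w + ε * b j * approxProfile γ b d ε j w) =
        ((ε * b j : ℝ) : ℂ) * (f ε j w - approxProfile γ b d ε j w) := by push_cast; ring
    rw [e, norm_mul, Complex.norm_real, Real.norm_eq_abs, abs_mul, abs_of_pos (hb j)]
    calc |ε| * b j * ‖f ε j w - approxProfile γ b d ε j w‖ ≤ |ε| * b j * (C * |ε| ^ 5) :=
          mul_le_mul_of_nonneg_left h4 (mul_nonneg (abs_nonneg _) (hb j).le)
      _ = |ε| * b j * C * |ε| ^ 5 := by ring
      _ ≤ c * |ε| ^ 5 := mul_le_mul_of_nonneg_right h3.le (by positivity)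

/-- Each of the fractions `γ 1 ^ 2 / γ 0` and `γ 0 ^ 2 / γ 1` arises from both corrections with
opposite signs and cancels in the sum. -/
theorem approxSpeed_sum_div (hγ : ∀ j, γ j ≠ 0) (hd : d ≠ 0) (ε : ℝ) :
    (approxSpeed γ b d ε 0 + approxSpeed γ b d ε 1) / d = (γ 0 + γ 1) / (2 * d ^ 2) +
      ε ^ 4 / (2 * d ^ 6) * (γ 0 * b 1 ^ 4 + γ 1 * b 0 ^ 4) := by
  have h0 := hγ 0
  have h1 := hγ 1
  simp only [approxSpeed, approxCorrection, sub_zero, sub_self]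
  field_simp
  ring

theorem IsCorotatingBranch.isBigO_speed (hα : 0 < α) (hγ : ∀ j, γ j ≠ 0) (hγs : γ 0 + γ 1 ≠ 0)
    (hb : ∀ j, 0 < b j) (hd : 0 < d) (hε₀ : 0 < ε₀) (h : IsCorotatingBranch α γ b d ε₀ Ω Z f)
    (j : Fin 2) : (fun ε => ![Ω ε * Z ε, Ω ε * (d - Z ε)] j - approxSpeed γ b d ε j) =O[𝓝 0]
      fun ε : ℝ => ε ^ 5 := by
  obtain ⟨C, hC0, hC⟩ := h.exists_le hα hγ hb hd hε₀
  refine IsBigO.of_bound C ?_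
  filter_upwards [hC] with ε h1
  rcases eq_or_ne ε 0 with rfl | hne
  -- The rotation condition is not imposed at `ε = 0`; there the prescribed initial values make the
  -- error vanish.
  · have : ![Ω 0 * Z 0, Ω 0 * (d - Z 0)] j - approxSpeed γ b d 0 j = 0 := by
      rw [h.Ω_zero, h.Z_zero]
      fin_cases j
      · simp [approxSpeed, approxCorrection]
        field_simp
        ring
      · simp [approxSpeed, approxCorrection]
        field_simp
        ring
    rw [this]
    simp
  · rw [Real.norm_eq_abs, Real.norm_eq_abs, abs_pow]
    exact (h1 hne j).2

theorem IsCorotatingBranch.isBigO_Ω (hα : 0 < α) (hγ : ∀ j, γ j ≠ 0) (hγs : γ 0 + γ 1 ≠ 0)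
    (hb : ∀ j, 0 < b j) (hd : 0 < d) (hε₀ : 0 < ε₀) (h : IsCorotatingBranch α γ b d ε₀ Ω Z f) :
    (fun ε : ℝ => Ω ε - ((γ 0 + γ 1) / (2 * d ^ 2) +
          ε ^ 4 / (2 * d ^ 6) * (γ 0 * b 1 ^ 4 + γ 1 * b 0 ^ 4))) =O[𝓝 0] fun ε : ℝ => ε ^ 5 := by
  have h1 := ((h.isBigO_speed hα hγ hγs hb hd hε₀ 0).add
    (h.isBigO_speed hα hγ hγs hb hd hε₀ 1)).const_mul_left d⁻¹
  refine h1.congr_left fun ε => ?_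
  rw [← approxSpeed_sum_div hγ hd.ne']
  simp only [Matrix.cons_val_zero, Matrix.cons_val_one]
  field_simp
  ring

/-- `Z` is recovered as `Ω * Z` divided by `Ω`, which stays away from zero because `γ 0 + γ 1 ≠ 0`.
The product of the claimed expansions of `Ω` and `Z` agrees with `approxSpeed` up to an exact
multiple of `ε ^ 8`. -/
theorem IsCorotatingBranch.isBigO_Z (hα : 0 < α) (hγ : ∀ j, γ j ≠ 0) (hγs : γ 0 + γ 1 ≠ 0)
    (hb : ∀ j, 0 < b j) (hd : 0 < d) (hε₀ : 0 < ε₀) (h : IsCorotatingBranch α γ b d ε₀ Ω Z f) :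
    (fun ε : ℝ => Z ε - (γ 1 * d / (γ 0 + γ 1) +
          ε ^ 4 / (d ^ 3 * (γ 0 + γ 1) ^ 2) *
            (γ 1 ^ 3 / γ 0 * b 0 ^ 4 - γ 0 ^ 3 / γ 1 * b 1 ^ 4))) =O[𝓝 0] fun ε : ℝ => ε ^ 5 := by
  have hA := h.isBigO_speed hα hγ hγs hb hd hε₀ 0
  have hΩ := h.isBigO_Ω hα hγ hγs hb hd hε₀
  set ω : ℝ → ℝ := fun ε => (γ 0 + γ 1) / (2 * d ^ 2) +
          ε ^ 4 / (2 * d ^ 6) * (γ 0 * b 1 ^ 4 + γ 1 * b 0 ^ 4) with hω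
  set z : ℝ → ℝ := fun ε => γ 1 * d / (γ 0 + γ 1) + ε ^ 4 / (d ^ 3 * (γ 0 + γ 1) ^ 2) *
            (γ 1 ^ 3 / γ 0 * b 0 ^ 4 - γ 0 ^ 3 / γ 1 * b 1 ^ 4) with hz
  have hΩ' : (fun ε => Ω ε - ω ε) =O[𝓝 0] fun ε : ℝ => ε ^ 5 := hΩ
  have hzc : Continuous z := by simp only [hz]; fun_prop
  have hωc : Continuous ω := by simp only [hω]; fun_prop
  have h5 : Tendsto (fun ε : ℝ => ε ^ 5) (𝓝 0) (𝓝 0) := by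
    have : Continuous fun ε : ℝ => ε ^ 5 := by fun_prop
    simpa using this.tendsto 0
  have hΩt : Tendsto Ω (𝓝 0) (𝓝 (ω 0)) := by
    have h1 := (hΩ'.trans_tendsto h5).add (hωc.tendsto 0)
    simpa using h1
  have hω0 : ω 0 ≠ 0 := by
    have : ω 0 = (γ 0 + γ 1) / (2 * d ^ 2) := by simp [hω]
    rw [this]
    exact div_ne_zero hγs (by positivity)
  have hinv : (fun ε => (Ω ε)⁻¹) =O[𝓝 0] fun _ => (1 : ℝ) := (hΩt.inv₀ hω0).isBigO_one ℝ
  have hz1 : z =O[𝓝 0] fun _ => (1 : ℝ) := (hzc.tendsto 0).isBigO_one ℝ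
  have h8 : (fun ε => approxSpeed γ b d ε 0 - z ε * ω ε) =O[𝓝 0] fun ε : ℝ => ε ^ 5 := by
    have e : ∀ ε, approxSpeed γ b d ε 0 - z ε * ω ε =
        -(1 / (d ^ 3 * (γ 0 + γ 1) ^ 2) * (γ 1 ^ 3 / γ 0 * b 0 ^ 4 - γ 0 ^ 3 / γ 1 * b 1 ^ 4)) *
          (1 / (2 * d ^ 6) * (γ 0 * b 1 ^ 4 + γ 1 * b 0 ^ 4)) * ε ^ 8 := by
      intro ε
      have h0 := hγ 0
      have h1 := hγ 1
      have hd' := hd.ne'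
      simp only [approxSpeed, approxCorrection, sub_zero, hz, hω]
      field_simp
      ring
    simp only [e]
    refine IsBigO.const_mul_left ?_ _
    exact (isLittleO_pow_pow (by norm_num : 5 < 8)).isBigO
  have h9 := ((hA.add h8).sub ((hz1.mul hΩ').congr_right fun ε => one_mul _)).mul hinv
  refine (h9.congr_right fun ε => mul_one _).congr' ?_ EventuallyEq.rfl
  filter_upwards [hΩt.eventually_ne hω0] with ε hε
  change (Ω ε * Z ε - approxSpeed γ b d ε 0 + (approxSpeed γ b d ε 0 - z ε * ω ε) -
    z ε * (Ω ε - ω ε)) * (Ω ε)⁻¹ = Z ε - z ε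
  field_simp
  ring

/-! ### Summable families as coordinates -/

/-- The space of absolutely summable real families. -/
abbrev Ell1 (ι : Type*) : Type _ := lp (fun _ : ι => ℝ) 1

/-- The standard unit vectors. -/
noncomputable def Ell1.basis {ι : Type*} [DecidableEq ι] (i : ι) : Ell1 ι := lp.single 1 i (1 : ℝ)

theorem Ell1.hasSum_abs {ι : Type*} (x : Ell1 ι) : HasSum (fun i => |x i|) ‖x‖ := by
  have := lp.hasSum_norm (by norm_num) x
  simpa using this

section Lift

variable {ι F G : Type*} [NormedAddCommGroup F] [NormedSpace ℝ F]
  [NormedAddCommGroup G] [NormedSpace ℝ G]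

theorem Ell1.norm_tsum_smul_le (x : Ell1 ι) {y : ι → F} {C : ℝ} (hC : ∀ i, ‖y i‖ ≤ C) :
    ‖∑' i, x i • y i‖ ≤ C * ‖x‖ := by
  have h1 : HasSum (fun i => C * |x i|) (C * ‖x‖) := (Ell1.hasSum_abs x).mul_left C
  refine tsum_of_norm_bounded h1 fun i => ?_
  rw [norm_smul, Real.norm_eq_abs, mul_comm]
  exact mul_le_mul_of_nonneg_right (hC i) (abs_nonneg _)

theorem Ell1.hasSum_basis [DecidableEq ι] (x : Ell1 ι) : HasSum (fun i => x i • Ell1.basis i) x := by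
  have h1 := lp.hasSum_single (p := 1) ENNReal.one_ne_top x
  have e : ∀ i, x i • (Ell1.basis i : Ell1 ι) = lp.single 1 i (x i) := fun i => by
    rw [Ell1.basis, ← lp.single_smul, smul_eq_mul, mul_one]
  simpa only [e] using h1

theorem Ell1.ext_clm [DecidableEq ι] {L M : Ell1 ι →L[ℝ] F}
    (hLM : ∀ i, L (Ell1.basis i) = M (Ell1.basis i)) : L = M := by
  ext x
  have h1 := (Ell1.hasSum_basis x).mapL L
  have h2 := (Ell1.hasSum_basis x).mapL M
  simp only [map_smul, hLM] at h1 h2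
  exact h1.unique h2

variable [CompleteSpace F] [CompleteSpace G]

theorem Ell1.summable_smul (x : Ell1 ι) {y : ι → F} (h : ∃ C : ℝ, ∀ i, ‖y i‖ ≤ C) :
    Summable fun i => x i • y i := by
  obtain ⟨C, hC⟩ := h
  refine Summable.of_norm_bounded ((Ell1.hasSum_abs x).summable.mul_right C) fun i => ?_
  rw [norm_smul, Real.norm_eq_abs]
  exact mul_le_mul_of_nonneg_left (hC i) (abs_nonneg _)

/-- The continuous linear map `x ↦ ∑ x_i y_i` of a bounded family `y`. -/
noncomputable def l1Lift (y : ι → F) (h : ∃ C : ℝ, ∀ i, ‖y i‖ ≤ C) : Ell1 ι →L[ℝ] F :=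
  LinearMap.mkContinuous
    { toFun := fun x => ∑' i, x i • y i
      map_add' := fun x x' => by
        refine Eq.trans (tsum_congr fun i => ?_)
          ((Ell1.summable_smul x h).tsum_add (Ell1.summable_smul x' h))
        exact add_smul _ _ _
      map_smul' := fun c x => by
        refine Eq.trans (tsum_congr fun i => ?_) ((Ell1.summable_smul x h).tsum_const_smul c)
        exact mul_smul _ _ _ } h.choose
    fun x => Ell1.norm_tsum_smul_le x h.choose_spec

variable {y : ι → F} (h : ∃ C : ℝ, ∀ i, ‖y i‖ ≤ C)

theorem hasSum_l1Lift (x : Ell1 ι) : HasSum (fun i => x i • y i) (l1Lift y h x) :=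
  (Ell1.summable_smul x h).hasSum

theorem norm_l1Lift_apply_le {C : ℝ} (hC : ∀ i, ‖y i‖ ≤ C) (x : Ell1 ι) : ‖l1Lift y h x‖ ≤ C * ‖x‖ :=
  Ell1.norm_tsum_smul_le x hC

theorem norm_l1Lift_le {C : ℝ} (hC0 : 0 ≤ C) (hC : ∀ i, ‖y i‖ ≤ C) : ‖l1Lift y h‖ ≤ C :=
  ContinuousLinearMap.opNorm_le_bound _ hC0 (norm_l1Lift_apply_le h hC)

theorem l1Lift_basis [DecidableEq ι] (i : ι) : l1Lift y h (Ell1.basis i) = y i := by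
  have h1 := hasSum_l1Lift h (Ell1.basis i)
  have h2 : HasSum (fun k => (Ell1.basis i : Ell1 ι) k • y k) ((Ell1.basis i : Ell1 ι) i • y i) :=
    hasSum_single i fun k hk => by
      rw [Ell1.basis, lp.single_apply_ne _ _ _ hk, zero_smul]
  rw [h1.unique h2, Ell1.basis, lp.single_apply_self, one_smul]

theorem Ell1.norm_basis [DecidableEq ι] (i : ι) : ‖(Ell1.basis i : Ell1 ι)‖ = 1 := by
  rw [Ell1.basis, lp.norm_single (by norm_num), norm_one]

theorem map_l1Lift (L : F →L[ℝ] G) {z : ι → G} (hz : ∃ C : ℝ, ∀ i, ‖z i‖ ≤ C)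
    (hL : ∀ i, L (y i) = z i) (x : Ell1 ι) : L (l1Lift y h x) = l1Lift z hz x := by
  have h1 := (hasSum_l1Lift h x).mapL L
  simp only [map_smul, hL] at h1
  exact h1.unique (hasSum_l1Lift hz x)

end Lift

/-! ### Profiles and their difference quotients in a Banach algebra -/

section Series

variable {B : Type*} [NormedRing B] [NormedAlgebra ℝ B]

theorem norm_pow_le_two_pow {B : Type*} [NormedRing B] {S : B} (hS : ‖S‖ ≤ 2) {n : ℕ} (hn : 0 < n) : ‖S ^ n‖ ≤ 2 ^ n :=
  (norm_pow_le' S hn).trans (pow_le_pow_left₀ (norm_nonneg _) hS n)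

/-- The coefficient `1 / ((n + 1) 2 ^ (n + 2))`. -/
noncomputable def profileWeight (n : ℕ) : ℝ := 1 / ((n + 1) * 2 ^ (n + 2))

theorem profileWeight_pos (n : ℕ) : 0 < profileWeight n := by
  rw [profileWeight]; positivity

/-- The powers that represent a profile. -/
noncomputable def seriesTerm (S : B) : ℕ → B
  -- The coordinate of index `0` does not influence the profile; it is reserved for the speed of the
  -- patch, see `offset`.
  | 0 => 0
  | n + 1 => profileWeight n • S ^ (n + 1)

/-- The powers that represent the derivative of a profile. -/
noncomputable def derivSeriesTerm (S : B) : ℕ → B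
  | 0 => 0
  | n + 1 => (-(1 / 2 ^ (n + 2)) : ℝ) • S ^ (n + 2)

/-- The products that represent the difference quotient of a profile. -/
noncomputable def quotSeriesTerm (S S' : B) : ℕ → B
  | 0 => 0
  | n + 1 => (-profileWeight n) • ∑ k ∈ Finset.range (n + 1), S ^ (k + 1) * S' ^ (n + 1 - k)

/-- The argument lives in a Banach algebra because the series is evaluated both at the number `conj
w` and at shift operators. One of these has norm up to `2`, and the powers of two in `profileWeight`
compensate for that. -/
theorem norm_seriesTerm_le {S : B} (hS : ‖S‖ ≤ 2) (n : ℕ) : ‖seriesTerm S n‖ ≤ 1 := by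
  rcases n with _ | n
  · simp [seriesTerm]
  · rw [seriesTerm, norm_smul, Real.norm_eq_abs, abs_of_pos (profileWeight_pos n), profileWeight]
    have h := norm_pow_le_two_pow hS n.succ_pos
    rw [div_mul_eq_mul_div, one_mul, div_le_one (by positivity)]
    refine h.trans ?_
    rw [Nat.succ_eq_add_one, pow_succ 2 (n + 1)]
    have h2 : (0 : ℝ) < 2 ^ (n + 1) := by positivity
    have h3 : (0 : ℝ) ≤ n := n.cast_nonneg
    nlinarith

theorem norm_derivSeriesTerm_le {S : B} (hS : ‖S‖ ≤ 2) (n : ℕ) : ‖derivSeriesTerm S n‖ ≤ 1 := by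
  rcases n with _ | n
  · simp [derivSeriesTerm]
  · rw [derivSeriesTerm, norm_smul, Real.norm_eq_abs, abs_neg, abs_of_pos (by positivity),
      div_mul_eq_mul_div, one_mul, div_le_one (by positivity)]
    exact norm_pow_le_two_pow hS (by omega)

/-- There are `n + 1` products, each of norm at most `2 ^ (n + 1)` because powers of `S` cost
nothing; `profileWeight` accounts for both factors. -/
theorem norm_quotSeriesTerm_le {S S' : B} (hS : ‖S‖ ≤ 1) (hS' : ‖S'‖ ≤ 2) (n : ℕ) :
    ‖quotSeriesTerm S S' n‖ ≤ 1 := by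
  rcases n with _ | n
  · simp [quotSeriesTerm]
  · rw [quotSeriesTerm, norm_smul, Real.norm_eq_abs, abs_neg, abs_of_pos (profileWeight_pos n),
      profileWeight]
    have h : ‖∑ k ∈ Finset.range (n + 1), S ^ (k + 1) * S' ^ (n + 1 - k)‖ ≤ (n + 1) * 2 ^ (n + 1) := by
      refine (norm_sum_le_of_le (f := fun k => S ^ (k + 1) * S' ^ (n + 1 - k)) _
        (n := fun _ => (2 : ℝ) ^ (n + 1)) fun k hk => ?_).trans ?_
      · rw [Finset.mem_range] at hk
        refine (norm_mul_le _ _).trans ?_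
        calc ‖S ^ (k + 1)‖ * ‖S' ^ (n + 1 - k)‖ ≤ 1 * 2 ^ (n + 1) := by
              refine mul_le_mul ((norm_pow_le' S k.succ_pos).trans (pow_le_one₀ (norm_nonneg _) hS))
                ((norm_pow_le_two_pow hS' (by omega)).trans ?_) (norm_nonneg _) zero_le_one
              exact pow_le_pow_right₀ one_le_two (Nat.sub_le _ _)
          _ = 2 ^ (n + 1) := one_mul _
      · simp
    rw [div_mul_eq_mul_div, one_mul, div_le_one (by positivity)]
    refine h.trans (mul_le_mul_of_nonneg_left ?_ (by positivity))
    exact pow_le_pow_right₀ one_le_two (by omega)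

variable [CompleteSpace B]

/-- The profile with coordinates `u`, evaluated at `S⁻¹`. -/
noncomputable def series (S : B) (hS : ‖S‖ ≤ 2) : Ell1 ℕ →L[ℝ] B :=
  l1Lift (seriesTerm S) ⟨1, norm_seriesTerm_le hS⟩

/-- The derivative of the profile with coordinates `u`, evaluated at `S⁻¹`. -/
noncomputable def derivSeries (S : B) (hS : ‖S‖ ≤ 2) : Ell1 ℕ →L[ℝ] B :=
  l1Lift (derivSeriesTerm S) ⟨1, norm_derivSeriesTerm_le hS⟩

/-- The difference quotient of the profile with coordinates `u`, between `S⁻¹` and `S'⁻¹`. -/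
noncomputable def quotSeries (S S' : B) (hS : ‖S‖ ≤ 1) (hS' : ‖S'‖ ≤ 2) : Ell1 ℕ →L[ℝ] B :=
  l1Lift (quotSeriesTerm S S') ⟨1, norm_quotSeriesTerm_le hS hS'⟩

end Series

/-! ### Eigenfunctionals -/

section Eigen

variable {V : Type*} [NormedAddCommGroup V] [NormedSpace ℝ V]

/-- `χ` is an eigenvector of the transpose of `M`, with eigenvalue `c`. -/
def Eigen (χ : V →L[ℝ] ℂ) (M : V →L[ℝ] V) (c : ℂ) : Prop := ∀ x, χ (M x) = c * χ x

variable {χ : V →L[ℝ] ℂ} {M N : V →L[ℝ] V} {c c' : ℂ}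

/-- Eigenfunctionals transport algebraic expressions in operators to the same expressions in their
eigenvalues. With point evaluation as `χ`, the boundary integrand is recovered from an operator, and
no product on the coefficients themselves is needed. -/
theorem Eigen.one : Eigen χ 1 1 := fun x => by simp

theorem Eigen.add (hM : Eigen χ M c) (hN : Eigen χ N c') : Eigen χ (M + N) (c + c') := fun x => by
  rw [add_apply, map_add, hM, hN, add_mul]

theorem Eigen.sub (hM : Eigen χ M c) (hN : Eigen χ N c') : Eigen χ (M - N) (c - c') := fun x => by
  rw [sub_apply, map_sub, hM, hN, sub_mul]

theorem Eigen.mul (hM : Eigen χ M c) (hN : Eigen χ N c') : Eigen χ (M * N) (c * c') := fun x => by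
  rw [mul_apply_eq_comp, hM, hN, mul_assoc]

theorem Eigen.smul (r : ℝ) (hM : Eigen χ M c) : Eigen χ (r • M) (r * c) := fun x => by
  rw [smul_apply, map_smul, hM, Complex.real_smul, mul_assoc]

theorem Eigen.real_smul (r : ℝ) (hM : Eigen χ M c) : Eigen χ (r • M) (r • c) := by
  rw [Complex.real_smul]
  exact hM.smul r

theorem Eigen.zero : Eigen χ 0 0 := fun x => by simp

theorem Eigen.pow (hM : Eigen χ M c) (n : ℕ) : Eigen χ (M ^ n) (c ^ n) := by
  induction n with
  | zero => simpa using Eigen.one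
  | succ n ih => rw [pow_succ, pow_succ]; exact ih.mul hM

theorem Eigen.sum {ι : Type*} (s : Finset ι) {M : ι → V →L[ℝ] V} {c : ι → ℂ}
    (h : ∀ i, Eigen χ (M i) (c i)) : Eigen χ (∑ i ∈ s, M i) (∑ i ∈ s, c i) := fun x => by
  rw [sum_apply, map_sum, Finset.sum_mul]
  exact Finset.sum_congr rfl fun i _ => h i x

/-- The eigenvalue cannot vanish, since `χ ∘ M = c χ`, `M` is onto and `χ ≠ 0`. -/
theorem Eigen.inverse (hM : Eigen χ M c) (hu : IsUnit M) (hχ : χ ≠ 0) :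
    Eigen χ (Ring.inverse M) c⁻¹ := by
  have h1 : ∀ x, c * χ (Ring.inverse M x) = χ x := fun x => by
    rw [← hM, ← mul_apply_eq_comp, Ring.mul_inverse_cancel _ hu]
    rfl
  have hc : c ≠ 0 := fun hc => hχ (by ext x; rw [← h1, hc, zero_mul]; rfl)
  intro x
  rw [← h1 x, inv_mul_cancel_left₀ hc]

variable [CompleteSpace V]

theorem Eigen.l1Lift {ι : Type*} {M : ι → V →L[ℝ] V} {c : ι → ℂ} (hM : ∃ C : ℝ, ∀ i, ‖M i‖ ≤ C)
    (hc : ∃ C : ℝ, ∀ i, ‖c i‖ ≤ C) (h : ∀ i, Eigen χ (M i) (c i)) (u : Ell1 ι) :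
    Eigen χ (l1Lift M hM u) (VortexPair.l1Lift c hc u) := fun x => by
  have h1 := ((hasSum_l1Lift hM u).mapL (ContinuousLinearMap.apply ℝ V x)).mapL χ
  have h2 := (hasSum_l1Lift hc u).mul_right (χ x)
  simp only [map_smul, ContinuousLinearMap.apply_apply, h _ x] at h1
  refine h1.unique ((hasSum_congr_of_forall fun i => ?_).2 h2)
  rw [smul_mul_assoc]

theorem Eigen.series (hM : Eigen χ M c) (h : ‖M‖ ≤ 2) (hc : ‖c‖ ≤ 2) (u : Ell1 ℕ) :
    Eigen χ (series M h u) (series c hc u) := by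
  refine Eigen.l1Lift _ _ (fun n => ?_) u
  rcases n with _ | n
  · exact Eigen.zero
  · exact (hM.pow _).real_smul _

theorem Eigen.derivSeries (hM : Eigen χ M c) (h : ‖M‖ ≤ 2) (hc : ‖c‖ ≤ 2) (u : Ell1 ℕ) :
    Eigen χ (derivSeries M h u) (derivSeries c hc u) := by
  refine Eigen.l1Lift _ _ (fun n => ?_) u
  rcases n with _ | n
  · exact Eigen.zero
  · exact (hM.pow _).real_smul _

theorem Eigen.quotSeries (hM : Eigen χ M c) (hN : Eigen χ N c') (h : ‖M‖ ≤ 1) (hc : ‖c‖ ≤ 1)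
    (h' : ‖N‖ ≤ 2) (hc' : ‖c'‖ ≤ 2) (u : Ell1 ℕ) :
    Eigen χ (quotSeries M N h h' u) (quotSeries c c' hc hc' u) := by
  refine Eigen.l1Lift _ _ (fun n => ?_) u
  rcases n with _ | n
  · exact Eigen.zero
  · exact (Eigen.sum _ fun k => (hM.pow _).mul (hN.pow _)).real_smul _

end Eigen

/-! ### Shift operators on Laurent coefficients in two variables -/

/-- The weight `2 ^ |n|`. -/
noncomputable def weight (n : ℤ) : ℝ := 2 ^ n.natAbs

theorem weight_pos (n : ℤ) : 0 < weight n := by rw [weight]; positivity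

theorem one_le_weight (n : ℤ) : 1 ≤ weight n := one_le_pow₀ one_le_two

theorem weight_add_le (m n : ℤ) : weight (m + n) ≤ weight n * weight m := by
  rw [weight, weight, weight, ← pow_add]
  exact pow_le_pow_right₀ one_le_two (by omega)

/-- Multiplication by `τ ^ k * w ^ l` in weighted coefficients. -/
noncomputable def shift (k l : ℤ) : Ell1 (ℤ × ℤ) →L[ℝ] Ell1 (ℤ × ℤ) :=
  l1Lift (fun p => (weight (p.2 + l) / weight p.2) • Ell1.basis (p.1 + k, p.2 + l))
    ⟨weight l, fun p => by
      rw [norm_smul, Ell1.norm_basis, mul_one, Real.norm_eq_abs,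
        abs_of_pos (div_pos (weight_pos _) (weight_pos _)), div_le_iff₀ (weight_pos _)]
      exact weight_add_le _ _⟩

/-- Only the variable `w` is weighted: a shift in `τ` costs nothing, one by `l` in `w` costs `2 ^
|l|`. -/
theorem norm_shift_le (k l : ℤ) : ‖shift k l‖ ≤ weight l :=
  norm_l1Lift_le _ (weight_pos l).le fun p => by
      rw [norm_smul, Ell1.norm_basis, mul_one, Real.norm_eq_abs,
        abs_of_pos (div_pos (weight_pos _) (weight_pos _)), div_le_iff₀ (weight_pos _)]
      exact weight_add_le _ _

theorem shift_basis (k l : ℤ) (p : ℤ × ℤ) :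
    shift k l (Ell1.basis p) = (weight (p.2 + l) / weight p.2) • Ell1.basis (p.1 + k, p.2 + l) :=
  l1Lift_basis _ _

theorem shift_basis_zero (k l : ℤ) :
    shift k l (Ell1.basis (0, 0)) = weight l • Ell1.basis (k, l) := by
  rw [shift_basis]
  simp [weight]

theorem shift_mul_shift (k l m n : ℤ) : shift k l * shift m n = shift (k + m) (l + n) := by
  refine Ell1.ext_clm fun p => ?_
  rw [mul_apply_eq_comp, shift_basis, map_smul, shift_basis, shift_basis, smul_smul]
  have h1 := (weight_pos p.2).ne'
  have h2 := (weight_pos (p.2 + n)).ne'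
  simp only
  rw [show p.1 + m + k = p.1 + (k + m) by ring, show p.2 + n + l = p.2 + (l + n) by ring]
  congr 1
  field_simp

theorem shift_zero_zero : shift 0 0 = 1 := by
  refine Ell1.ext_clm fun p => ?_
  rw [shift_basis, add_zero, add_zero, div_self (weight_pos _).ne', one_smul]
  rfl

theorem shift_pow (k l : ℤ) (n : ℕ) : shift k l ^ n = shift (n * k) (n * l) := by
  induction n with
  | zero => simp [shift_zero_zero]
  | succ n ih =>
    rw [pow_succ, ih, shift_mul_shift]
    congr 1 <;> push_cast <;> ring

theorem norm_laurentTerm_le (τ w : Circle) (p : ℤ × ℤ) :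
    ‖(τ : ℂ) ^ p.1 * (w : ℂ) ^ p.2 / weight p.2‖ ≤ 1 := by
  rw [norm_div, norm_mul, norm_circle_zpow, norm_circle_zpow, Complex.norm_real, Real.norm_eq_abs,
    abs_of_pos (weight_pos _), one_mul]
  exact (div_le_one (weight_pos _)).2 (one_le_weight _)

/-- The value at `(τ, w)` of the Laurent series with given weighted coefficients. -/
noncomputable def evalAt (τ w : Circle) : Ell1 (ℤ × ℤ) →L[ℝ] ℂ :=
  l1Lift (fun p => (τ : ℂ) ^ p.1 * (w : ℂ) ^ p.2 / weight p.2) ⟨1, norm_laurentTerm_le τ w⟩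

theorem evalAt_basis (τ w : Circle) (p : ℤ × ℤ) :
    evalAt τ w (Ell1.basis p) = (τ : ℂ) ^ p.1 * (w : ℂ) ^ p.2 / weight p.2 := l1Lift_basis _ _

theorem evalAt_basis_zero (τ w : Circle) : evalAt τ w (Ell1.basis (0, 0)) = 1 := by
  rw [evalAt_basis]; simp [weight]

theorem evalAt_ne_zero (τ w : Circle) : evalAt τ w ≠ 0 := fun h => by
  have := evalAt_basis_zero τ w
  rw [h] at this
  exact zero_ne_one this

theorem eigen_shift (τ w : Circle) (k l : ℤ) :
    Eigen (evalAt τ w) (shift k l) ((τ : ℂ) ^ k * (w : ℂ) ^ l) := by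
  have h : (evalAt τ w).comp (shift k l) = (ContinuousLinearMap.mul ℝ ℂ
      ((τ : ℂ) ^ k * (w : ℂ) ^ l)).comp (evalAt τ w) := by
    refine Ell1.ext_clm fun p => ?_
    simp only [ContinuousLinearMap.comp_apply, ContinuousLinearMap.mul_apply', shift_basis, map_smul,
      evalAt_basis]
    rw [zpow_add₀ (Circle.coe_ne_zero τ), zpow_add₀ (Circle.coe_ne_zero w), Complex.real_smul]
    have h1 : (weight p.2 : ℂ) ≠ 0 := by exact_mod_cast (weight_pos p.2).ne'
    have h2 : (weight (p.2 + l) : ℂ) ≠ 0 := by exact_mod_cast (weight_pos (p.2 + l)).ne'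
    push_cast
    field_simp
  exact fun x => DFunLike.congr_fun h x

/-- The Laurent series in `w` which is the mean over `τ`. -/
noncomputable def meanTerm (w : Circle) (p : ℤ × ℤ) : ℂ :=
  if p.1 = 0 then (w : ℂ) ^ p.2 / weight p.2 else 0

theorem norm_meanTerm_le (w : Circle) (p : ℤ × ℤ) : ‖meanTerm w p‖ ≤ 1 := by
  rw [meanTerm]
  split_ifs
  · simpa using norm_laurentTerm_le 1 w p
  · simp

/-- Integration term by term over `τ` keeps exactly the coefficients whose power of `τ` is zero. -/
theorem hasSum_circleMean_evalAt (w : Circle) (x : Ell1 (ℤ × ℤ)) :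
    HasSum (fun p => x p • meanTerm w p) (circleMean fun τ => evalAt τ w x) := by
  have h : circleMean (fun τ => evalAt τ w x) = l1Lift (meanTerm w) ⟨1, norm_meanTerm_le w⟩ x := by
    have hc : ∀ p : ℤ × ℤ, circleMean (fun τ : Circle => (τ : ℂ) ^ p.1 * (w : ℂ) ^ p.2 / weight p.2) =
        meanTerm w p := fun p => by
      simp only [mul_div_assoc]
      rw [circleMean_mul_const, circleMean_zpow, meanTerm]
      split_ifs <;> simp
    have hi := hasSum_integral_of_summable_integral_norm (μ := angleMeasure)
      (F := fun (p : ℤ × ℤ) t => x p • ((Circle.exp t : ℂ) ^ p.1 * (w : ℂ) ^ p.2 / weight p.2))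
      (fun p => ((Tame.of_continuous (((continuous_circle_zpow p.1).mul continuous_const).div_const
        (weight p.2 : ℂ))).integrable).smul (x p)) ?_
    · have e : ∀ t : ℝ, ∑' p : ℤ × ℤ, x p • ((Circle.exp t : ℂ) ^ p.1 * (w : ℂ) ^ p.2 / weight p.2) =
          evalAt (Circle.exp t) w x := fun t => (hasSum_l1Lift _ x).tsum_eq
      simp only [e, integral_smul] at hi
      have hi' : HasSum (fun p => x p • meanTerm w p) (circleMean fun τ => evalAt τ w x) := by
        have e2 : ∀ p, x p • meanTerm w p = x p • ∫ t, ((Circle.exp t : ℂ) ^ p.1 * (w : ℂ) ^ p.2 /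
          weight p.2) ∂angleMeasure := fun p => by rw [← hc p]; rfl
        simp only [e2]
        exact hi
      exact hi'.unique (hasSum_l1Lift _ x)
    · refine Summable.of_nonneg_of_le (fun p => integral_nonneg fun _ => norm_nonneg _) (fun p => ?_)
        (Ell1.hasSum_abs x).summable
      have : ∀ t : ℝ, ‖x p • ((Circle.exp t : ℂ) ^ p.1 * (w : ℂ) ^ p.2 / weight p.2)‖ ≤ |x p| := fun t => by
        rw [norm_smul, Real.norm_eq_abs]
        exact mul_le_of_le_one_right (abs_nonneg _) (norm_laurentTerm_le _ w p)
      calc _ ≤ ∫ _, |x p| ∂angleMeasure := by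
            refine integral_mono ?_ (integrable_const _) this
            exact ((((Tame.of_continuous (((continuous_circle_zpow p.1).mul continuous_const).div_const
              (weight p.2 : ℂ))).integrable).smul (x p))).norm
        _ = |x p| := by simp
  rw [h]
  exact hasSum_l1Lift _ x

/-- The coefficients are real, and on the circle conjugation exchanges `w ^ n` and `w ^ (-n)`, which
have equal weights. -/
theorem circleMean_evalAt_im (w : Circle) (x : Ell1 (ℤ × ℤ)) (hx : ∀ n : ℤ, x (0, -n) = x (0, n)) :
    (circleMean fun τ => evalAt τ w x).im = 0 := by
  rw [← Complex.conj_eq_iff_im]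
  have h := hasSum_circleMean_evalAt w x
  have h1 : HasSum (fun p => conj (x p • meanTerm w p)) (conj (circleMean fun τ => evalAt τ w x)) :=
    h.mapL (Complex.conjCLE : ℂ →L[ℝ] ℂ)
  have h2 := ((Equiv.prodCongr (Equiv.refl ℤ) (Equiv.neg ℤ)).hasSum_iff).2 h
  refine h1.unique ((hasSum_congr_of_forall fun p => ?_).2 h2)
  obtain ⟨m, n⟩ := p
  change conj (x (m, n) • meanTerm w (m, n)) = x (m, -n) • meanTerm w (m, -n)
  by_cases hm : m = 0
  · subst hm
    rw [hx, Complex.real_smul, Complex.real_smul, map_mul, Complex.conj_ofReal, meanTerm, meanTerm,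
      if_pos rfl, if_pos rfl, map_div₀, Complex.conj_ofReal, map_zpow₀, conj_circle, inv_zpow, zpow_neg,
      weight, weight, Int.natAbs_neg]
  · simp [meanTerm, hm]

/-- The functionals whose vanishing means that the mean over `τ` is real. -/
noncomputable def oddPartTerm (p : ℤ × ℤ) : Ell1 ℕ :=
  if p.1 = 0 then
    (if 0 < p.2 then Ell1.basis (p.2.toNat - 1) else
      if p.2 < 0 then -Ell1.basis ((-p.2).toNat - 1) else 0) else 0

theorem norm_oddPartTerm_le (p : ℤ × ℤ) : ‖oddPartTerm p‖ ≤ 1 := by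
  rw [oddPartTerm]
  split_ifs <;> simp [Ell1.norm_basis]

/-- The coefficients of the odd part of the mean over `τ`. -/
noncomputable def oddPart : Ell1 (ℤ × ℤ) →L[ℝ] Ell1 ℕ := l1Lift oddPartTerm ⟨1, norm_oddPartTerm_le⟩

theorem oddPart_basis (p : ℤ × ℤ) : oddPart (Ell1.basis p) = oddPartTerm p := l1Lift_basis _ _

/-- The coordinate functionals. -/
noncomputable def Ell1.coord {ι : Type*} [DecidableEq ι] (i : ι) : Ell1 ι →L[ℝ] ℝ :=
  l1Lift (fun k => if k = i then 1 else 0) ⟨1, fun k => by split_ifs <;> simp⟩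

theorem Ell1.coord_apply {ι : Type*} [DecidableEq ι] (i : ι) (x : Ell1 ι) : Ell1.coord i x = x i := by
  have h1 := hasSum_l1Lift (y := fun k => if k = i then (1 : ℝ) else 0)
    ⟨1, fun k => by split_ifs <;> simp⟩ x
  have h2 := hasSum_single (f := fun k => x k • if k = i then (1 : ℝ) else 0) i
    fun k hk => by rw [if_neg hk, smul_zero]
  rw [Ell1.coord, h1.unique h2, if_pos rfl, smul_eq_mul, mul_one]

theorem Ell1.basis_apply {ι : Type*} [DecidableEq ι] (i k : ι) :
    (Ell1.basis i : Ell1 ι) k = if i = k then 1 else 0 := by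
  rw [← Ell1.coord_apply, Ell1.coord, l1Lift_basis]

theorem oddPart_apply (x : Ell1 (ℤ × ℤ)) (n : ℕ) :
    oddPart x n = x (0, (n + 1 : ℤ)) - x (0, -(n + 1 : ℤ)) := by
  have h : (Ell1.coord n).comp oddPart =
      Ell1.coord ((0, (n + 1 : ℤ)) : ℤ × ℤ) - Ell1.coord ((0, -(n + 1 : ℤ)) : ℤ × ℤ) := by
    refine Ell1.ext_clm fun p => ?_
    obtain ⟨k, l⟩ := p
    rw [ContinuousLinearMap.comp_apply, sub_apply, oddPart_basis, Ell1.coord_apply,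
      Ell1.coord_apply, Ell1.basis_apply, Ell1.coord_apply, Ell1.basis_apply, oddPartTerm]
    simp only [Prod.mk.injEq]
    by_cases hk : k = 0
    · subst hk
      simp only [if_true, true_and]
      rcases lt_trichotomy 0 l with hl | hl | hl
      · rw [if_pos hl, Ell1.basis_apply, if_neg (show ¬ l = -(n + 1 : ℤ) by omega), sub_zero]
        congr 1
        simp only [eq_iff_iff]
        omega
      · rw [if_neg (by omega), if_neg (by omega), if_neg (by omega), if_neg (by omega), sub_zero]
        rfl
      · rw [if_neg (by omega), if_pos hl, if_neg (show ¬ l = (n + 1 : ℤ) by omega), zero_sub]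
        have : ∀ y : Ell1 ℕ, (-y : Ell1 ℕ) n = -(y n) := fun y => rfl
        rw [this, Ell1.basis_apply]
        congr 2
        simp only [eq_iff_iff]
        omega
    · simp only [hk, if_false, false_and, sub_zero]
      rfl
  have := DFunLike.congr_fun h x
  rw [ContinuousLinearMap.comp_apply, sub_apply, Ell1.coord_apply,
    Ell1.coord_apply, Ell1.coord_apply] at this
  exact this

theorem circleMean_evalAt_im_of_oddPart {x : Ell1 (ℤ × ℤ)} (hx : oddPart x = 0) (w : Circle) :
    (circleMean fun τ => evalAt τ w x).im = 0 := by
  have h : ∀ n : ℕ, x (0, (n + 1 : ℤ)) - x (0, -(n + 1 : ℤ)) = 0 := fun n => by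
    rw [← oddPart_apply, hx]; rfl
  refine circleMean_evalAt_im w x fun n => ?_
  rcases lt_trichotomy 0 n with hn | hn | hn
  · have := h (n.toNat - 1)
    rw [show (((n.toNat - 1 : ℕ) : ℤ) + 1) = n by omega] at this
    linarith
  · subst hn; rfl
  · have := h ((-n).toNat - 1)
    rw [show ((((-n).toNat - 1 : ℕ) : ℤ) + 1) = -n by omega, neg_neg] at this
    linarith

/-! ### Profiles with summable coordinates -/

theorem norm_conj_le_two (w : Circle) : ‖conj (w : ℂ)‖ ≤ 2 := by
  rw [Complex.norm_conj, Circle.norm_coe]; norm_num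

theorem norm_coe_le_two (w : Circle) : ‖(w : ℂ)‖ ≤ 2 := by
  rw [Circle.norm_coe]; norm_num

theorem norm_conj_le_one (w : Circle) : ‖conj (w : ℂ)‖ ≤ 1 := by
  rw [Complex.norm_conj, Circle.norm_coe]

/-- The profile with coordinates `u`. -/
noncomputable def profile (u : Ell1 ℕ) (w : Circle) : ℂ := series (conj (w : ℂ)) (norm_conj_le_two w) u

/-- The derivative of the profile with coordinates `u`. -/
noncomputable def profileDeriv (u : Ell1 ℕ) (w : Circle) : ℂ :=
  derivSeries (conj (w : ℂ)) (norm_conj_le_two w) u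

theorem norm_pow_sub_pow_le {x y : ℂ} (hx : ‖x‖ ≤ 1) (hy : ‖y‖ ≤ 1) (n : ℕ) :
    ‖x ^ n - y ^ n‖ ≤ n * ‖x - y‖ := by
  rw [← (Commute.all x y).geom_sum₂_mul, norm_mul]
  refine mul_le_mul_of_nonneg_right ?_ (norm_nonneg _)
  refine (norm_sum_le_of_le _ (n := fun _ => (1 : ℝ)) fun k _ => ?_).trans (by simp)
  rw [norm_mul, norm_pow, norm_pow]
  exact mul_le_one₀ (pow_le_one₀ (norm_nonneg _) hx) (by positivity) (pow_le_one₀ (norm_nonneg _) hy)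

theorem norm_l1Lift_sub_le {ι F : Type*} [NormedAddCommGroup F] [NormedSpace ℝ F] [CompleteSpace F]
    {y z : ι → F} (hy : ∃ C : ℝ, ∀ i, ‖y i‖ ≤ C) (hz : ∃ C : ℝ, ∀ i, ‖z i‖ ≤ C) {C : ℝ}
    (h : ∀ i, ‖y i - z i‖ ≤ C) (x : Ell1 ι) : ‖l1Lift y hy x - l1Lift z hz x‖ ≤ C * ‖x‖ := by
  have h1 := (hasSum_l1Lift hy x).sub (hasSum_l1Lift hz x)
  simp only [← smul_sub] at h1
  rw [← h1.tsum_eq]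
  exact Ell1.norm_tsum_smul_le x h

theorem norm_seriesTerm_sub_le {x y : ℂ} (hx : ‖x‖ ≤ 1) (hy : ‖y‖ ≤ 1) (n : ℕ) :
    ‖seriesTerm x n - seriesTerm y n‖ ≤ ‖x - y‖ := by
  rcases n with _ | n
  · simp [seriesTerm]
  · rw [seriesTerm, seriesTerm, ← smul_sub, norm_smul, Real.norm_eq_abs,
      abs_of_pos (profileWeight_pos n), profileWeight, div_mul_eq_mul_div, one_mul,
      div_le_iff₀ (by positivity)]
    refine (norm_pow_sub_pow_le hx hy (n + 1)).trans ?_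
    push_cast
    have h1 : (1 : ℝ) ≤ 2 ^ (n + 2) := one_le_pow₀ one_le_two
    have h2 : (0 : ℝ) ≤ (n + 1) * ‖x - y‖ := by positivity
    nlinarith

theorem norm_derivSeriesTerm_sub_le {x y : ℂ} (hx : ‖x‖ ≤ 1) (hy : ‖y‖ ≤ 1) (n : ℕ) :
    ‖derivSeriesTerm x n - derivSeriesTerm y n‖ ≤ ‖x - y‖ := by
  rcases n with _ | n
  · simp [derivSeriesTerm]
  · rw [derivSeriesTerm, derivSeriesTerm, ← smul_sub, norm_smul, Real.norm_eq_abs, abs_neg,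
      abs_of_pos (by positivity), div_mul_eq_mul_div, one_mul, div_le_iff₀ (by positivity)]
    refine (norm_pow_sub_pow_le hx hy (n + 2)).trans ?_
    rw [mul_comm]
    refine mul_le_mul_of_nonneg_left ?_ (norm_nonneg _)
    exact_mod_cast (Nat.lt_two_pow_self (n := n + 2)).le

theorem norm_profile_le (u : Ell1 ℕ) (w : Circle) : ‖profile u w‖ ≤ ‖u‖ := by
  exact (norm_l1Lift_apply_le ⟨1, norm_seriesTerm_le (norm_conj_le_two w)⟩
    (norm_seriesTerm_le (norm_conj_le_two w)) u).trans_eq (one_mul _)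

theorem norm_profileDeriv_le (u : Ell1 ℕ) (w : Circle) : ‖profileDeriv u w‖ ≤ ‖u‖ := by
  exact (norm_l1Lift_apply_le ⟨1, norm_derivSeriesTerm_le (norm_conj_le_two w)⟩
    (norm_derivSeriesTerm_le (norm_conj_le_two w)) u).trans_eq (one_mul _)

theorem norm_profileDeriv_sub_le (u : Ell1 ℕ) (w w' : Circle) :
    ‖profileDeriv u w - profileDeriv u w'‖ ≤ ‖u‖ * dist w w' := by
  refine (norm_l1Lift_sub_le _ _ (norm_derivSeriesTerm_sub_le (norm_conj_le_one w)
    (norm_conj_le_one w')) u).trans (le_of_eq ?_)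
  rw [← map_sub, Complex.norm_conj, mul_comm, ← dist_eq_norm]
  rfl

/-- Termwise differentiation: the derivatives of the terms are dominated by `|u n|`. -/
theorem profile_deriv (u : Ell1 ℕ) :
    CircleDifferentiable (profile u) ∧ circleDeriv (profile u) = profileDeriv u := by
  refine CircleDifferentiable.of_hasDerivAt fun w => ?_
  have hterm : ∀ (n : ℕ) (t : ℝ), HasDerivAt
      (fun s : ℝ => u n • seriesTerm (conj ((w * Circle.exp s : Circle) : ℂ)) n)
      (u n • (derivSeriesTerm (conj ((w * Circle.exp t : Circle) : ℂ)) n *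
        (Complex.I * (w * Circle.exp t : Circle)))) t := fun n t => by
    refine HasDerivAt.const_smul (u n) ?_
    rcases n with _ | n
    · simpa [seriesTerm, derivSeriesTerm] using hasDerivAt_const t (0 : ℂ)
    · have h := (hasDerivAt_conj_pow (w * Circle.exp t) (n + 1)).const_smul (profileWeight n)
      have hs : HasDerivAt (fun s : ℝ => s - t) 1 t := (hasDerivAt_id t).sub_const t
      have h0 : (fun s : ℝ => s - t) t = 0 := sub_self t
      have h' := HasDerivAt.scomp_of_eq t h hs h0.symm
      refine (h'.congr_of_eventuallyEq (Eventually.of_forall fun s => ?_)).congr_deriv ?_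
      · simp only [seriesTerm, Function.comp_apply, Pi.smul_apply]
        rw [mul_assoc, ← Circle.exp_add, add_sub_cancel]
      · simp only [derivSeriesTerm, profileWeight, one_smul, Complex.real_smul]
        push_cast
        have : (n : ℂ) + 1 ≠ 0 := by exact_mod_cast n.succ_ne_zero
        field_simp
  have hbound : ∀ (n : ℕ) (t : ℝ), ‖u n • (derivSeriesTerm (conj ((w * Circle.exp t : Circle) : ℂ)) n *
      (Complex.I * (w * Circle.exp t : Circle)))‖ ≤ |u n| := fun n t => by
    rw [norm_smul, norm_mul, norm_mul, Complex.norm_I, Circle.norm_coe, mul_one, mul_one, Real.norm_eq_abs]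
    exact mul_le_of_le_one_right (abs_nonneg _) (norm_derivSeriesTerm_le (norm_conj_le_two _) n)
  have h := hasDerivAt_tsum (Ell1.hasSum_abs u).summable hterm hbound (y₀ := 0)
    (Ell1.summable_smul u ⟨1, norm_seriesTerm_le (norm_conj_le_two _)⟩) 0
  have h2 := (hasSum_l1Lift ⟨1, norm_derivSeriesTerm_le (norm_conj_le_two w)⟩ u).mul_right
    (Complex.I * (w : ℂ))
  refine h.congr_deriv ?_
  simp only [Circle.exp_zero, mul_one]
  refine Eq.trans (tsum_congr fun n => ?_) h2.tsum_eq
  rw [smul_mul_assoc]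

theorem continuous_profileDeriv (u : Ell1 ℕ) : Continuous (profileDeriv u) := by
  refine (LipschitzWith.of_dist_le_mul (K := ‖u‖₊) fun w w' => ?_).continuous
  rw [dist_eq_norm]
  exact norm_profileDeriv_sub_le u w w'

/-- The coefficients of the profile with coordinates `u`. -/
noncomputable def profileCoeff (u : Ell1 ℕ) (n : ℕ) : ℝ := u (n + 1) * profileWeight n

theorem isProfile_profile (u : Ell1 ℕ) : IsProfile (profile u) (profileCoeff u) := by
  obtain ⟨h1, h2⟩ := profile_deriv u
  refine ⟨h1, h2 ▸ continuous_profileDeriv u, fun w => ?_⟩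
  have h3 := hasSum_l1Lift ⟨1, norm_seriesTerm_le (norm_conj_le_two w)⟩ u
  rw [← hasSum_nat_add_iff' 1] at h3
  simp only [Finset.range_one, Finset.sum_singleton, seriesTerm, smul_zero, sub_zero] at h3
  refine (hasSum_congr_of_forall fun n => ?_).2 h3
  simp only [profileCoeff, Complex.real_smul, Complex.ofReal_mul]
  ring

/-- For each power, `(τ⁻ᵐ - w⁻ᵐ) / (τ - w)` is minus the sum of `τ^{-(k+1)} w^{-(m-k)}` over `k <
m`. The diagonal is excluded because `diffQuot` is zero there, whereas the series gives the
derivative. -/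
theorem diffQuot_profile (u : Ell1 ℕ) {τ w : Circle} (h : τ ≠ w) : diffQuot (profile u) τ w =
    quotSeries (conj (τ : ℂ)) (conj (w : ℂ)) (norm_conj_le_one τ) (norm_conj_le_two w) u := by
  have h0 : (τ : ℂ) - w ≠ 0 := sub_ne_zero.2 fun h' => h (Circle.ext h')
  have h1 := ((hasSum_l1Lift ⟨1, norm_seriesTerm_le (norm_conj_le_two τ)⟩ u).sub
    (hasSum_l1Lift ⟨1, norm_seriesTerm_le (norm_conj_le_two w)⟩ u)).div_const ((τ : ℂ) - w)
  have h2 := hasSum_l1Lift ⟨1, norm_quotSeriesTerm_le (norm_conj_le_one τ) (norm_conj_le_two w)⟩ u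
  refine h1.unique ((hasSum_congr_of_forall fun n => ?_).2 h2)
  rw [← smul_sub, smul_div_assoc]
  congr 1
  rcases n with _ | n
  · simp [seriesTerm, quotSeriesTerm]
  · rw [seriesTerm, seriesTerm, quotSeriesTerm, ← smul_sub, smul_div_assoc, neg_smul, ← smul_neg]
    congr 1
    rw [div_eq_iff h0, ← (Commute.all (conj (τ : ℂ)) (conj (w : ℂ))).geom_sum₂_mul, neg_mul,
      ← mul_neg]
    have e1 : ∑ k ∈ Finset.range (n + 1), conj (τ : ℂ) ^ (k + 1) * conj (w : ℂ) ^ (n + 1 - k) =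
        (∑ k ∈ Finset.range (n + 1), conj (τ : ℂ) ^ k * conj (w : ℂ) ^ (n + 1 - 1 - k)) *
          (conj (τ : ℂ) * conj (w : ℂ)) := by
      rw [Finset.sum_mul]
      refine Finset.sum_congr rfl fun k hk => ?_
      rw [Finset.mem_range] at hk
      rw [show n + 1 - k = (n + 1 - 1 - k) + 1 by omega, pow_succ, pow_succ]
      ring
    rw [e1, mul_assoc]
    congr 1
    rw [conj_circle, conj_circle]
    have := Circle.coe_ne_zero τ
    have := Circle.coe_ne_zero w
    field_simp
    ring

/-- The derivative is Lipschitz with constant `‖u‖`, thanks to the geometric weights. On a space of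
diameter at most two this gives a Hölder constant `2 ^ (1 - α) * ‖u‖`, and `4 = 1 + 1 + 2`. -/
theorem holderNorm_profile_le {α : ℝ≥0} (hα : α ≤ 1) (u : Ell1 ℕ) :
    holderNorm α (profile u) ≤ 4 * ‖u‖ₑ := by
  have h1 : (⨆ w : Circle, ‖profile u w‖ₑ) ≤ ‖u‖ₑ := iSup_le fun w =>
    enorm_le_iff_norm_le.2 (norm_profile_le u w)
  have h2 : (⨆ w : Circle, ‖profileDeriv u w‖ₑ) ≤ ‖u‖ₑ := iSup_le fun w =>
    enorm_le_iff_norm_le.2 (norm_profileDeriv_le u w)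
  have hL : HolderWith ‖u‖₊ 1 (profileDeriv u) := by
    rw [holderWith_one]
    refine LipschitzWith.of_dist_le_mul fun w w' => ?_
    rw [dist_eq_norm]
    exact norm_profileDeriv_sub_le u w w'
  have hD : ∀ x y : Circle, edist x y ≤ ((2 : ℝ≥0) : ℝ≥0∞) := fun x y => by
    rw [edist_dist]
    refine ENNReal.ofReal_le_of_le_toReal ?_
    have : dist x y = ‖(x : ℂ) - y‖ := by rw [← dist_eq_norm]; rfl
    rw [this]
    refine (norm_sub_le _ _).trans ?_
    rw [Circle.norm_coe, Circle.norm_coe]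
    norm_num
  have h3 : eHolderNorm α (profileDeriv u) ≤ 2 * ‖u‖ₑ := by
    have := (hL.of_le hD hα).eHolderNorm_le
    refine this.trans ?_
    rw [mul_comm (2 : ℝ≥0∞)]
    push_cast
    refine mul_le_mul' le_rfl ?_
    rw [← ENNReal.coe_ofNat]
    refine ENNReal.coe_le_coe.2 ?_
    calc (2 : ℝ≥0) ^ ((1 : ℝ) - α) ≤ 2 ^ (1 : ℝ) :=
          NNReal.rpow_le_rpow_of_exponent_le (by norm_num) (by simp)
      _ = 2 := NNReal.rpow_one 2
  rw [holderNorm, (profile_deriv u).2]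
  calc _ ≤ ‖u‖ₑ + ‖u‖ₑ + 2 * ‖u‖ₑ := add_le_add (add_le_add h1 h2) h3
    _ = 4 * ‖u‖ₑ := by ring

theorem memX_profile {α : ℝ≥0} (hα : α ≤ 1) (u : Ell1 ℕ) : MemX α (profile u) :=
  ⟨(profile_deriv u).1, (holderNorm_profile_le hα u).trans_lt
    (ENNReal.mul_lt_top (by simp) enorm_lt_top), ⟨_, (isProfile_profile u).series⟩⟩

theorem unitBounded_profile {u : Ell1 ℕ} (hu : ‖u‖ ≤ 1) : UnitBounded (profile u) :=
  ⟨fun w => (norm_profile_le u w).trans hu, fun w => by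
    rw [(profile_deriv u).2]; exact (norm_profileDeriv_le u w).trans hu⟩

/-- The map from coordinates to profiles is linear and bounded into `C^{1+α}`, so it carries `C¹`
curves to `C¹` curves. -/
theorem isC1Curve_profile {α : ℝ≥0} (hα : α ≤ 1) {s : Set ℝ} {u u' : ℝ → Ell1 ℕ}
    (hu : ∀ ε ∈ s, HasDerivAt u (u' ε) ε) (hu' : ContinuousOn u' s) :
    IsC1Curve α s (fun ε => profile (u ε)) := by
  refine ⟨fun ε _ => memX_profile hα _, fun ε => profile (u' ε), fun ε _ => memX_profile hα _,
    fun ε hε => ?_, fun ε hε => ?_⟩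
  · have h1 := (hasDerivAt_iff_tendsto_slope.1 (hu ε hε)).mono_left
      (nhdsWithin_mono ε (show s \ {ε} ⊆ {ε}ᶜ from fun x hx => hx.2))
    have h2 : Tendsto (fun η => 4 * ‖slope u ε η - u' ε‖ₑ) (𝓝[s \ {ε}] ε) (𝓝 0) := by
      have h3 : Tendsto (fun η => ‖slope u ε η - u' ε‖ₑ) (𝓝[s \ {ε}] ε) (𝓝 0) := by
        have := (h1.sub_const (u' ε)).enorm
        simpa using this
      simpa using ENNReal.Tendsto.const_mul h3 (Or.inr (by simp : (4 : ℝ≥0∞) ≠ ∞))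
    refine tendsto_of_tendsto_of_tendsto_of_le_of_le tendsto_const_nhds h2 (fun _ => zero_le) fun η => ?_
    refine le_trans (le_of_eq ?_) (holderNorm_profile_le hα (slope u ε η - u' ε))
    congr 1
    ext w
    simp only [profile, map_sub, slope, vsub_eq_sub, map_smul, Complex.real_smul]
    push_cast
    rw [div_eq_inv_mul]
  · have h2 : Tendsto (fun η => 4 * ‖u' η - u' ε‖ₑ) (𝓝[s] ε) (𝓝 0) := by
      have h3 : Tendsto (fun η => ‖u' η - u' ε‖ₑ) (𝓝[s] ε) (𝓝 0) := by
        have := ((hu' ε hε).tendsto.sub_const (u' ε)).enorm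
        simpa using this
      simpa using ENNReal.Tendsto.const_mul h3 (Or.inr (by simp : (4 : ℝ≥0∞) ≠ ∞))
    refine tendsto_of_tendsto_of_tendsto_of_le_of_le tendsto_const_nhds h2 (fun _ => zero_le) fun η => ?_
    refine le_trans (le_of_eq ?_) (holderNorm_profile_le hα (u' η - u' ε))
    congr 1
    ext w
    simp only [profile, map_sub]

/-! ### Conformality -/

/-- The holomorphic function `F` with `F(1/w) = f(w)` for the profile `f`. -/
noncomputable def profileExt (u : Ell1 ℕ) (ζ : ℂ) : ℂ := ∑' n, u n • seriesTerm ζ n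

theorem profileExt_zero (u : Ell1 ℕ) : profileExt u 0 = 0 := by
  have : ∀ n : ℕ, u n • seriesTerm (0 : ℂ) n = 0 := fun n => by
    rcases n with _ | n <;> simp [seriesTerm]
  simp [profileExt, this]

theorem norm_profileExt_sub_le (u : Ell1 ℕ) {x y : ℂ} (hx : ‖x‖ ≤ 1) (hy : ‖y‖ ≤ 1) :
    ‖profileExt u x - profileExt u y‖ ≤ ‖u‖ * ‖x - y‖ := by
  rw [mul_comm]
  exact norm_l1Lift_sub_le ⟨1, norm_seriesTerm_le (hx.trans one_le_two)⟩
    ⟨1, norm_seriesTerm_le (hy.trans one_le_two)⟩ (norm_seriesTerm_sub_le hx hy) u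

theorem norm_profileExt_le (u : Ell1 ℕ) {x : ℂ} (hx : ‖x‖ ≤ 1) : ‖profileExt u x‖ ≤ ‖u‖ * ‖x‖ := by
  have := norm_profileExt_sub_le u hx (y := 0) (by simp)
  rwa [profileExt_zero, sub_zero, sub_zero] at this

theorem differentiableOn_profileExt (u : Ell1 ℕ) :
    DifferentiableOn ℂ (profileExt u) (Metric.ball 0 1) := by
  refine Complex.differentiableOn_tsum_of_summable_norm (Ell1.hasSum_abs u).summable (fun n => ?_)
    Metric.isOpen_ball fun n ζ hζ => ?_
  · rcases n with _ | n
    · simp only [seriesTerm, smul_zero]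
      exact differentiableOn_const _
    · simp only [seriesTerm]
      fun_prop
  · rw [norm_smul, Real.norm_eq_abs]
    rw [mem_ball_zero_iff] at hζ
    exact mul_le_of_le_one_right (abs_nonneg _) (norm_seriesTerm_le (hζ.le.trans one_le_two) n)

theorem norm_inv_sub_inv_le {z z' : ℂ} (hz : 1 ≤ ‖z‖) (hz' : 1 ≤ ‖z'‖) : ‖z⁻¹ - z'⁻¹‖ ≤ ‖z - z'‖ := by
  have h1 : z ≠ 0 := norm_pos_iff.1 (by linarith)
  have h2 : z' ≠ 0 := norm_pos_iff.1 (by linarith)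
  rw [inv_sub_inv h1 h2, norm_div, norm_mul, norm_sub_rev]
  exact div_le_self (norm_nonneg _) (one_le_mul_of_one_le_of_one_le hz hz')

/-- On the exterior the perturbation is Lipschitz with constant `1 / 2` and bounded by `1 / (2
|z|)`. The first property makes the sum injective; the second keeps it away from zero and gives the
normalization at infinity. -/
theorem isConformalParam_of_norm_le {u : Ell1 ℕ} {η : ℝ} (h : |η| * ‖u‖ ≤ 1 / 2) :
    IsConformalParam fun w => (w : ℂ) + η * profile u w := by
  have hinv : ∀ {z : ℂ}, 1 ≤ ‖z‖ → ‖z⁻¹‖ ≤ 1 := fun hz => by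
    rw [norm_inv]; exact inv_le_one_of_one_le₀ hz
  have hlip : ∀ {z z' : ℂ}, 1 ≤ ‖z‖ → 1 ≤ ‖z'‖ →
      ‖(η : ℂ) * profileExt u z⁻¹ - η * profileExt u z'⁻¹‖ ≤ 1 / 2 * ‖z - z'‖ := fun {z z'} hz hz' => by
    rw [← mul_sub, norm_mul, Complex.norm_real, Real.norm_eq_abs]
    calc |η| * ‖profileExt u z⁻¹ - profileExt u z'⁻¹‖ ≤ |η| * (‖u‖ * ‖z - z'‖) := by
          refine mul_le_mul_of_nonneg_left ?_ (abs_nonneg _)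
          exact (norm_profileExt_sub_le u (hinv hz) (hinv hz')).trans
            (mul_le_mul_of_nonneg_left (norm_inv_sub_inv_le hz hz') (norm_nonneg _))
      _ = |η| * ‖u‖ * ‖z - z'‖ := by ring
      _ ≤ 1 / 2 * ‖z - z'‖ := mul_le_mul_of_nonneg_right h (norm_nonneg _)
  have hbd : ∀ {z : ℂ}, 1 ≤ ‖z‖ → ‖(η : ℂ) * profileExt u z⁻¹‖ ≤ 1 / 2 * ‖z⁻¹‖ := fun {z} hz => by
    rw [norm_mul, Complex.norm_real, Real.norm_eq_abs]
    calc |η| * ‖profileExt u z⁻¹‖ ≤ |η| * (‖u‖ * ‖z⁻¹‖) :=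
          mul_le_mul_of_nonneg_left (norm_profileExt_le u (hinv hz)) (abs_nonneg _)
      _ = |η| * ‖u‖ * ‖z⁻¹‖ := by ring
      _ ≤ 1 / 2 * ‖z⁻¹‖ := mul_le_mul_of_nonneg_right h (norm_nonneg _)
  have hcont : ContinuousOn (fun z : ℂ => (η : ℂ) * profileExt u z⁻¹) {w | 1 ≤ ‖w‖} := by
    have : LipschitzOnWith (1 / 2) (fun z : ℂ => (η : ℂ) * profileExt u z⁻¹) {w | 1 ≤ ‖w‖} :=
      LipschitzOnWith.of_dist_le_mul fun z hz z' hz' => by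
        rw [dist_eq_norm, dist_eq_norm]
        simpa using hlip hz hz'
    exact this.continuousOn
  refine ⟨fun z => z + η * profileExt u z⁻¹, continuousOn_id.add hcont, ?_, ?_, ?_, fun w => ?_, ?_, ?_⟩
  · refine differentiableOn_id.add ((differentiableOn_const _).mul
      ((differentiableOn_profileExt u).comp (fun z hz => ?_) fun z hz => ?_))
    · exact (differentiableAt_inv (norm_pos_iff.1 (zero_lt_one.trans hz))).differentiableWithinAt
    · rw [mem_ball_zero_iff, norm_inv]
      exact inv_lt_one_of_one_lt₀ hz
  · intro z hz z' hz' hzz'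
    have h1 := hlip hz hz'
    have h2 : z - z' = -((η : ℂ) * profileExt u z⁻¹ - η * profileExt u z'⁻¹) := by
      simp only at hzz'
      linear_combination hzz'
    rw [← norm_neg, ← h2] at h1
    have h3 : ‖z - z'‖ = 0 := le_antisymm (by linarith [norm_nonneg (z - z')]) (norm_nonneg _)
    exact sub_eq_zero.1 (norm_eq_zero.1 h3)
  · have h1 : Tendsto (fun z : ℂ => 1 / 2 * ‖z⁻¹‖) (Bornology.cobounded ℂ) (𝓝 0) := by
      have := (tendsto_inv₀_cobounded (α := ℂ)).norm.const_mul (1 / 2 : ℝ)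
      simpa using this
    refine squeeze_zero_norm' ?_ h1
    filter_upwards [tendsto_norm_cobounded_atTop.eventually (eventually_ge_atTop (1 : ℝ))] with z hz
    simpa using hbd hz
  · simp only [profile]
    rw [← conj_circle]
    rfl
  · rintro ⟨z, hz, hz0⟩
    have h1 := hbd hz
    have h2 : z = -((η : ℂ) * profileExt u z⁻¹) := by
      simp only at hz0
      linear_combination hz0
    rw [← norm_neg, ← h2] at h1
    have := hinv hz
    have : (1 : ℝ) ≤ ‖z‖ := hz
    linarith
  · intro p hp
    by_contra hp2
    rw [mem_ball_zero_iff, not_lt] at hp2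
    apply hp
    -- Points with `‖p‖ ≥ 2` are attained: `T` is a contraction of the closed exterior into itself,
    -- since `2 - 1 / 2 ≥ 1`, and its fixed point is a preimage of `p`.
    set T : ℂ → ℂ := fun z => p - η * profileExt u z⁻¹ with hT
    have hmaps : MapsTo T {w : ℂ | 1 ≤ ‖w‖} {w : ℂ | 1 ≤ ‖w‖} := fun z hz => by
      have h1 := hbd hz
      have h2 := hinv hz
      have h3 := norm_sub_norm_le p ((η : ℂ) * profileExt u z⁻¹)
      simp only [hT, mem_ofPred_eq]
      linarith
    have hclosed : IsClosed {w : ℂ | 1 ≤ ‖w‖} := isClosed_le continuous_const continuous_norm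
    have hcontr : ContractingWith (1 / 2) (hmaps.restrict T _ _) := by
      refine ⟨by rw [← NNReal.coe_lt_coe]; norm_num, LipschitzWith.of_dist_le_mul fun z z' => ?_⟩
      rw [Subtype.dist_eq, Subtype.dist_eq, MapsTo.val_restrict_apply, MapsTo.val_restrict_apply,
        dist_eq_norm, dist_eq_norm]
      simp only [hT]
      rw [sub_sub_sub_cancel_left, norm_sub_rev]
      simpa using hlip z.2 z'.2
    obtain ⟨z, hz, hfix, -⟩ := hcontr.exists_fixedPoint' hclosed.isComplete hmaps
      (x := 1) (by simp) (edist_ne_top _ _)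
    refine ⟨z, hz, ?_⟩
    have : p - η * profileExt u z⁻¹ = z := hfix
    simp only
    rw [← this]
    nth_rewrite 2 [this]
    ring

/-! ### The boundary field as an operator on Laurent coefficients -/

/-- Multiplication by the integration variable `τ`. -/
noncomputable def mulTau : Ell1 (ℤ × ℤ) →L[ℝ] Ell1 (ℤ × ℤ) := shift 1 0

/-- Multiplication by `τ⁻¹`. -/
noncomputable def mulTauInv : Ell1 (ℤ × ℤ) →L[ℝ] Ell1 (ℤ × ℤ) := shift (-1) 0

/-- Multiplication by the boundary variable `w`. -/
noncomputable def mulW : Ell1 (ℤ × ℤ) →L[ℝ] Ell1 (ℤ × ℤ) := shift 0 1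

/-- Multiplication by `w⁻¹`. -/
noncomputable def mulWInv : Ell1 (ℤ × ℤ) →L[ℝ] Ell1 (ℤ × ℤ) := shift 0 (-1)

theorem norm_mulTau_le : ‖mulTau‖ ≤ 1 := (norm_shift_le 1 0).trans_eq (by simp [weight])

theorem norm_mulTauInv_le : ‖mulTauInv‖ ≤ 1 := (norm_shift_le (-1) 0).trans_eq (by simp [weight])

theorem norm_mulW_le : ‖mulW‖ ≤ 2 := (norm_shift_le 0 1).trans_eq (by simp [weight])

theorem norm_mulWInv_le : ‖mulWInv‖ ≤ 2 := (norm_shift_le 0 (-1)).trans_eq (by simp [weight])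

/-- The difference quotient of the profile with coordinates `u`. -/
noncomputable def quotOp : Ell1 ℕ →L[ℝ] Ell1 (ℤ × ℤ) →L[ℝ] Ell1 (ℤ × ℤ) :=
  quotSeries mulTauInv mulWInv norm_mulTauInv_le norm_mulWInv_le

/-- The conjugate of the difference quotient of the profile with coordinates `u`. -/
noncomputable def conjQuotOp : Ell1 ℕ →L[ℝ] Ell1 (ℤ × ℤ) →L[ℝ] Ell1 (ℤ × ℤ) :=
  quotSeries mulTau mulW norm_mulTau_le norm_mulW_le

/-- The profile with coordinates `u` in the variable `τ`. -/
noncomputable def profileTauOp : Ell1 ℕ →L[ℝ] Ell1 (ℤ × ℤ) →L[ℝ] Ell1 (ℤ × ℤ) :=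
  series mulTauInv (norm_mulTauInv_le.trans one_le_two)

/-- The conjugate profile with coordinates `u` in the variable `τ`. -/
noncomputable def conjProfileTauOp : Ell1 ℕ →L[ℝ] Ell1 (ℤ × ℤ) →L[ℝ] Ell1 (ℤ × ℤ) :=
  series mulTau (norm_mulTau_le.trans one_le_two)

/-- The derivative of the profile with coordinates `u` in the variable `τ`. -/
noncomputable def derivTauOp : Ell1 ℕ →L[ℝ] Ell1 (ℤ × ℤ) →L[ℝ] Ell1 (ℤ × ℤ) :=
  derivSeries mulTauInv (norm_mulTauInv_le.trans one_le_two)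

/-- The profile with coordinates `u` in the variable `w`. -/
noncomputable def profileWOp : Ell1 ℕ →L[ℝ] Ell1 (ℤ × ℤ) →L[ℝ] Ell1 (ℤ × ℤ) :=
  series mulWInv norm_mulWInv_le

/-- The conjugate profile with coordinates `u` in the variable `w`. -/
noncomputable def conjProfileWOp : Ell1 ℕ →L[ℝ] Ell1 (ℤ × ℤ) →L[ℝ] Ell1 (ℤ × ℤ) :=
  series mulW norm_mulW_le

/-- The derivative of the profile with coordinates `u` in the variable `w`. -/
noncomputable def derivWOp : Ell1 ℕ →L[ℝ] Ell1 (ℤ × ℤ) →L[ℝ] Ell1 (ℤ × ℤ) :=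
  derivSeries mulWInv norm_mulWInv_le

/-- The denominator of the self-induced velocity. -/
noncomputable def selfDenom (η : ℝ) (u : Ell1 ℕ) : Ell1 (ℤ × ℤ) →L[ℝ] Ell1 (ℤ × ℤ) := 1 + η • quotOp u

/-- The denominator of the velocity induced by the other patch. -/
noncomputable def crossDenom (d η η' : ℝ) (u v : Ell1 ℕ) : Ell1 (ℤ × ℤ) →L[ℝ] Ell1 (ℤ × ℤ) :=
  d • 1 - η • (mulW + η • profileWOp u) - η' • (mulTau + η' • profileTauOp v)

/-- The integrand of the reduced boundary field, as a multiplication operator. -/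
noncomputable def fieldOp (γ γ' d η η' Ω A : ℝ) (u v : Ell1 ℕ) :
    Ell1 (ℤ × ℤ) →L[ℝ] Ell1 (ℤ × ℤ) :=
  (-(γ / 2)) • derivWOp u +
    ((Ω * η) • (mulWInv + η • conjProfileWOp u) - A • 1 -
      (γ / 2 * η) • (mulWInv * ((conjQuotOp u - quotOp u) * (derivTauOp u - quotOp u) *
        Ring.inverse (selfDenom η u))) +
      (γ' / 2) • (mulTau * (mulTauInv + η' • conjProfileTauOp v) * (1 + η' • derivTauOp v) *
        Ring.inverse (crossDenom d η η' u v))) *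
    (mulW * (1 + η • derivWOp u))

section Evaluation

variable (τ w : Circle)

theorem eigen_mulTau : Eigen (evalAt τ w) mulTau (τ : ℂ) := by
  simpa [mulTau] using eigen_shift τ w 1 0

theorem eigen_mulTauInv : Eigen (evalAt τ w) mulTauInv (conj (τ : ℂ)) := by
  rw [conj_circle]; simpa [mulTauInv] using eigen_shift τ w (-1) 0

theorem eigen_mulW : Eigen (evalAt τ w) mulW (w : ℂ) := by
  simpa [mulW] using eigen_shift τ w 0 1

theorem eigen_mulWInv : Eigen (evalAt τ w) mulWInv (conj (w : ℂ)) := by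
  rw [conj_circle]; simpa [mulWInv] using eigen_shift τ w 0 (-1)

theorem conj_series (c : ℂ) (hc : ‖c‖ ≤ 2) (hc' : ‖conj c‖ ≤ 2) (u : Ell1 ℕ) :
    conj (series c hc u) = series (conj c) hc' u := by
  refine map_l1Lift _ (Complex.conjCLE : ℂ →L[ℝ] ℂ) _ (fun n => ?_) u
  rcases n with _ | n
  · simp [seriesTerm]
  · simp [seriesTerm, -Complex.real_smul]

theorem conj_quotSeries (c c' : ℂ) (hc : ‖c‖ ≤ 1) (hc' : ‖c'‖ ≤ 2) (hd : ‖conj c‖ ≤ 1)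
    (hd' : ‖conj c'‖ ≤ 2) (u : Ell1 ℕ) :
    conj (quotSeries c c' hc hc' u) = quotSeries (conj c) (conj c') hd hd' u := by
  refine map_l1Lift _ (Complex.conjCLE : ℂ →L[ℝ] ℂ) _ (fun n => ?_) u
  rcases n with _ | n
  · simp [quotSeriesTerm]
  · simp [quotSeriesTerm, map_sum]

theorem conj_profile (u : Ell1 ℕ) : conj (profile u w) = series (w : ℂ) (norm_coe_le_two w) u := by
  rw [profile, conj_series _ _ (by simpa using norm_coe_le_two w)]
  simp only [Complex.conj_conj]

theorem eigen_profileTauOp (u : Ell1 ℕ) : Eigen (evalAt τ w) (profileTauOp u) (profile u τ) :=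
  (eigen_mulTauInv τ w).series _ _ u

theorem eigen_profileWOp (u : Ell1 ℕ) : Eigen (evalAt τ w) (profileWOp u) (profile u w) :=
  (eigen_mulWInv τ w).series _ _ u

theorem eigen_conjProfileTauOp (u : Ell1 ℕ) :
    Eigen (evalAt τ w) (conjProfileTauOp u) (conj (profile u τ)) := by
  rw [conj_profile]
  exact (eigen_mulTau τ w).series _ _ u

theorem eigen_conjProfileWOp (u : Ell1 ℕ) :
    Eigen (evalAt τ w) (conjProfileWOp u) (conj (profile u w)) := by
  rw [conj_profile]
  exact (eigen_mulW τ w).series _ _ u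

theorem eigen_derivTauOp (u : Ell1 ℕ) :
    Eigen (evalAt τ w) (derivTauOp u) (circleDeriv (profile u) τ) := by
  rw [(profile_deriv u).2]
  exact (eigen_mulTauInv τ w).derivSeries _ _ u

theorem eigen_derivWOp (u : Ell1 ℕ) :
    Eigen (evalAt τ w) (derivWOp u) (circleDeriv (profile u) w) := by
  rw [(profile_deriv u).2]
  exact (eigen_mulWInv τ w).derivSeries _ _ u

variable {τ w}

theorem eigen_quotOp (h : τ ≠ w) (u : Ell1 ℕ) :
    Eigen (evalAt τ w) (quotOp u) (diffQuot (profile u) τ w) := by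
  rw [diffQuot_profile u h]
  exact (eigen_mulTauInv τ w).quotSeries (eigen_mulWInv τ w) _ _ _ _ u

theorem eigen_conjQuotOp (h : τ ≠ w) (u : Ell1 ℕ) :
    Eigen (evalAt τ w) (conjQuotOp u) (conj (diffQuot (profile u) τ w)) := by
  rw [diffQuot_profile u h, conj_quotSeries _ _ _ _ (by simp [Circle.norm_coe])
    (by simp [Circle.norm_coe])]
  simp only [Complex.conj_conj]
  exact (eigen_mulTau τ w).quotSeries (eigen_mulW τ w) _ _ _ _ u

theorem Eigen.congr {V : Type*} [NormedAddCommGroup V] [NormedSpace ℝ V] {χ : V →L[ℝ] ℂ}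
    {M : V →L[ℝ] V} {c c' : ℂ} (h : Eigen χ M c) (hc : c = c') : Eigen χ M c' := hc ▸ h

/-- `fieldOp` is assembled from the same operations as the integrand, each of which respects
eigenfunctionals; the two inverses require the denominators to be units. -/
theorem eigen_fieldOp (h : τ ≠ w) {γ γ' d η η' Ω A : ℝ} {u v : Ell1 ℕ}
    (h1 : IsUnit (selfDenom η u)) (h2 : IsUnit (crossDenom d η η' u v)) :
    Eigen (evalAt τ w) (fieldOp γ γ' d η η' Ω A u v) (-(γ / 2) * circleDeriv (profile u) w +
      (Ω * η * conj ((w : ℂ) + η * profile u w) - A -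
        γ / 2 * (η * conj (w : ℂ) * selfKernel η (profile u) w τ) +
        γ' / 2 * crossKernel η' (profile v) (d - η * ((w : ℂ) + η * profile u w)) τ) *
        ((w : ℂ) * (1 + η * circleDeriv (profile u) w))) := by
  have hχ := evalAt_ne_zero τ w
  have s1 : Eigen (evalAt τ w) (selfDenom η u) (1 + η * diffQuot (profile u) τ w) :=
    Eigen.one.add ((eigen_quotOp h u).smul η)
  have s2 : Eigen (evalAt τ w) (crossDenom d η η' u v)
      (d * 1 - η * ((w : ℂ) + η * profile u w) - η' * ((τ : ℂ) + η' * profile v τ)) :=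
    ((Eigen.one.smul d).sub (((eigen_mulW τ w).add ((eigen_profileWOp τ w u).smul η)).smul η)).sub
      (((eigen_mulTau τ w).add ((eigen_profileTauOp τ w v).smul η')).smul η')
  refine Eigen.congr ((((eigen_derivWOp τ w u).smul (-(γ / 2))).add
    ((((((((eigen_mulWInv τ w).add ((eigen_conjProfileWOp τ w u).smul η)).smul (Ω * η)).sub
      (Eigen.one.smul A)).sub (((eigen_mulWInv τ w).mul
        ((((eigen_conjQuotOp h u).sub (eigen_quotOp h u)).mul
          ((eigen_derivTauOp τ w u).sub (eigen_quotOp h u))).mul (s1.inverse h1 hχ))).smul (γ / 2 * η))).add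
      (((((eigen_mulTau τ w).mul ((eigen_mulTauInv τ w).add
        ((eigen_conjProfileTauOp τ w v).smul η'))).mul
        (Eigen.one.add ((eigen_derivTauOp τ w v).smul η'))).mul (s2.inverse h2 hχ)).smul (γ' / 2))).mul
      ((eigen_mulW τ w).mul (Eigen.one.add ((eigen_derivWOp τ w u).smul η))))))) ?_
  rw [selfKernel, crossKernel, div_eq_mul_inv _ (1 + _), div_eq_mul_inv _ (_ - _)]
  simp only [map_add, map_mul, Complex.conj_ofReal]
  push_cast
  ring

/-- The basis vector `(0, 0)` represents the constant function `1`, so evaluation returns the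
integrand off the diagonal, and the mean over `τ` ignores the diagonal. -/
theorem circleMean_evalAt_fieldOp {γ γ' d κ η η' Ω A : ℝ} {u v : Ell1 ℕ} (hd : 0 < d)
    (hκ : κ ≤ 1 / 4) (hκd : κ ≤ d / 8) (hη : |η| ≤ κ) (hη' : |η'| ≤ κ) (hu : ‖u‖ ≤ 1) (hv : ‖v‖ ≤ 1)
    (h1 : IsUnit (selfDenom η u)) (h2 : IsUnit (crossDenom d η η' u v)) (w : Circle) :
    circleMean (fun τ => evalAt τ w (fieldOp γ γ' d η η' Ω A u v (Ell1.basis (0, 0)))) =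
      reducedField γ γ' η η' d Ω A (profile u) (profile v) w := by
  have bu := unitBounded_profile hu
  have bv := unitBounded_profile hv
  have t1 := tame_selfKernel (isProfile_profile u) (bu.eta_le (hη.trans hκ)) w
  have t2 := tame_crossKernel hd hκ hκd hη hη' bu bv (isProfile_profile v) w
  have e : ∀ τ, τ ≠ w → evalAt τ w (fieldOp γ γ' d η η' Ω A u v (Ell1.basis (0, 0))) =
      -(γ / 2) * circleDeriv (profile u) w +
      ((Ω * η * conj ((w : ℂ) + η * profile u w) - A) -
        γ / 2 * (η * conj (w : ℂ)) * selfKernel η (profile u) w τ +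
        γ' / 2 * crossKernel η' (profile v) (d - η * ((w : ℂ) + η * profile u w)) τ) *
        ((w : ℂ) * (1 + η * circleDeriv (profile u) w)) := fun τ h => by
    rw [eigen_fieldOp h h1 h2, evalAt_basis_zero, mul_one, mul_assoc (γ / 2 : ℂ)]
  rw [circleMean_congr e, reducedField]
  have t3 := (Tame.const (Ω * η * conj ((w : ℂ) + η * profile u w) - A)).sub
    ((Tame.const (γ / 2 * (η * conj (w : ℂ)))).mul t1)
  have t4 := (Tame.const (γ' / 2)).mul t2
  rw [circleMean_add (Tame.const _) ((t3.add t4).mul (Tame.const _)), circleMean_const,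
    circleMean_mul_const, circleMean_add t3 t4, circleMean_sub (Tame.const _)
    ((Tame.const _).mul t1), circleMean_const, circleMean_const_mul, circleMean_const_mul, mul_assoc (γ / 2 : ℂ)]

end Evaluation

/-! ### Smoothness -/

section Smoothness

variable {E : Type*} [NormedAddCommGroup E] [NormedSpace ℝ E] {n : WithTop ℕ∞} {x : E}

theorem contDiffAt_ringInverse_comp {B : Type*} [NormedRing B] [NormedAlgebra ℝ B] [CompleteSpace B]
    {M : E → B} (hM : ContDiffAt ℝ n M x) (h : IsUnit (M x)) :
    ContDiffAt ℝ n (fun y => Ring.inverse (M y)) x := by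
  obtain ⟨m, hm⟩ := h
  exact ContDiffAt.comp x (hm ▸ contDiffAt_ringInverse ℝ m) hM

variable {η η' Ω A : E → ℝ} {u v : E → Ell1 ℕ}

theorem contDiffAt_selfDenom (hη : ContDiffAt ℝ n η x) (hu : ContDiffAt ℝ n u x) :
    ContDiffAt ℝ n (fun y => selfDenom (η y) (u y)) x := by
  unfold selfDenom
  fun_prop

theorem contDiffAt_crossDenom (hη : ContDiffAt ℝ n η x) (hη' : ContDiffAt ℝ n η' x)
    (hu : ContDiffAt ℝ n u x) (hv : ContDiffAt ℝ n v x) (d : ℝ) :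
    ContDiffAt ℝ n (fun y => crossDenom d (η y) (η' y) (u y) (v y)) x := by
  unfold crossDenom
  fun_prop

/-- Apart from continuous linear maps, scalar multiplications and products, only the two inverses
occur, and inversion in a Banach algebra is smooth at units. -/
theorem contDiffAt_fieldOp (hη : ContDiffAt ℝ n η x) (hη' : ContDiffAt ℝ n η' x)
    (hu : ContDiffAt ℝ n u x) (hv : ContDiffAt ℝ n v x)
    (hΩ : ContDiffAt ℝ n Ω x) (hA : ContDiffAt ℝ n A x) (γ γ' d : ℝ)
    (h1 : IsUnit (selfDenom (η x) (u x))) (h2 : IsUnit (crossDenom d (η x) (η' x) (u x) (v x))) :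
    ContDiffAt ℝ n (fun y => fieldOp γ γ' d (η y) (η' y) (Ω y) (A y) (u y) (v y)) x := by
  have i1 := contDiffAt_ringInverse_comp (contDiffAt_selfDenom hη hu) h1
  have i2 := contDiffAt_ringInverse_comp (contDiffAt_crossDenom hη hη' hu hv d) h2
  unfold fieldOp
  fun_prop

end Smoothness

/-! ### Existence of a branch -/

/-- The factor `1 / 2 ^ (n + 2)` in `derivSeriesTerm` cancels the weight of the frequency `-(n +
2)`, and the signs agree, so coordinate `n + 1` returns unchanged. Slot `0` corresponds to frequency
one and stays empty. -/
theorem oddPart_derivWOp (u : Ell1 ℕ) :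
    oddPart (derivWOp u (Ell1.basis (0, 0))) = u - u 0 • Ell1.basis 0 := by
  have h : (oddPart.comp (ContinuousLinearMap.apply ℝ (Ell1 (ℤ × ℤ)) (Ell1.basis (0, 0)))).comp derivWOp =
      ContinuousLinearMap.id ℝ (Ell1 ℕ) - (Ell1.coord 0).smulRight (Ell1.basis 0) := by
    refine Ell1.ext_clm fun n => ?_
    simp only [ContinuousLinearMap.comp_apply, ContinuousLinearMap.apply_apply, sub_apply,
      ContinuousLinearMap.id_apply, ContinuousLinearMap.smulRight_apply, Ell1.coord_apply,
      Ell1.basis_apply]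
    rw [derivWOp, derivSeries, l1Lift_basis]
    rcases n with _ | n
    · simp [derivSeriesTerm]
    · rw [derivSeriesTerm, mulWInv, shift_pow, smul_apply, shift_basis_zero,
        map_smul, map_smul, oddPart_basis, oddPartTerm, if_pos (by simp), if_neg (by push_cast; omega),
        if_pos (by push_cast; omega), smul_neg, smul_neg, smul_smul, if_neg (by omega), zero_smul, sub_zero,
        ← neg_smul]
      have e : (-((((n + 2 : ℕ) : ℤ)) * -1)).toNat - 1 = n + 1 := by omega
      simp only [e]
      have e2 : weight (((n + 2 : ℕ) : ℤ) * -1) = 2 ^ (n + 2) := by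
        rw [weight]; congr 1; omega
      rw [e2]
      have : -(-(1 / 2 ^ (n + 2)) * 2 ^ (n + 2) : ℝ) = 1 := by field_simp
      rw [this, one_smul]
  have := DFunLike.congr_fun h u
  simpa only [ContinuousLinearMap.comp_apply, ContinuousLinearMap.apply_apply, sub_apply,
      ContinuousLinearMap.id_apply, ContinuousLinearMap.smulRight_apply, Ell1.coord_apply] using this

/-- Multiplication by `w` fills the slot that the derivative leaves empty; the factor `2` is the
weight of frequency one. -/
theorem oddPart_mulW : oddPart (mulW (Ell1.basis (0, 0))) = (2 : ℝ) • Ell1.basis 0 := by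
  rw [mulW, shift_basis_zero, map_smul, oddPart_basis]
  simp [oddPartTerm, weight]

theorem selfDenom_zero (u : Ell1 ℕ) : selfDenom 0 u = 1 := by simp [selfDenom]

theorem crossDenom_zero (d : ℝ) (u v : Ell1 ℕ) : crossDenom d 0 0 u v = d • 1 := by simp [crossDenom]

theorem isUnit_smul_one {B : Type*} [Ring B] [Algebra ℝ B] {d : ℝ} (hd : d ≠ 0) :
    IsUnit (d • (1 : B)) := by
  rw [← Algebra.algebraMap_eq_smul_one]
  exact (isUnit_iff_ne_zero.2 hd).map (algebraMap ℝ B)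

theorem ringInverse_smul_one {B : Type*} [Ring B] [Algebra ℝ B] {d : ℝ} (hd : d ≠ 0) :
    Ring.inverse (d • (1 : B)) = d⁻¹ • (1 : B) := by
  have h := Ring.mul_inverse_cancel _ (isUnit_smul_one (B := B) hd)
  rw [smul_mul_assoc, one_mul] at h
  exact ((inv_smul_eq_iff₀ hd).2 h.symm).symm

theorem fieldOp_zero (γ γ' : ℝ) {d : ℝ} (hd : d ≠ 0) (Ω A : ℝ) (u v : Ell1 ℕ) :
    fieldOp γ γ' d 0 0 Ω A u v = (-(γ / 2)) • derivWOp u + (γ' / (2 * d) - A) • mulW := by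
  have h : mulTau * mulTauInv = 1 := by
    rw [mulTau, mulTauInv, shift_mul_shift]; exact shift_zero_zero
  rw [fieldOp, selfDenom_zero, crossDenom_zero, ringInverse_smul_one hd]
  simp only [mul_zero, zero_smul, add_zero, zero_sub, sub_zero, mul_one, h, one_mul, add_mul,
    smul_smul, neg_mul, smul_mul_assoc, sub_smul]
  rw [add_right_inj, sub_eq_add_neg, add_comm]
  congr 2
  field_simp

section Branch

variable (γ b : Fin 2 → ℝ) (d : ℝ)

/-- The distance from a vortex to the centre of rotation times the angular velocity. -/
noncomputable def offset (j : Fin 2) (u : Fin 2 → Ell1 ℕ) : ℝ :=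
  γ (1 - j) / (2 * d) + γ j / 4 * Ell1.coord 0 (u j)

/-- The angular velocity. -/
noncomputable def angularSpeed (u : Fin 2 → Ell1 ℕ) : ℝ := (offset γ d 0 u + offset γ d 1 u) / d

/-- The nonlinear map whose zeros are the co-rotating pairs. -/
noncomputable def residual (p : ℝ × (Fin 2 → Ell1 ℕ)) (j : Fin 2) : Ell1 ℕ :=
  (-(2 / γ j)) • oddPart (fieldOp (γ j) (γ (1 - j)) d (p.1 * b j) (p.1 * b (1 - j))
    (angularSpeed γ d p.2) (offset γ d j p.2) (p.2 j) (p.2 (1 - j)) (Ell1.basis (0, 0)))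

variable {γ b d}

theorem contDiff_offset (j : Fin 2) : ContDiff ℝ 1 (offset γ d j) := by
  unfold offset
  fun_prop

theorem contDiff_angularSpeed : ContDiff ℝ 1 (angularSpeed γ d) := by
  have h0 := contDiff_offset (γ := γ) (d := d) 0
  have h1 := contDiff_offset (γ := γ) (d := d) 1
  unfold angularSpeed
  fun_prop

/-- The derivative part reproduces all coordinates except the first, and the deviation `γ j / 4 * u
0` of the speed reproduces the first. The constants in `offset` and the factor `-(2 / γ j)` are
normalized for this. -/
theorem residual_zero (hγ : ∀ j, γ j ≠ 0) (hd : d ≠ 0) (u : Fin 2 → Ell1 ℕ) :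
    residual γ b d (0, u) = u := by
  ext1 j
  have hj := hγ j
  simp only [residual, zero_mul]
  rw [fieldOp_zero _ _ hd, add_apply, smul_apply, smul_apply, map_add, map_smul, map_smul,
    oddPart_derivWOp, oddPart_mulW, offset, Ell1.coord_apply, sub_add_cancel_left, smul_add, smul_smul,
    smul_smul, smul_smul, smul_sub, smul_smul]
  rw [show -(2 / γ j) * -(γ j / 2) = 1 by field_simp, one_smul, one_mul,
    show -(2 / γ j) * -(γ j / 4 * u j 0) * 2 = u j 0 by field_simp; ring]
  exact sub_add_cancel _ _

theorem contDiffAt_residual (hd : d ≠ 0) : ContDiffAt ℝ 1 (residual γ b d) (0, 0) := by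
  refine contDiffAt_pi.2 fun j => ?_
  have h := contDiffAt_fieldOp (E := ℝ × (Fin 2 → Ell1 ℕ)) (n := 1) (x := (0, 0))
    (η := fun p => p.1 * b j) (η' := fun p => p.1 * b (1 - j)) (u := fun p => p.2 j)
    (v := fun p => p.2 (1 - j)) (Ω := fun p => angularSpeed γ d p.2) (A := fun p => offset γ d j p.2)
    (by fun_prop) (by fun_prop) (by fun_prop) (by fun_prop)
    (contDiff_angularSpeed.comp contDiff_snd).contDiffAt ((contDiff_offset j).comp contDiff_snd).contDiffAt
    (γ j) (γ (1 - j)) d (by simp only [zero_mul, selfDenom_zero]; exact isUnit_one)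
    (by simp only [zero_mul, crossDenom_zero]; exact isUnit_smul_one hd)
  unfold residual
  fun_prop

theorem isInvertible_fderiv_residual (hγ : ∀ j, γ j ≠ 0) (hd : d ≠ 0) :
    (fderiv ℝ (residual γ b d) (0, 0) ∘SL
      ContinuousLinearMap.inr ℝ ℝ (Fin 2 → Ell1 ℕ)).IsInvertible := by
  have h1 := ((contDiffAt_residual (γ := γ) (b := b) hd).differentiableAt one_ne_zero).hasFDerivAt
  have h2 : HasFDerivAt (fun u : Fin 2 → Ell1 ℕ => ((0 : ℝ), u))
      (ContinuousLinearMap.inr ℝ ℝ (Fin 2 → Ell1 ℕ)) 0 := hasFDerivAt_prodMk_right _ _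
  have h3 := HasFDerivAt.comp (g := residual γ b d) 0 h1 h2
  have h4 : residual γ b d ∘ (fun u : Fin 2 → Ell1 ℕ => ((0 : ℝ), u)) = id :=
    funext fun u => residual_zero hγ hd u
  rw [h4] at h3
  rw [h3.unique (hasFDerivAt_id _)]
  exact ⟨ContinuousLinearEquiv.refl ℝ _, rfl⟩

theorem exists_solution_curve (hγ : ∀ j, γ j ≠ 0) (hd : d ≠ 0) :
    ∃ ψ : ℝ → Fin 2 → Ell1 ℕ, ψ 0 = 0 ∧ ContDiffAt ℝ 1 ψ 0 ∧
      ∀ᶠ ε in 𝓝 (0 : ℝ), residual γ b d (ε, ψ ε) = 0 := by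
  have h := contDiffAt_residual (γ := γ) (b := b) hd
  have hi := isInvertible_fderiv_residual (b := b) hγ hd
  refine ⟨h.implicitFunction one_ne_zero hi, h.implicitFunction_apply_self one_ne_zero hi,
    h.contDiffAt_implicitFunction one_ne_zero hi, ?_⟩
  filter_upwards [h.eventually_apply_implicitFunction one_ne_zero hi] with ε hε
  rw [hε, residual_zero hγ hd]

/-- With `Z` the quotient of the first offset by `Ω`, the speed `Ω * Z` is the first offset, and `Ω
* (d - Z)` is the second because `Ω * d` is their sum. -/
theorem rotatesUniformly_of_residual {κ ε : ℝ} {u : Fin 2 → Ell1 ℕ} (hγ : ∀ j, γ j ≠ 0)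
    (hd : 0 < d) (hκ : κ ≤ 1 / 4) (hκd : κ ≤ d / 8) (hε : ∀ j, |ε * b j| ≤ κ)
    (hε0 : ∀ j, ε * b j ≠ 0) (hu : ∀ j, ‖u j‖ ≤ 1)
    (h1 : ∀ j, IsUnit (selfDenom (ε * b j) (u j)))
    (h2 : ∀ j, IsUnit (crossDenom d (ε * b j) (ε * b (1 - j)) (u j) (u (1 - j))))
    (hs : angularSpeed γ d u ≠ 0) (hr : residual γ b d (ε, u) = 0) :
    RotatesUniformly γ b ε (angularSpeed γ d u) (offset γ d 0 u / angularSpeed γ d u)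
      (patchBoundary b d ε (conformalMap b ε fun j => profile (u j))) := by
  have bu := fun j => unitBounded_profile (hu j)
  rw [rotatesUniformly_iff (fun j => isProfile_profile (u j)) hε0
    (fun j => (bu j).eta_le ((hε j).trans hκ)) fun j w τ =>
      (half_pos hd).trans_le (le_re_separation hκ hκd (hε j) (hε _) (bu j) (bu _) w τ)]
  have hA : ∀ j, (![angularSpeed γ d u * (offset γ d 0 u / angularSpeed γ d u),
      angularSpeed γ d u * (d - offset γ d 0 u / angularSpeed γ d u)] : Fin 2 → ℝ) j = offset γ d j u := by
    rw [Fin.forall_fin_two]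
    refine ⟨mul_div_cancel₀ _ hs, ?_⟩
    change angularSpeed γ d u * (d - offset γ d 0 u / angularSpeed γ d u) = _
    rw [mul_sub, mul_div_cancel₀ _ hs, angularSpeed, div_mul_cancel₀ _ hd.ne', add_sub_cancel_left]
  intro j w
  rw [hA, ← circleMean_evalAt_fieldOp hd hκ hκd (hε j) (hε _) (hu j) (hu _) (h1 j) (h2 j) w]
  refine circleMean_evalAt_im_of_oddPart ?_ w
  have := congrFun hr j
  simp only [residual, Pi.zero_apply, smul_eq_zero, neg_eq_zero, div_eq_zero_iff, hγ, or_false,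
    OfNat.ofNat_ne_zero, false_or] at this
  exact this

theorem holderNorm_profile_lt_one {α : ℝ≥0} (hα : α ≤ 1) {u : Ell1 ℕ} (hu : ‖u‖ < 1 / 4) :
    holderNorm α (profile u) < 1 := by
  refine (holderNorm_profile_le hα u).trans_lt ?_
  rw [← ofReal_norm, ← ENNReal.ofReal_ofNat, ← ENNReal.ofReal_mul (by norm_num), ENNReal.ofReal_lt_one]
  linarith

theorem exists_isCorotatingBranch {α : ℝ≥0} (hα : α ≤ 1) (hγ : ∀ j, γ j ≠ 0) (hγs : γ 0 + γ 1 ≠ 0)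
    (hb : ∀ j, 0 < b j) (hd : 0 < d) :
    ∃ ε₀ : ℝ, 0 < ε₀ ∧ ε₀ < 1 / 2 ∧ ∃ (Ω Z : ℝ → ℝ) (f : ℝ → Fin 2 → Circle → ℂ),
      IsCorotatingBranch α γ b d ε₀ Ω Z f := by
  obtain ⟨ψ, hψ0, hψ, hres⟩ := exists_solution_curve (b := b) hγ hd.ne'
  have hκ : 0 < min (1 / 4) (d / 8) := lt_min (by norm_num) (by linarith)
  have hoff : ∀ j, offset γ d j 0 = γ (1 - j) / (2 * d) := fun j => by simp [offset]
  have hspeed : angularSpeed γ d 0 = (γ 0 + γ 1) / (2 * d ^ 2) := by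
    rw [angularSpeed, hoff, hoff, sub_zero, sub_self]
    field_simp
    ring
  have e1 : ∀ᶠ ε in 𝓝 (0 : ℝ), ContDiffAt ℝ 1 ψ ε := hψ.eventually (by simp)
  -- The bound `1 / 4` is matched to the constant `4` of `holderNorm_profile_le`.
  have e2 : ∀ j, ∀ᶠ ε in 𝓝 (0 : ℝ), ‖ψ ε j‖ < 1 / 4 := fun j => by
    have : ContinuousAt (fun ε => ‖ψ ε j‖) 0 := ((continuousAt_pi.1 hψ.continuousAt) j).norm
    exact this.eventually_lt_const (by simp [hψ0])
  have e3 : ∀ j, ∀ᶠ ε in 𝓝 (0 : ℝ), IsUnit (selfDenom (ε * b j) (ψ ε j)) := fun j => by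
    have := (contDiffAt_selfDenom (n := 1) (x := (0 : ℝ)) (η := fun ε => ε * b j)
      (u := fun ε => ψ ε j) (by fun_prop) (contDiffAt_pi.1 hψ j)).continuousAt
    refine this.eventually_mem (Units.isOpen.mem_nhds ?_)
    simp only [zero_mul, selfDenom_zero]
    exact isUnit_one
  have e4 : ∀ j, ∀ᶠ ε in 𝓝 (0 : ℝ),
      IsUnit (crossDenom d (ε * b j) (ε * b (1 - j)) (ψ ε j) (ψ ε (1 - j))) := fun j => by
    have := (contDiffAt_crossDenom (n := 1) (x := (0 : ℝ)) (η := fun ε => ε * b j)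
      (η' := fun ε => ε * b (1 - j)) (u := fun ε => ψ ε j) (v := fun ε => ψ ε (1 - j))
      (by fun_prop) (by fun_prop) (contDiffAt_pi.1 hψ j) (contDiffAt_pi.1 hψ _) d).continuousAt
    refine this.eventually_mem (Units.isOpen.mem_nhds ?_)
    simp only [zero_mul, crossDenom_zero]
    exact isUnit_smul_one hd.ne'
  -- The centre is a quotient by the angular velocity, which is nonzero at `ε = 0` since `γ 0 + γ 1
  -- ≠ 0`.
  have e5 : ∀ᶠ ε in 𝓝 (0 : ℝ), angularSpeed γ d (ψ ε) ≠ 0 := by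
    have : ContinuousAt (fun ε => angularSpeed γ d (ψ ε)) 0 :=
      contDiff_angularSpeed.continuous.continuousAt.comp hψ.continuousAt
    refine this.eventually_ne ?_
    rw [hψ0, hspeed]
    positivity
  have e6 : ∀ j, ∀ᶠ ε in 𝓝 (0 : ℝ), |ε * b j| < min (1 / 4) (d / 8) := fun j => by
    have : ContinuousAt (fun ε => |ε * b j|) 0 := by fun_prop
    exact this.eventually_lt_const (by simpa using hκ)
  obtain ⟨r, hr, H⟩ := Metric.eventually_nhds_iff.1 ((((((eventually_all.2 e2).and
    (eventually_all.2 e3)).and (eventually_all.2 e4)).and (eventually_all.2 e6)).and (e1.and e5)).and hres)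
  -- Half of `r` places the closed interval inside the open neighbourhood; `1 / 4` ensures `ε₀ < 1 /
  -- 2`.
  have hr0 : 0 < min (r / 2) (1 / 4) := lt_min (by linarith) (by norm_num)
  have H' : ∀ ε ∈ Icc (-min (r / 2) (1 / 4)) (min (r / 2) (1 / 4)), _ := fun ε hε => @H ε (by
    rw [Real.dist_eq, sub_zero]
    exact (abs_le.2 hε).trans_lt ((min_le_left _ _).trans_lt (by linarith)))
  refine ⟨min (r / 2) (1 / 4), hr0, (min_le_right _ _).trans_lt (by norm_num),
    fun ε => angularSpeed γ d (ψ ε), fun ε => offset γ d 0 (ψ ε) / angularSpeed γ d (ψ ε),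
    fun ε j => profile (ψ ε j), ?_⟩
  have hcd : ∀ ε ∈ Icc (-min (r / 2) (1 / 4)) (min (r / 2) (1 / 4)), ContDiffAt ℝ 1 ψ ε :=
    fun ε hε => (H' ε hε).1.2.1
  have hΩ : ∀ ε ∈ Icc (-min (r / 2) (1 / 4)) (min (r / 2) (1 / 4)),
      ContDiffAt ℝ 1 (fun ε => angularSpeed γ d (ψ ε)) ε := fun ε hε =>
    contDiff_angularSpeed.contDiffAt.comp ε (hcd ε hε)
  constructor
  · exact fun ε hε => (hΩ ε hε).contDiffWithinAt
  · exact fun ε hε => (((contDiff_offset 0).contDiffAt.comp ε (hcd ε hε)).div (hΩ ε hε)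
      (H' ε hε).1.2.2).contDiffWithinAt
  · intro j
    refine isC1Curve_profile hα (u' := fun ε => deriv ψ ε j) (fun ε hε => ?_) fun ε hε => ?_
    · exact hasDerivAt_pi.1 ((hcd ε hε).differentiableAt one_ne_zero).hasDerivAt j
    · have h1 : ContinuousAt (fderiv ℝ ψ) ε :=
        ((hcd ε hε).fderiv_right (m := 0) (by norm_num)).continuousAt
      have h2 : ContinuousAt (deriv ψ) ε := h1.clm_apply continuousAt_const
      exact ((continuousAt_pi.1 h2) j).continuousWithinAt
  · exact fun ε hε j => holderNorm_profile_lt_one hα ((H' ε hε).1.1.1.1.1 j)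
  · simp only [hψ0, hspeed]
  · simp only [hψ0, hspeed, hoff, sub_zero]
    field_simp
  · intro j w
    simp [hψ0, profile]
  · intro ε hε j
    obtain ⟨⟨⟨⟨⟨h2, h3⟩, h4⟩, h6⟩, h1, h5⟩, h7⟩ := H' ε hε
    have := isConformalParam_of_norm_le (u := ψ ε j) (η := ε * b j) (by
      have k1 := (h6 j).trans_le (min_le_left _ _)
      have k2 := h2 j
      have := norm_nonneg (ψ ε j)
      have := abs_nonneg (ε * b j)
      nlinarith)
    rwa [Complex.ofReal_mul] at this
  · intro ε hε hε0
    obtain ⟨⟨⟨⟨⟨h2, h3⟩, h4⟩, h6⟩, h1, h5⟩, h7⟩ := H' ε hε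
    exact rotatesUniformly_of_residual hγ hd (min_le_left _ _) (min_le_right _ _) (fun j => (h6 j).le)
      (fun j => mul_ne_zero hε0 (hb j).ne') (fun j => (h2 j).le.trans (by norm_num)) h3 h4 h5 h7

end Branch

end VortexPair

/-- Here `γ 0, γ 1` are `γ₁, γ₂`, likewise for `b`, and `1 - j` is the index of the other patch. -/
theorem mainTheorem3 (α : ℝ≥0) (hα₀ : 0 < α) (hα₁ : α < 1)
    (γ b : Fin 2 → ℝ) (d : ℝ)
    (hγ : ∀ j, γ j ≠ 0) (hγs : γ 0 + γ 1 ≠ 0)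
    (hb : ∀ j, 0 < b j) (hd : 2 * (b 0 + b 1) < d) :
    (∃ ε₀ : ℝ, 0 < ε₀ ∧ ε₀ < 1 / 2 ∧ ∃ (Ω Z : ℝ → ℝ) (f : ℝ → Fin 2 → Circle → ℂ),
      VortexPair.IsCorotatingBranch α γ b d ε₀ Ω Z f) ∧
    (∀ (ε₀ : ℝ) (Ω Z : ℝ → ℝ) (f : ℝ → Fin 2 → Circle → ℂ), 0 < ε₀ →
      VortexPair.IsCorotatingBranch α γ b d ε₀ Ω Z f →
      (∀ (j : Fin 2) (c : ℝ), 0 < c → ∀ᶠ ε in 𝓝 (0 : ℝ), ∀ w : Circle,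
        ‖VortexPair.conformalMap b ε (f ε) j w -
          VortexPair.conformalExpansion (γ (1 - j) / γ j) (ε * b j / d) w‖ ≤ c * |ε| ^ 5) ∧
      (fun ε : ℝ => Ω ε - ((γ 0 + γ 1) / (2 * d ^ 2) +
          ε ^ 4 / (2 * d ^ 6) * (γ 0 * b 1 ^ 4 + γ 1 * b 0 ^ 4))) =o[𝓝 0] (fun ε : ℝ => ε ^ 4) ∧
      (fun ε : ℝ => Z ε - (γ 1 * d / (γ 0 + γ 1) +
          ε ^ 4 / (d ^ 3 * (γ 0 + γ 1) ^ 2) *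
            (γ 1 ^ 3 / γ 0 * b 0 ^ 4 - γ 0 ^ 3 / γ 1 * b 1 ^ 4))) =o[𝓝 0]
        (fun ε : ℝ => ε ^ 4)) := by
  have hd' : 0 < d := by linarith [hb 0, hb 1]
  have hlt : (fun ε : ℝ => ε ^ 5) =o[𝓝 0] fun ε : ℝ => ε ^ 4 := isLittleO_pow_pow (by norm_num)
  exact ⟨VortexPair.exists_isCorotatingBranch hα₁.le hγ hγs hb hd', fun ε₀ Ω Z f hε₀ h =>
    ⟨fun j c hc => h.conformalMap_sub_le hα₀ hγ hb hd' hε₀ j hc,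
      (h.isBigO_Ω hα₀ hγ hγs hb hd' hε₀).trans_isLittleO hlt,
      (h.isBigO_Z hα₀ hγ hγs hb hd' hε₀).trans_isLittleO hlt⟩⟩
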